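/- **Proposition (Optimistic bias for kNN).** Let $d_x\ge 1$, let $\mathcal Y$ be a measurable space, $\mathcal Z\subset\mathbb R^{d_z}$, and let $\ell:\mathbb R^{d_z}\times\mathcal Y\to\mathbb R$ be a (jointly measurable) cost. For a probability law $Q$ on $\mathcal Y$ write $v_Q(z)=\mathbb E_{Y\sim Q}[\ell(z;Y)]$. Fix $M$, and say that $Q$ satisfies (A) with optimal decision $z^*\in\mathcal Z$ if 1. $v_Q$ is twice differentiable on $\mathcal Z$; 2. $\ell(\cdot;y)$ is twice differentiable on $\mathcal Z$ for every $y$, and for $Q$-almost every $y$ and all $z,w\in\mathcal Z$: $|\ell(z;y)|\le M$, $\|\nabla_z\ell(z;y)\|\le M$ and $|\ell(z;y)-\ell(w;y)|\le M\|z-w\|$ (the last bound follows from the gradient bound if $\mathcal Z$ is convex); 3. $\mathcal Z$ is open and bounded; $z^*$ is the unique, well-separated minimizer of $v_Q$ over $\mathcal Z$ (for each $\varepsilon>0$, $\inf\{v_Q(z):z\in\mathcal Z,\|z-z^*\|\ge\varepsilon\}>v_Q(z^*)$); $\nabla v_Q(z^*)=0$ and $\nabla^2v_Q(z^*)$ is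 positive definite. Suppose that some law $Q_0$ satisfies (A) with optimal decision $z_0$, and that $\nabla_z\ell(z_0;Y)$ is not $Q_0$-almost surely zero. Let $0<\gamma_v\le 1/2$ and let $k_n\le n$ be integers with $k_n=\Theta(n^{2\gamma_v})$. A kNN learner on data $\mathcal D_n=((X_i,Y_i))_{i\le n}$ is a measurable map $\hat z(x)=\hat z(\mathcal D_n;x)$ with $$\hat z(x)\in\operatorname*{argmin}_{z\in\mathcal Z}\ \sum_{i\in N_n(x)}\ell(z;Y_i),$$ where $N_n(x)$ is a set of $k_n$ nearest neighbours of $x$ among $X_1,\dots,X_n$ (distance ties broken arbitrarily), where the choice among several minimizers depends only on the objective function, and where $\hat z(x)\in\mathcal Z$ is any point, also depending only on the objective function, if no minimizer exists. Then for each $n$ there is a distribution $P_n$ of $(X,Y)$ on $\mathbb R^{d_x}\times\mathcal Y$ of the following form. With $m_n=\max\{1,\lfloor n/(2k_n)\rfloor\}$, there are bounded measurable regions $R_1,\dots,R_{m_n}\subset\mathbb R^{d_x}$ (depending on $n$) of the same positive volume with $\operatorname{diam}(R_i)<d(R_i,R_j)$ for $i\ne j$, and laws $Q_1,Q_2,\dots$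 on $\mathcal Y$ (not depending on $n$), each satisfying (A) with the same $M$, such that $P_n$ is the equal-weight mixture over $j\le m_n$ of the laws under which $X$ is uniform on $R_j$ and $Y\mid X\sim Q_j$. For every kNN learner, with $\mathcal D_n$ an i.i.d. sample of size $n$ from $P_n$, $c(z)=\mathbb E_{P_n}[\ell(z(X);Y)]$ and $c_n(z)=\frac1n\sum_{i\le n}\ell(z(X_i);Y_i)$: * $\hat z$ has variability rate $\gamma_v$, i.e. there are constants $0<c_1\le c_2$ such that for all large $n$ and $P_n$-almost every $x$, $c_1n^{-\gamma_v}\le\mathbb E_{\mathcal D_n}\|\hat z(x)-\mathbb E_{\mathcal D_n}[\hat z(x)]\|\le c_2n^{-\gamma_v}$; * $c_n(\hat z)$ and $c(\hat z)$ are integrable for every $n$, $\mathbb E_{\mathcal D_n}[c_n(\hat z)-c(\hat z)]<0$ for all large $n$, and $$\mathbb E_{\mathcal D_n}[c_n(\hat z)-c(\hat z)]=\Theta(1/k_n)=\Theta(n^{-2\gamma_v})$$ (orders of magnitude of the absolute value). -/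

import Mathlib

open MeasureTheory Filter Asymptotics
open scoped ENNReal Topology

noncomputable section

namespace KNNBias

/-- Twice differentiability at every point of an open set. -/
def TwiceDifferentiable {dz : ℕ} (f : EuclideanSpace ℝ (Fin dz) → ℝ)
    (Z : Set (EuclideanSpace ℝ (Fin dz))) : Prop :=
  ∀ z ∈ Z, DifferentiableAt ℝ f z ∧ DifferentiableAt ℝ (fderiv ℝ f) z

/-- The expected cost `v(z) = E_{Y ∼ Q} [ℓ(z; Y)]` of a decision `z`. -/
def expectedCost {dz : ℕ} {Y : Type*} [MeasurableSpace Y]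
    (ℓ : EuclideanSpace ℝ (Fin dz) → Y → ℝ) (Q : Measure Y)
    (z : EuclideanSpace ℝ (Fin dz)) : ℝ :=
  ∫ y, ℓ z y ∂Q

/-- Smoothness of the expected cost, regularity of the cost, and optimality conditions, for one
conditional law `Q` of the outcome, with bound `M` and optimal decision `zstar`. A joint law
satisfies these assumptions when its conditional laws given `X = x` do for all `x`. -/
structure Assumptions {dz : ℕ} {Y : Type*} [MeasurableSpace Y]
    (M : ℝ) (ℓ : EuclideanSpace ℝ (Fin dz) → Y → ℝ) (Z : Set (EuclideanSpace ℝ (Fin dz)))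
    (Q : Measure Y) (zstar : EuclideanSpace ℝ (Fin dz)) : Prop where
  isProbabilityMeasure : IsProbabilityMeasure Q
  smooth_expectedCost : TwiceDifferentiable (expectedCost ℓ Q) Z
  smooth_cost : ∀ y, TwiceDifferentiable (fun z => ℓ z y) Z
  cost_bounded : ∀ᵐ y ∂Q, ∀ z ∈ Z, |ℓ z y| ≤ M
  gradient_bounded : ∀ᵐ y ∂Q, ∀ z ∈ Z, ‖fderiv ℝ (fun w => ℓ w y) z‖ ≤ M
  /-- On a convex `Z` this is the same as the bound on the gradient. -/
  cost_lipschitz : ∀ᵐ y ∂Q, ∀ z ∈ Z, ∀ w ∈ Z, |ℓ z y - ℓ w y| ≤ M * dist z w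
  isOpen : IsOpen Z
  isBounded : Bornology.IsBounded Z
  mem : zstar ∈ Z
  /-- `zstar` is the minimizer of the expected cost, unique and well separated. -/
  wellSeparated : ∀ ε > 0, ∃ η > 0, ∀ z ∈ Z, ε ≤ dist z zstar →
    expectedCost ℓ Q zstar + η ≤ expectedCost ℓ Q z
  first_order : fderiv ℝ (expectedCost ℓ Q) zstar = 0
  second_order : ∀ h : EuclideanSpace ℝ (Fin dz), h ≠ 0 →
    0 < (fderiv ℝ (fderiv ℝ (expectedCost ℓ Q)) zstar h) h

/-- `S` is a set of (indices of) `k` nearest neighbours of `x` among the covariates `X i`;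
ties in the distances may be broken in any way. -/
def IsNearestNeighborSet {dx n : ℕ} (k : ℕ) (X : Fin n → EuclideanSpace ℝ (Fin dx))
    (x : EuclideanSpace ℝ (Fin dx)) (S : Finset (Fin n)) : Prop :=
  S.card = k ∧ ∀ i ∈ S, ∀ j ∉ S, dist (X i) x ≤ dist (X j) x

/-- `argmin` is a way to pick a minimizer over `Z` of an objective that has one. -/
def IsArgminRule {dz : ℕ} (Z : Set (EuclideanSpace ℝ (Fin dz)))
    (argmin : (EuclideanSpace ℝ (Fin dz) → ℝ) → EuclideanSpace ℝ (Fin dz)) : Prop :=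
  ∀ f, argmin f ∈ Z ∧ ((∃ z ∈ Z, IsMinOn f Z z) → IsMinOn f Z (argmin f))

/-- The kNN learner on `n` data points: the decision at `x` is a minimizer over `Z` of the total
cost over `k` nearest neighbours of `x`. -/
def IsKNNLearner {dx dz : ℕ} {Y : Type*} [MeasurableSpace Y]
    (ℓ : EuclideanSpace ℝ (Fin dz) → Y → ℝ) (Z : Set (EuclideanSpace ℝ (Fin dz))) (n k : ℕ)
    (zhat : (Fin n → EuclideanSpace ℝ (Fin dx) × Y) → EuclideanSpace ℝ (Fin dx) →
      EuclideanSpace ℝ (Fin dz)) : Prop :=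
  Measurable (Function.uncurry zhat) ∧
  ∃ argmin, IsArgminRule Z argmin ∧
    ∀ D x, ∃ S : Finset (Fin n), IsNearestNeighborSet k (fun i => (D i).1) x S ∧
      zhat D x = argmin (fun z => ∑ i ∈ S, ℓ z (D i).2)

/-- The law of `n` i.i.d. data points from `P`. -/
def datasetLaw {dx : ℕ} {Y : Type*} [MeasurableSpace Y]
    (P : Measure (EuclideanSpace ℝ (Fin dx) × Y)) (n : ℕ) :
    Measure (Fin n → EuclideanSpace ℝ (Fin dx) × Y) :=
  Measure.pi fun _ => P

/-- The out-of-sample performance `c(z) = E_P [ℓ(z(X); Y)]` of a decision mapping. -/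
def trueCost {dx dz : ℕ} {Y : Type*} [MeasurableSpace Y]
    (ℓ : EuclideanSpace ℝ (Fin dz) → Y → ℝ) (P : Measure (EuclideanSpace ℝ (Fin dx) × Y))
    (z : EuclideanSpace ℝ (Fin dx) → EuclideanSpace ℝ (Fin dz)) : ℝ :=
  ∫ p, ℓ (z p.1) p.2 ∂P

/-- The plug-in evaluation `c_n(z) = (1/n) ∑ ℓ(z(X_i); Y_i)` of a decision mapping. -/
def plugInCost {dx dz : ℕ} {Y : Type*}
    (ℓ : EuclideanSpace ℝ (Fin dz) → Y → ℝ) {n : ℕ}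
    (D : Fin n → EuclideanSpace ℝ (Fin dx) × Y)
    (z : EuclideanSpace ℝ (Fin dx) → EuclideanSpace ℝ (Fin dz)) : ℝ :=
  (∑ i, ℓ (z (D i).1) (D i).2) / n

/-- The bias `E[c_n(ẑ) - c(ẑ)]` of the plug-in evaluation of a learner. -/
def plugInBias {dx dz : ℕ} {Y : Type*} [MeasurableSpace Y]
    (ℓ : EuclideanSpace ℝ (Fin dz) → Y → ℝ) (P : Measure (EuclideanSpace ℝ (Fin dx) × Y))
    (n : ℕ) (zhat : (Fin n → EuclideanSpace ℝ (Fin dx) × Y) → EuclideanSpace ℝ (Fin dx) →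
      EuclideanSpace ℝ (Fin dz)) : ℝ :=
  ∫ D, (plugInCost ℓ D (zhat D) - trueCost ℓ P (zhat D)) ∂(datasetLaw P n)

/-- `E ‖ẑ(x) - E[ẑ(x)]‖`, with expectations over the data. -/
def variability {dx dz : ℕ} {Y : Type*} [MeasurableSpace Y]
    (P : Measure (EuclideanSpace ℝ (Fin dx) × Y))
    (n : ℕ) (zhat : (Fin n → EuclideanSpace ℝ (Fin dx) × Y) → EuclideanSpace ℝ (Fin dx) →
      EuclideanSpace ℝ (Fin dz)) (x : EuclideanSpace ℝ (Fin dx)) : ℝ :=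
  ∫ D, ‖zhat D x - ∫ D', zhat D' x ∂(datasetLaw P n)‖ ∂(datasetLaw P n)

/-- Variability convergence rate `γ`: `E ‖ẑ(x) - E[ẑ(x)]‖ = Θ(n ^ (-γ))` for almost every `x`.
As the law depends on `n`, the constants do not depend on `x`. -/
def HasVariabilityRate {dx dz : ℕ} {Y : Type*} [MeasurableSpace Y]
    (P : ℕ → Measure (EuclideanSpace ℝ (Fin dx) × Y))
    (zhat : ∀ n, (Fin n → EuclideanSpace ℝ (Fin dx) × Y) → EuclideanSpace ℝ (Fin dx) →
      EuclideanSpace ℝ (Fin dz)) (γ : ℝ) : Prop :=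
  ∃ c₁ > 0, ∃ c₂ > 0, ∀ᶠ n : ℕ in atTop, ∀ᵐ x ∂((P n).map Prod.fst),
    c₁ * (n : ℝ) ^ (-γ) ≤ variability (P n) n (zhat n) x ∧
      variability (P n) n (zhat n) x ≤ c₂ * (n : ℝ) ^ (-γ)

/-- Regions of the same positive finite volume, each of diameter less than its distance to every
other region. -/
structure SeparatedRegions {dx m : ℕ} (R : Fin m → Set (EuclideanSpace ℝ (Fin dx))) : Prop where
  measurableSet : ∀ i, MeasurableSet (R i)
  isBounded : ∀ i, Bornology.IsBounded (R i)
  volume_pos : ∀ i, 0 < volume (R i)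
  volume_eq : ∀ i j, volume (R i) = volume (R j)
  separated : ∀ i j, i ≠ j → ∃ s, Metric.diam (R i) < s ∧ ∀ x ∈ R i, ∀ y ∈ R j, s ≤ dist x y

/-- The mixture, with equal weights, of the laws under which `X` is uniform on the region `R i`
and `Y` has law `Q i` given `X`. -/
def clusterMixture {dx m : ℕ} {Y : Type*} [MeasurableSpace Y]
    (R : Fin m → Set (EuclideanSpace ℝ (Fin dx))) (Q : Fin m → Measure Y) :
    Measure (EuclideanSpace ℝ (Fin dx) × Y) :=
  (m : ℝ≥0∞)⁻¹ • ∑ i, (ProbabilityTheory.cond volume (R i)).prod (Q i)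

end KNNBias

end

noncomputable section

namespace KNNBias

/-! The laws `Q j` are allowed to coincide, and all are taken equal to `Q₀`. The outcome is then
independent of the covariate (`clusterMixture_const`), and all that the bias and variability bounds
need from the covariate law is that spheres are null. Distance ties have probability zero, so given
the covariates the decision at `x` minimizes the cost over a fixed set of `k` i.i.d. outcomes
(`IsKNNLearner.exists_neighbors`). Everything reduces to empirical minimization over `k` outcomes,
with constants depending on neither `n` nor the covariate law (`exists_learner_bounds`).

Bias: a data point is one of its own neighbours, so by exchangeability its expected in-sample cost
is `1 / k` times the expected minimal total cost (`integral_cost_at_mul`), while the out-of-sample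
cost is `E v(ẑ) ≥ v(z₀)`. It suffices that the expected minimal total cost lies below `k v(z₀)` by
an amount between two positive constants, and that `k (E v(ẑ) - v(z₀))` is bounded. Variability: `√k
E‖ẑ - z₀‖` has to be bounded, and `√k E‖ẑ - b‖` bounded below uniformly in the fixed point `b`, in
particular for `b = E ẑ`.

Upper bounds (`exists_localization`, `exists_upper_bounds`): Hoeffding moments and chaining control
the centred total cost at distance `ρ / √k` from `z₀` by a random constant times `(1 + ρ) ^ (3 /
2)`. The quadratic growth of `k v` beats the exponent `3 / 2`, which bounds the fourth moment of `√k
‖ẑ - z₀‖`. Where minimizers may fail to be near `z₀`, boundedness and a probability `O(k⁻⁴)` suffice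
(`exists_good_event`).

Optimism (`exists_improvement`): let `u` be a direction in which the gradient at `z₀` is
nondegenerate. The better of the shifts `b ± t u / √k` gains a term linear in `t`, from the mean
absolute value of the normalized gradient sum, and loses a curvature term quadratic in `t`. For
small `t` the net gain is a positive constant.

Spread (`exists_le_integral_norm_sub`): if `ẑ` were on average much closer to `b` than `1 / √k`, the
total costs at `b` and `ẑ` would nearly agree, against the constant gain just found. Only moment
bounds are used, no limit theorem for the minimizer. -/

/-! ### A chaining bound for stochastic processes on Euclidean space -/

/-- The point `s • a` of the grid of mesh `s`. -/
def gridPoint {d : ℕ} (s : ℝ) (a : Fin d → ℤ) : EuclideanSpace ℝ (Fin d) :=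
  WithLp.toLp 2 fun l => s * a l

/-- The integer points of the cube `[-m, m] ^ d`. -/
def gridBox (d m : ℕ) : Finset (Fin d → ℤ) :=
  Fintype.piFinset fun _ => Finset.Icc (-(m : ℤ)) m

lemma mem_gridBox {d m : ℕ} {a : Fin d → ℤ} : a ∈ gridBox d m ↔ ∀ l, |a l| ≤ m := by
  simp [gridBox, abs_le]

lemma card_gridBox (d m : ℕ) : (gridBox d m).card = (2 * m + 1) ^ d := by
  have h : ((m : ℤ) + 1 + m).toNat = 2 * m + 1 := by omega
  simp [gridBox, h]

lemma gridPoint_zero {d : ℕ} (s : ℝ) : gridPoint s (0 : Fin d → ℤ) = 0 := by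
  ext l; simp [gridPoint]

lemma norm_gridPoint_sub_le {d : ℕ} {s : ℝ} (hs : 0 ≤ s) (a : Fin d → ℤ) {e : Fin d → ℤ}
    (he : e ∈ gridBox d 1) :
    ‖gridPoint s a - gridPoint (s / 2) (2 • a + e)‖ ≤ d * s := by
  rw [EuclideanSpace.norm_eq]
  apply Real.sqrt_le_iff.2 ⟨by positivity, ?_⟩
  have hl : ∀ l, ‖(gridPoint s a - gridPoint (s / 2) (2 • a + e)).ofLp l‖ ^ 2 ≤ s ^ 2 := by
    intro l
    have h1 : (gridPoint s a - gridPoint (s / 2) (2 • a + e)).ofLp l = -(s / 2 * e l) := by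
      simp [gridPoint]; ring
    have h2 : |(e l : ℝ)| ≤ 1 := by exact_mod_cast mem_gridBox.1 he l
    rw [h1, norm_neg, Real.norm_eq_abs, abs_mul, abs_of_nonneg (by positivity : 0 ≤ s / 2)]
    gcongr
    nlinarith [abs_nonneg (e l : ℝ)]
  calc _ ≤ ∑ _l : Fin d, s ^ 2 := Finset.sum_le_sum fun l _ => hl l
    _ = d * s ^ 2 := by simp
    _ ≤ (d * s) ^ 2 := by
      rw [mul_pow]
      gcongr
      exact_mod_cast Nat.le_self_pow two_ne_zero d

/-- Chaining along the dyadic grids of the cube of side `R`. -/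
lemma abs_le_of_grid_increments {d : ℕ} {g : EuclideanSpace ℝ (Fin d) → ℝ} (hg : Continuous g)
    (hg0 : g 0 = 0) {R T : ℝ} (hR : 0 < R)
    (hT : ∀ j : ℕ, ∀ a ∈ gridBox d (2 ^ j), ∀ e ∈ gridBox d 1,
      |g (gridPoint (R / 2 ^ j) a) - g (gridPoint (R / 2 ^ j / 2) (2 • a + e))| ≤ T * (3 / 4) ^ j)
    {x : EuclideanSpace ℝ (Fin d)} (hx : ∀ l, |x l| < R / 2) : |g x| ≤ 4 * T := by
  set a : ℕ → Fin d → ℤ := fun j l => round (x l * 2 ^ j / R) with ha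
  set f : ℕ → EuclideanSpace ℝ (Fin d) := fun j => gridPoint (R / 2 ^ j) (a j) with hf
  have hbox : ∀ j, a j ∈ gridBox d (2 ^ j) := by
    intro j
    refine mem_gridBox.2 fun l => ?_
    have h1 := abs_sub_round (x l * 2 ^ j / R)
    have h2 : |x l * 2 ^ j / R| ≤ 2 ^ j / 2 := by
      rw [abs_div, abs_mul, abs_of_pos hR, abs_of_pos (by positivity : (0 : ℝ) < 2 ^ j),
        div_le_iff₀ hR]
      have := (hx l).le
      have h3 : (0 : ℝ) < 2 ^ j := by positivity
      nlinarith
    have h3 : (1 : ℝ) ≤ 2 ^ j := one_le_pow₀ (by norm_num)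
    have h4 : |(a j l : ℝ)| ≤ 2 ^ j := by
      have h5 : |(a j l : ℝ)| ≤ |x l * 2 ^ j / R| + |x l * 2 ^ j / R - a j l| := by
        have := abs_sub (x l * 2 ^ j / R) (x l * 2 ^ j / R - a j l)
        simpa using this
      simp only [ha] at *
      linarith
    exact_mod_cast h4
  -- Two rounding errors of at most `1 / 2`, one of them doubled, make the difference at most `3 /
  -- 2`, hence at most `1` since it is an integer.
  have hstep : ∀ j, a (j + 1) - 2 • a j ∈ gridBox d 1 := by
    intro j
    refine mem_gridBox.2 fun l => ?_
    have h1 := abs_le.1 (abs_sub_round (x l * 2 ^ j / R))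
    have h2 := abs_le.1 (abs_sub_round (x l * 2 ^ (j + 1) / R))
    have h3 : x l * 2 ^ (j + 1) / R = 2 * (x l * 2 ^ j / R) := by ring
    have h4 : |((a (j + 1) l - 2 * a j l : ℤ) : ℝ)| < 2 := by
      push_cast
      rw [abs_lt]
      simp only [ha]
      rw [h3] at h2 ⊢
      constructor <;> linarith [h1.1, h1.2, h2.1, h2.2]
    have h5 : |a (j + 1) l - 2 * a j l| < 2 := by exact_mod_cast h4
    simp only [Pi.sub_apply, nsmul_eq_mul]
    have : |a (j + 1) l - 2 * a j l| ≤ 1 := by omega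
    exact_mod_cast this
  have hlim : Tendsto f atTop (𝓝 x) := by
    have h1 : Tendsto (fun j l => R / 2 ^ j * (a j l : ℝ)) atTop (𝓝 x.ofLp) := by
      refine tendsto_pi_nhds.2 fun l => ?_
      rw [tendsto_iff_dist_tendsto_zero]
      refine squeeze_zero (g := fun j : ℕ => R / 2 * (1 / 2) ^ j) (fun _ => dist_nonneg)
        (fun j => ?_) ?_
      · have h2 := abs_sub_round (x l * 2 ^ j / R)
        have h3 : (0 : ℝ) < 2 ^ j := by positivity
        rw [dist_comm, Real.dist_eq]
        have h4 : x l - R / 2 ^ j * (a j l : ℝ) = R / 2 ^ j * (x l * 2 ^ j / R - a j l) := by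
          field_simp
        rw [h4, abs_mul, abs_of_pos (by positivity)]
        calc _ ≤ R / 2 ^ j * (1 / 2) := by gcongr
          _ = _ := by rw [one_div_pow]; ring
      · simpa using (tendsto_pow_atTop_nhds_zero_of_lt_one (r := (1 / 2 : ℝ)) (by norm_num)
          (by norm_num)).const_mul (R / 2)
    exact ((PiLp.continuous_toLp 2 _).tendsto _).comp h1
  -- Coordinates smaller than `R / 2` round to `0` on the coarsest grid, so the chain starts at the
  -- origin. The increments then sum to `T / (1 - 3 / 4) = 4 T`.
  have h0 : f 0 = 0 := by
    have : a 0 = 0 := by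
      funext l
      have := abs_lt.1 (hx l)
      simp only [ha, pow_zero, mul_one, Pi.zero_apply, round_eq_zero_iff]
      constructor
      · rw [le_div_iff₀ hR]; linarith
      · rw [div_lt_iff₀ hR]; linarith
    rw [hf]
    simp only [this, gridPoint_zero]
  have key := dist_le_of_le_geometric_of_tendsto₀ (3 / 4) T (f := fun j => g (f j)) (by norm_num)
    (fun j => by
      have h := hT j (a j) (hbox j) _ (hstep j)
      rw [add_sub_cancel, div_div, ← pow_succ] at h
      exact h) ((hg.tendsto x).comp hlim)
  rw [h0, hg0, Real.dist_eq, zero_sub, abs_neg] at key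
  norm_num at key
  linarith

/-- A weighted sum of the `p`-th powers of the increments of `g` along dyadic grids of the cubes
of side `2 ^ i`. -/
def chainEnergy {d : ℕ} (p : ℕ) (g : EuclideanSpace ℝ (Fin d) → ℝ) : ℝ≥0∞ :=
  ∑' i : ℕ, ∑' j : ℕ, ∑ a ∈ gridBox d (2 ^ j), ∑ e ∈ gridBox d 1,
    ENNReal.ofReal ((1 / 2) ^ i * ((1 / 2) ^ i * (4 / 3) ^ j) ^ p *
      |g (gridPoint (2 ^ i / 2 ^ j) a) - g (gridPoint (2 ^ i / 2 ^ j / 2) (2 • a + e))| ^ p)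

/-- Every term of the energy is at most the whole, so on the cube of side `2 ^ i` the increments at
level `j` decay like `(3 / 4) ^ j` and chaining applies. The dyadic side is chosen comparable to `1
+ ‖x‖`, which produces the polynomial growth in `x`. -/
lemma abs_pow_le_chainEnergy {d p : ℕ} (hp : p ≠ 0) {g : EuclideanSpace ℝ (Fin d) → ℝ}
    (hg : Continuous g) (hg0 : g 0 = 0) (hfin : chainEnergy p g ≠ ⊤)
    (x : EuclideanSpace ℝ (Fin d)) :
    |g x| ^ p ≤ 4 ^ p * (chainEnergy p g).toReal * (4 * (1 + ‖x‖)) ^ (p + 1) := by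
  obtain ⟨m, hm1, hm2⟩ := exists_nat_pow_near (x := 2 * (1 + ‖x‖)) (y := 2)
    (by linarith [norm_nonneg x]) (by norm_num)
  set i := m + 1
  set B := (chainEnergy p g).toReal
  have hB : 0 ≤ B := ENNReal.toReal_nonneg
  have hi : (2 : ℝ) ^ i ≤ 4 * (1 + ‖x‖) := by rw [pow_succ]; linarith
  have hterm : ∀ j : ℕ, ∀ a ∈ gridBox d (2 ^ j), ∀ e ∈ gridBox d 1,
      (1 / 2) ^ i * ((1 / 2) ^ i * (4 / 3) ^ j) ^ p * |g (gridPoint (2 ^ i / 2 ^ j) a)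
        - g (gridPoint (2 ^ i / 2 ^ j / 2) (2 • a + e))| ^ p ≤ B := by
    intro j a ha e he
    rw [← ENNReal.ofReal_le_iff_le_toReal hfin]
    refine le_trans ?_ (ENNReal.le_tsum i)
    refine le_trans ?_ (ENNReal.le_tsum j)
    refine le_trans ?_ (Finset.single_le_sum (fun _ _ => zero_le) ha)
    exact Finset.single_le_sum (f := fun e => ENNReal.ofReal ((1 / 2) ^ i *
      ((1 / 2) ^ i * (4 / 3) ^ j) ^ p * |g (gridPoint (2 ^ i / 2 ^ j) a)
        - g (gridPoint (2 ^ i / 2 ^ j / 2) (2 • a + e))| ^ p)) (fun _ _ => zero_le) he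
  set T : ℝ := 2 ^ i * (2 ^ i * B) ^ (1 / p : ℝ)
  have hTp : T ^ p = (2 ^ i) ^ (p + 1) * B := by
    rw [mul_pow, ← Real.rpow_natCast _ p, ← Real.rpow_natCast (_ ^ (1 / p : ℝ)),
      ← Real.rpow_mul (by positivity), one_div_mul_cancel (by exact_mod_cast hp), Real.rpow_one,
      Real.rpow_natCast]
    ring
  have hT0 : 0 ≤ T := by positivity
  have := abs_le_of_grid_increments hg hg0 (R := 2 ^ i) (T := T) (by positivity)
    (fun j a ha e he => by
      have h := hterm j a ha e he
      rw [← pow_le_pow_iff_left₀ (abs_nonneg _) (by positivity) hp, mul_pow, hTp]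
      have e1 : ((1 / 2 : ℝ) ^ i * ((1 / 2) ^ i * (4 / 3) ^ j) ^ p)
          = (((2 ^ i) ^ (p + 1)) * ((3 / 4) ^ j) ^ p)⁻¹ := by
        rw [mul_inv, ← inv_pow, ← inv_pow, ← inv_pow, ← inv_pow]; norm_num; ring
      rw [e1, inv_mul_le_iff₀ (by positivity)] at h
      linarith) (x := x) (fun l => by
      have := PiLp.norm_apply_le x l
      rw [Real.norm_eq_abs] at this
      linarith)
  calc |g x| ^ p ≤ (4 * T) ^ p := by gcongr
    _ = 4 ^ p * B * (2 ^ i) ^ (p + 1) := by rw [mul_pow, hTp]; ring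
    _ ≤ _ := by gcongr

/-- The part of the bound on the expected chain energy that does not depend on the process. -/
def chainBound (d p : ℕ) (c : ℝ) : ℝ≥0∞ :=
  ∑' i : ℕ, ∑' j : ℕ, ENNReal.ofReal (9 ^ d * c * d ^ p) * ENNReal.ofReal (1 / 2) ^ i *
    ENNReal.ofReal (2 ^ d * (2 / 3) ^ p) ^ j

/-- Level `j` has of order `2 ^ (d j)` increments, each with `p`-th moment of order `2 ^ (-p j)`
relative to the cube, against a weight `(4 / 3) ^ (p j)`. The ratio `2 ^ d (2 / 3) ^ p` is below `1`
for large `p`; the factor `(1 / 2) ^ i` sums over the cubes. -/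
lemma chainBound_ne_top {d p : ℕ} (hp : (2 : ℝ) ^ d * (2 / 3) ^ p < 1) (c : ℝ) :
    chainBound d p c ≠ ⊤ := by
  simp only [chainBound, ENNReal.tsum_mul_left, ENNReal.tsum_mul_right, ENNReal.tsum_geometric]
  refine ENNReal.mul_ne_top (ENNReal.mul_ne_top ENNReal.ofReal_ne_top ?_) ?_
  · rw [Ne, ENNReal.inv_eq_top, tsub_eq_zero_iff_le, not_le]
    exact ENNReal.ofReal_lt_one.2 (by norm_num)
  · rw [Ne, ENNReal.inv_eq_top, tsub_eq_zero_iff_le, not_le]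
    exact ENNReal.ofReal_lt_one.2 hp

lemma measurable_chainEnergy {d p : ℕ} {Ω : Type*} [MeasurableSpace Ω]
    {g : EuclideanSpace ℝ (Fin d) → Ω → ℝ} (hg : ∀ x, Measurable (g x)) :
    Measurable fun ω => chainEnergy p fun x => g x ω := by
  unfold chainEnergy
  refine Measurable.tsum fun i => Measurable.tsum fun j => ?_
  refine Finset.measurable_sum _ fun a _ => Finset.measurable_sum _ fun e _ => ?_
  exact ((((hg _).sub (hg _)).abs.pow_const p).const_mul _).ennreal_ofReal

lemma lintegral_chainEnergy_le {d p : ℕ} {Ω : Type*} [MeasurableSpace Ω] {P : Measure Ω} {c : ℝ}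
    (hc : 0 ≤ c) {g : EuclideanSpace ℝ (Fin d) → Ω → ℝ} (hg : ∀ x, Measurable (g x))
    (hinc : ∀ x y, ∫⁻ ω, ENNReal.ofReal (|g x ω - g y ω| ^ p) ∂P
      ≤ ENNReal.ofReal (c * ‖x - y‖ ^ p)) :
    ∫⁻ ω, chainEnergy p (fun x => g x ω) ∂P ≤ chainBound d p c := by
  have hmeas : ∀ (w : ℝ) x y, Measurable fun ω => ENNReal.ofReal (w * |g x ω - g y ω| ^ p) :=
    fun w x y => ((((hg _).sub (hg _)).abs.pow_const p).const_mul _).ennreal_ofReal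
  unfold chainEnergy chainBound
  rw [lintegral_tsum fun i => (Measurable.tsum fun j => Finset.measurable_sum _ fun a _ =>
    Finset.measurable_sum _ fun e _ => hmeas _ _ _).aemeasurable]
  refine ENNReal.tsum_le_tsum fun i => ?_
  rw [lintegral_tsum fun j => (Finset.measurable_sum _ fun a _ =>
    Finset.measurable_sum _ fun e _ => hmeas _ _ _).aemeasurable]
  refine ENNReal.tsum_le_tsum fun j => ?_
  rw [lintegral_finsetSum _ fun a _ => Finset.measurable_sum _ fun e _ => hmeas _ _ _]
  have hterm : ∀ a ∈ gridBox d (2 ^ j),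
      ∫⁻ ω, ∑ e ∈ gridBox d 1, ENNReal.ofReal ((1 / 2) ^ i * ((1 / 2) ^ i * (4 / 3) ^ j) ^ p *
      |g (gridPoint (2 ^ i / 2 ^ j) a) ω - g (gridPoint (2 ^ i / 2 ^ j / 2) (2 • a + e)) ω| ^ p) ∂P
      ≤ ∑ e ∈ gridBox d 1, ENNReal.ofReal ((1 / 2) ^ i * ((1 / 2) ^ i * (4 / 3) ^ j) ^ p *
        (c * (d * (2 ^ i / 2 ^ j)) ^ p)) := by
    intro a _
    rw [lintegral_finsetSum _ fun e _ => hmeas _ _ _]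
    refine Finset.sum_le_sum fun e he => ?_
    simp_rw [ENNReal.ofReal_mul (by positivity : (0 : ℝ) ≤ (1 / 2) ^ i *
      ((1 / 2) ^ i * (4 / 3) ^ j) ^ p)]
    rw [lintegral_const_mul' _ _ ENNReal.ofReal_ne_top]
    gcongr
    refine (hinc _ _).trans (ENNReal.ofReal_le_ofReal ?_)
    gcongr
    exact norm_gridPoint_sub_le (by positivity) a he
  refine (Finset.sum_le_sum hterm).trans ?_
  rw [Finset.sum_const, Finset.sum_const, card_gridBox, card_gridBox]
  simp only [nsmul_eq_mul]
  rw [← ENNReal.ofReal_natCast, ← ENNReal.ofReal_natCast,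
    ← ENNReal.ofReal_pow (by norm_num), ← ENNReal.ofReal_pow (by positivity),
    ← ENNReal.ofReal_mul (by positivity), ← ENNReal.ofReal_mul (by positivity),
    ← ENNReal.ofReal_mul (by positivity), ← ENNReal.ofReal_mul (by positivity)]
  refine ENNReal.ofReal_le_ofReal ?_
  push_cast
  norm_num only [mul_one]
  have h2 : (2 * 2 ^ j + 1 : ℝ) ≤ 3 * 2 ^ j := by
    linarith [one_le_pow₀ (M₀ := ℝ) (a := 2) (n := j) (by norm_num)]
  calc (2 * 2 ^ j + 1 : ℝ) ^ d * (3 ^ d * ((1 / 2) ^ i * ((1 / 2) ^ i * (4 / 3) ^ j) ^ p *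
        (c * (d * (2 ^ i / 2 ^ j)) ^ p)))
      ≤ (3 * 2 ^ j) ^ d * (3 ^ d * ((1 / 2) ^ i * ((1 / 2) ^ i * (4 / 3) ^ j) ^ p *
        (c * (d * (2 ^ i / 2 ^ j)) ^ p))) := by
        gcongr
    _ = (3 ^ d * 3 ^ d) * c * d ^ p * (1 / 2) ^ i * ((2 ^ j) ^ d *
        ((1 / 2) ^ i * (4 / 3) ^ j * (2 ^ i / 2 ^ j)) ^ p) := by
        simp only [mul_pow]; ring
    _ = _ := by
        have e1 : ((1 / 2) ^ i * (4 / 3) ^ j * (2 ^ i / 2 ^ j) : ℝ) = (2 / 3) ^ j := by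
          rw [show (2 / 3 : ℝ) = 4 / 3 / 2 by norm_num, div_pow (4 / 3 : ℝ) 2, one_div_pow]
          field_simp
        rw [e1, ← mul_pow, mul_pow (2 ^ d : ℝ) _ j, pow_right_comm 2 j d,
          pow_right_comm (2 / 3 : ℝ) j p]
        norm_num

/-- A process with increments controlled in `L ^ (2 q)` for large `q` has a modulus of continuity
at the origin with bounded fourth moment. -/
theorem exists_modulus (d q : ℕ) (hq : 4 ≤ q) (hdq : (2 : ℝ) ^ d * (2 / 3) ^ (2 * q) < 1)
    {c : ℝ} (hc : 0 ≤ c) :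
    ∃ C : ℝ, ∀ {Ω : Type*} [MeasurableSpace Ω] (P : Measure Ω) [IsProbabilityMeasure P]
      (g : EuclideanSpace ℝ (Fin d) → Ω → ℝ), (∀ x, Measurable (g x)) →
      (∀ x y, ∫⁻ ω, ENNReal.ofReal (|g x ω - g y ω| ^ (2 * q)) ∂P
        ≤ ENNReal.ofReal (c * ‖x - y‖ ^ (2 * q))) →
      (∀ᵐ ω ∂P, Continuous (fun x => g x ω) ∧ g 0 ω = 0) →
      ∃ A : Ω → ℝ, Measurable A ∧ (∀ ω, 0 ≤ A ω) ∧ Integrable (fun ω => A ω ^ 4) P ∧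
        ∫ ω, A ω ^ 4 ∂P ≤ C ∧ ∀ᵐ ω ∂P, ∀ x, g x ω ^ 2 ≤ A ω * (1 + ‖x‖) ^ 3 := by
  set K : ℝ := 4 ^ (2 * q) * 4 ^ (2 * q + 1)
  refine ⟨1 + K * (chainBound d (2 * q) c).toReal, ?_⟩
  intro Ω _ P _ g hg hinc hcont
  have hq0 : (q : ℝ) ≠ 0 := by positivity
  set V : Ω → ℝ := fun ω => (chainEnergy (2 * q) fun x => g x ω).toReal with hV
  have hVm : Measurable V := (measurable_chainEnergy hg).ennreal_toReal
  have hV0 : ∀ ω, 0 ≤ V ω := fun ω => ENNReal.toReal_nonneg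
  have hle := lintegral_chainEnergy_le hc hg hinc
  have hne : ∫⁻ ω, chainEnergy (2 * q) (fun x => g x ω) ∂P ≠ ⊤ :=
    ne_top_of_le_ne_top (chainBound_ne_top hdq c) hle
  have hVint : Integrable V P :=
    integrable_toReal_of_lintegral_ne_top (measurable_chainEnergy hg).aemeasurable hne
  have hVle : ∫ ω, V ω ∂P ≤ (chainBound d (2 * q) c).toReal := by
    rw [integral_toReal (measurable_chainEnergy hg).aemeasurable
      (ae_lt_top (measurable_chainEnergy hg) hne)]
    exact ENNReal.toReal_mono (chainBound_ne_top hdq c) hle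
  -- The `q`-th root turns growth `(1 + ‖x‖) ^ (2 q + 1)` of `g ^ (2 q)` into at most `(1 + ‖x‖) ^
  -- 3` for `g ^ 2`. As `4 ≤ q`, the fourth moment of `A` is controlled by the mean of `V`.
  set A : Ω → ℝ := fun ω => (K * V ω) ^ (1 / q : ℝ) with hA
  have hAm : Measurable A := (hVm.const_mul K).pow_const _
  have hA0 : ∀ ω, 0 ≤ A ω := fun ω => Real.rpow_nonneg (mul_nonneg (by positivity) (hV0 ω)) _
  have hAq : ∀ ω, A ω ^ q = K * V ω := by
    intro ω
    rw [hA, ← Real.rpow_natCast, ← Real.rpow_mul (mul_nonneg (by positivity) (hV0 ω)),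
      one_div_mul_cancel hq0, Real.rpow_one]
  have hA4 : ∀ ω, A ω ^ 4 ≤ 1 + K * V ω := by
    intro ω
    rw [← hAq]
    rcases le_total (A ω) 1 with h | h
    · linarith [pow_le_one₀ (n := 4) (hA0 ω) h, pow_nonneg (hA0 ω) q]
    · linarith [pow_le_pow_right₀ h hq]
  have hdom : Integrable (fun ω => 1 + K * V ω) P := (integrable_const _).add (hVint.const_mul K)
  have hint : Integrable (fun ω => A ω ^ 4) P :=
    hdom.mono' (hAm.pow_const 4).aestronglyMeasurable (ae_of_all _ fun ω => by
      rw [Real.norm_eq_abs, abs_of_nonneg (pow_nonneg (hA0 ω) 4)]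
      exact hA4 ω)
  refine ⟨A, hAm, hA0, hint, ?_, ?_⟩
  · calc ∫ ω, A ω ^ 4 ∂P ≤ ∫ ω, (1 + K * V ω) ∂P := integral_mono hint hdom hA4
      _ = 1 + K * ∫ ω, V ω ∂P := by
        rw [integral_add (integrable_const _) (hVint.const_mul K), integral_const_mul]; simp
      _ ≤ _ := by gcongr
  · filter_upwards [hcont, ae_lt_top (measurable_chainEnergy hg) hne] with ω h1 h2 x
    have h3 := abs_pow_le_chainEnergy (p := 2 * q) (by omega) h1.1 h1.2 h2.ne x
    rw [← pow_le_pow_iff_left₀ (sq_nonneg _) (by have := hA0 ω; positivity) (n := q) (by omega),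
      mul_pow, hAq, ← pow_mul, ← Even.pow_abs (even_two_mul q)]
    refine h3.trans ?_
    have h4 : (1 : ℝ) ≤ 1 + ‖x‖ := by linarith [norm_nonneg x]
    have h5 : (1 + ‖x‖) ^ (2 * q + 1) ≤ ((1 + ‖x‖) ^ 3) ^ q := by
      rw [← pow_mul]
      exact pow_le_pow_right₀ h4 (by omega)
    have := hV0 ω
    calc _ = K * V ω * (1 + ‖x‖) ^ (2 * q + 1) := by rw [mul_pow]; ring
      _ ≤ _ := by gcongr

/-! ### Moments of sums of independent variables -/

section Moments

open ProbabilityTheory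

variable {ι Y : Type*} [Fintype ι] [MeasurableSpace Y] {Q : Measure Y} [IsProbabilityMeasure Q]

lemma ae_pi_of_ae {p : Y → Prop} (h : ∀ᵐ y ∂Q, p y) :
    ∀ᵐ ω ∂(Measure.pi fun _ : ι => Q), ∀ i, p (ω i) :=
  ae_all_iff.2 fun i => (measurePreserving_eval (fun _ : ι => Q) i).quasiMeasurePreserving.ae h

lemma integral_comp_eval_pi {f : Y → ℝ} (hf : AEStronglyMeasurable f Q) (i : ι) :
    ∫ ω, f (ω i) ∂(Measure.pi fun _ : ι => Q) = ∫ y, f y ∂Q := by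
  have h := measurePreserving_eval (fun _ : ι => Q) i
  have h2 := integral_map h.measurable.aemeasurable (f := f) (by rw [h.map_eq]; exact hf)
  rw [h.map_eq] at h2
  exact h2.symm

lemma integrable_comp_eval_pi {f : Y → ℝ} (hf : Integrable f Q) (i : ι) :
    Integrable (fun ω : ι → Y => f (ω i)) (Measure.pi fun _ : ι => Q) :=
  (measurePreserving_eval (fun _ : ι => Q) i).integrable_comp_of_integrable hf

lemma abs_pow_le_exp_add_exp (x : ℝ) (p : ℕ) :
    |x| ^ p ≤ p.factorial * (Real.exp x + Real.exp (-x)) := by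
  have h1 := Real.pow_div_factorial_le_exp |x| (abs_nonneg x) p
  have h2 : Real.exp |x| ≤ Real.exp x + Real.exp (-x) := by
    rcases abs_choice x with h | h <;> rw [h] <;> linarith [Real.exp_pos x, Real.exp_pos (-x)]
  rw [div_le_iff₀ (by positivity)] at h1
  nlinarith [(by positivity : (0 : ℝ) < p.factorial)]

/-- Moments of sums of bounded centered independent variables, from Hoeffding's lemma. -/
lemma lintegral_abs_sum_pow_le {ξ : Y → ℝ} (hξ : Measurable ξ) (hξ0 : ∫ y, ξ y ∂Q = 0) {B : ℝ}
    (hB : 0 ≤ B) (hξB : ∀ᵐ y ∂Q, |ξ y| ≤ B) (S : Finset ι) (p : ℕ) :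
    ∫⁻ ω, ENNReal.ofReal (|∑ i ∈ S, ξ (ω i)| ^ p) ∂(Measure.pi fun _ : ι => Q)
      ≤ ENNReal.ofReal (4 * p.factorial * (√S.card * B) ^ p) := by
  set b := √S.card * B with hb
  -- The exponential moments below are taken at `± 1 / b`, so `b = 0`, where the sum vanishes almost
  -- surely, is set apart.
  rcases (show 0 ≤ b by positivity).eq_or_lt with h0 | h0
  · have hz : ∀ᵐ ω ∂(Measure.pi fun _ : ι => Q), ∑ i ∈ S, ξ (ω i) = 0 := by
      filter_upwards [ae_pi_of_ae (ι := ι) hξB] with ω hω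
      rcases mul_eq_zero.1 h0.symm with h | h
      · rw [Real.sqrt_eq_zero (Nat.cast_nonneg _), Nat.cast_eq_zero, Finset.card_eq_zero] at h
        simp [h]
      · refine Finset.sum_eq_zero fun i _ => abs_nonpos_iff.1 (h ▸ hω i)
    rw [← h0, lintegral_congr_ae (g := fun _ => ENNReal.ofReal (0 ^ p))
      (by filter_upwards [hz] with ω hω; rw [hω, abs_zero])]
    simp only [lintegral_const, measure_univ, mul_one]
    refine ENNReal.ofReal_le_ofReal (le_mul_of_one_le_left (by positivity) ?_)
    have : (1 : ℝ) ≤ p.factorial := by exact_mod_cast Nat.succ_le_of_lt p.factorial_pos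
    linarith
  have hsub : HasSubgaussianMGF ξ ((‖B - -B‖₊ / 2) ^ 2) Q :=
    hasSubgaussianMGF_of_mem_Icc_of_integral_eq_zero hξ.aemeasurable
      (hξB.mono fun y hy => abs_le.1 hy) hξ0
  have hi : ∀ i : ι, HasSubgaussianMGF (fun ω : ι → Y => ξ (ω i)) ((‖B - -B‖₊ / 2) ^ 2)
      (Measure.pi fun _ : ι => Q) := fun i =>
    HasSubgaussianMGF.of_map (Y := fun ω : ι → Y => ω i) (measurable_pi_apply i).aemeasurable
      (by rw [(measurePreserving_eval (fun _ : ι => Q) i).map_eq]; exact hsub)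
  have hsum := HasSubgaussianMGF.sum_of_iIndepFun (s := S)
    (iIndepFun_pi (μ := fun _ : ι => Q) (X := fun _ => ξ) fun _ => hξ.aemeasurable)
    (fun i _ => hi i)
  set W : (ι → Y) → ℝ := fun ω => ∑ i ∈ S, ξ (ω i) with hW
  have hcoef : ((∑ _i ∈ S, (‖B - -B‖₊ / 2) ^ 2 : NNReal) : ℝ) = b ^ 2 := by
    simp only [Finset.sum_const, nsmul_eq_mul, NNReal.coe_mul, NNReal.coe_natCast, NNReal.coe_pow,
      NNReal.coe_div, coe_nnnorm, NNReal.coe_ofNat]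
    rw [Real.norm_of_nonneg (by linarith), hb, mul_pow, Real.sq_sqrt (by positivity)]
    ring
  -- At this `t` the sub-Gaussian bound is `exp (1 / 2) ≤ 2`.
  have hmgf : ∀ t : ℝ, t ^ 2 = (b ^ 2)⁻¹ →
      ∫ ω, Real.exp (t * W ω) ∂(Measure.pi fun _ : ι => Q) ≤ 2 := by
    intro t ht
    have h := hsum.mgf_le t
    rw [hcoef, ht, mul_inv_cancel₀ (by positivity)] at h
    refine h.trans ?_
    have h1 : Real.exp (1 / 2) * Real.exp (1 / 2) = Real.exp 1 := by rw [← Real.exp_add]; norm_num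
    nlinarith [Real.exp_one_lt_d9, Real.exp_pos (1 / 2)]
  have hint : ∀ t : ℝ, Integrable (fun ω => Real.exp (t * W ω)) (Measure.pi fun _ : ι => Q) :=
    fun t => hsum.integrable_exp_mul t
  have hdom : Integrable (fun ω => b ^ p * (p.factorial *
      (Real.exp (b⁻¹ * W ω) + Real.exp (-b⁻¹ * W ω)))) (Measure.pi fun _ : ι => Q) :=
    (((hint _).add (hint _)).const_mul _).const_mul _
  calc ∫⁻ ω, ENNReal.ofReal (|W ω| ^ p) ∂(Measure.pi fun _ : ι => Q)
      ≤ ∫⁻ ω, ENNReal.ofReal (b ^ p * (p.factorial *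
      (Real.exp (b⁻¹ * W ω) + Real.exp (-b⁻¹ * W ω)))) ∂(Measure.pi fun _ : ι => Q) := by
        refine lintegral_mono fun ω => ENNReal.ofReal_le_ofReal ?_
        have h := abs_pow_le_exp_add_exp (b⁻¹ * W ω) p
        rw [← neg_mul] at h
        calc |W ω| ^ p = b ^ p * |b⁻¹ * W ω| ^ p := by
              rw [abs_mul, abs_of_pos (inv_pos.2 h0), ← mul_pow b, mul_inv_cancel_left₀ h0.ne']
          _ ≤ _ := by gcongr
    _ = ENNReal.ofReal (∫ ω, b ^ p * (p.factorial *
      (Real.exp (b⁻¹ * W ω) + Real.exp (-b⁻¹ * W ω))) ∂(Measure.pi fun _ : ι => Q)) :=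
        (ofReal_integral_eq_lintegral_ofReal hdom (ae_of_all _ fun ω => by positivity)).symm
    _ ≤ _ := by
        refine ENNReal.ofReal_le_ofReal ?_
        rw [integral_const_mul, integral_const_mul, integral_add (hint _) (hint _)]
        have h1 := hmgf b⁻¹ (by rw [inv_pow])
        have h2 := hmgf (-b⁻¹) (by rw [neg_sq, inv_pow])
        calc _ ≤ b ^ p * (p.factorial * (2 + 2)) := by gcongr
          _ = _ := by ring

lemma integral_abs_sum_pow_le {ξ : Y → ℝ} (hξ : Measurable ξ) (hξ0 : ∫ y, ξ y ∂Q = 0) {B : ℝ}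
    (hB : 0 ≤ B) (hξB : ∀ᵐ y ∂Q, |ξ y| ≤ B) (S : Finset ι) (p : ℕ) :
    Integrable (fun ω : ι → Y => |∑ i ∈ S, ξ (ω i)| ^ p) (Measure.pi fun _ : ι => Q) ∧
    ∫ ω, |∑ i ∈ S, ξ (ω i)| ^ p ∂(Measure.pi fun _ : ι => Q)
      ≤ 4 * p.factorial * (√S.card * B) ^ p := by
  have hm : Measurable fun ω : ι → Y => |∑ i ∈ S, ξ (ω i)| ^ p :=
    (Finset.measurable_sum _ fun i _ => hξ.comp (measurable_pi_apply i)).abs.pow_const p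
  have h := lintegral_abs_sum_pow_le hξ hξ0 hB hξB S p
  constructor
  · refine ⟨hm.aestronglyMeasurable, ?_⟩
    rw [hasFiniteIntegral_iff_ofReal (ae_of_all _ fun ω => by positivity)]
    exact h.trans_lt ENNReal.ofReal_lt_top
  · rw [integral_eq_lintegral_of_nonneg_ae (ae_of_all _ fun ω => by positivity)
      hm.aestronglyMeasurable]
    exact ENNReal.toReal_le_of_le_ofReal (by positivity) h

lemma integral_sq_sum_eq {ξ : Y → ℝ} (hξ : MemLp ξ 2 Q) (hξ0 : ∫ y, ξ y ∂Q = 0) (S : Finset ι) :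
    ∫ ω, (∑ i ∈ S, ξ (ω i)) ^ 2 ∂(Measure.pi fun _ : ι => Q) = S.card * ∫ y, ξ y ^ 2 ∂Q := by
  have hL : ∀ i : ι, MemLp (fun ω : ι → Y => ξ (ω i)) 2 (Measure.pi fun _ : ι => Q) := fun i =>
    hξ.comp_measurePreserving (measurePreserving_eval (fun _ : ι => Q) i)
  have hm : ∀ i : ι, ∫ ω, ξ (ω i) ∂(Measure.pi fun _ : ι => Q) = 0 := fun i => by
    rw [integral_comp_eval_pi hξ.1, hξ0]
  have hvar := IndepFun.variance_sum (s := S) (X := fun (i : ι) (ω : ι → Y) => ξ (ω i))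
    (fun i _ => hL i) (fun i _ j _ hij =>
      (iIndepFun_pi (μ := fun _ : ι => Q) (X := fun _ => ξ) fun _ => hξ.1.aemeasurable).indepFun
        hij)
  have hsum : ∫ ω, (∑ i ∈ S, fun ω : ι → Y => ξ (ω i)) ω ∂(Measure.pi fun _ : ι => Q) = 0 := by
    simp only [Finset.sum_apply]
    rw [integral_finsetSum _ fun i _ => (hL i).integrable (by norm_num)]
    exact Finset.sum_eq_zero fun i _ => hm i
  rw [variance_of_integral_eq_zero (memLp_finsetSum' _ fun i _ => hL i).1.aemeasurable hsum] at hvar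
  simp only [Finset.sum_apply] at hvar
  rw [hvar, Finset.sum_congr rfl fun i _ => by
    rw [variance_of_integral_eq_zero (hL i).1.aemeasurable (hm i),
      integral_comp_eval_pi (f := fun y => ξ y ^ 2) (hξ.1.pow 2)]]
  simp

/-- A lower bound on the first absolute moment of a normalized sum. -/
lemma exists_le_integral_abs_sum {ξ : Y → ℝ} (hξ : Measurable ξ) (hξ0 : ∫ y, ξ y ∂Q = 0) {B : ℝ}
    (hB : 0 ≤ B) (hξB : ∀ᵐ y ∂Q, |ξ y| ≤ B) (hpos : 0 < ∫ y, ξ y ^ 2 ∂Q) :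
    ∃ c > 0, ∀ {ι : Type*} [Fintype ι] (S : Finset ι),
      c * √S.card ≤ ∫ ω, |∑ i ∈ S, ξ (ω i)| ∂(Measure.pi fun _ : ι => Q) := by
  set σ := ∫ y, ξ y ^ 2 ∂Q
  -- Chosen so that, after truncation at `N √|S|`, the fourth-moment bound `96 |S| ^ 2 B ^ 4`
  -- accounts for at most half of the second moment `|S| σ`.
  set N : ℝ := 1 + 200 * B ^ 4 / σ
  have hN : 1 ≤ N := le_add_of_nonneg_right (by positivity)
  refine ⟨σ / (2 * N), by positivity, ?_⟩
  intro ι _ S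
  have hL2 : MemLp ξ 2 Q := MemLp.of_bound hξ.aestronglyMeasurable B hξB
  have h2 := integral_sq_sum_eq (ι := ι) hL2 hξ0 S
  obtain ⟨i1, -⟩ := integral_abs_sum_pow_le hξ hξ0 hB hξB S 1
  obtain ⟨i4, h4⟩ := integral_abs_sum_pow_le hξ hξ0 hB hξB S 4
  obtain ⟨i2, -⟩ := integral_abs_sum_pow_le hξ hξ0 hB hξB S 2
  simp only [sq_abs, pow_one] at i1 i2
  rcases S.card.eq_zero_or_pos with h0 | h0
  · simp only [h0, Nat.cast_zero, Real.sqrt_zero, mul_zero]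
    exact integral_nonneg fun ω => abs_nonneg _
  set r := √(S.card : ℝ)
  have hr : 0 < r := Real.sqrt_pos.2 (by exact_mod_cast h0)
  have hr2 : r ^ 2 = S.card := Real.sq_sqrt (by positivity)
  -- Interpolation of the second moment between the first and the fourth: a large variance and a
  -- bounded fourth moment force a large first moment.
  have hpt : ∀ w : ℝ, w ^ 2 ≤ N * r * |w| + |w| ^ 4 / (N * r) ^ 2 := by
    intro w
    rw [← sq_abs]
    rcases le_total |w| (N * r) with h | h
    · have : 0 ≤ |w| ^ 4 / (N * r) ^ 2 := by positivity
      nlinarith [abs_nonneg w]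
    · have h3 : |w| ^ 2 ≤ |w| ^ 4 / (N * r) ^ 2 := by
        rw [le_div_iff₀ (by positivity)]
        have : (N * r) ^ 2 ≤ |w| ^ 2 := by gcongr
        nlinarith [sq_nonneg |w|]
      have : 0 ≤ N * r * |w| := by positivity
      linarith
  have hle := integral_mono (μ := Measure.pi fun _ : ι => Q) i2
    ((i1.const_mul (N * r)).add (i4.div_const ((N * r) ^ 2))) (fun ω => hpt (∑ i ∈ S, ξ (ω i)))
  simp only [Pi.add_apply] at hle
  rw [integral_add (i1.const_mul _) (i4.div_const _), integral_const_mul, integral_div, h2, ← hr2]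
    at hle
  have h5 : (∫ ω, |∑ i ∈ S, ξ (ω i)| ^ 4 ∂(Measure.pi fun _ : ι => Q)) / (N * r) ^ 2
      ≤ r ^ 2 * σ / 2 := by
    rw [div_le_iff₀ (by positivity)]
    refine h4.trans ?_
    have h6 : 200 * B ^ 4 ≤ N * σ := by
      have : (1 + 200 * B ^ 4 / σ) * σ = σ + 200 * B ^ 4 := by field_simp
      simp only [N]; linarith
    have h7 : N * σ ≤ N ^ 2 * σ := by gcongr; nlinarith
    have h8 : (Nat.factorial 4 : ℝ) = 24 := by norm_num [Nat.factorial]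
    rw [h8]
    calc 4 * 24 * (r * B) ^ 4 = r ^ 4 * (96 * B ^ 4) := by ring
      _ ≤ r ^ 4 * (N ^ 2 * σ / 2) := by gcongr; nlinarith [pow_nonneg hB 4]
      _ = _ := by ring
  rw [div_mul_eq_mul_div, div_le_iff₀ (by positivity)]
  nlinarith

end Moments

/-! ### Second-order expansions -/

section Calculus

variable {E : Type*} [NormedAddCommGroup E] [NormedSpace ℝ E] {f : E → ℝ} {z₀ : E}

lemma exists_norm_fderiv_sub_le (hf' : DifferentiableAt ℝ (fderiv ℝ f) z₀)
    (hf0 : fderiv ℝ f z₀ = 0) {κ : ℝ} (hκ : 0 < κ) :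
    ∃ ε > 0, ∀ h : E, ‖h‖ < ε →
      ‖fderiv ℝ f (z₀ + h) - fderiv ℝ (fderiv ℝ f) z₀ h‖ ≤ κ * ‖h‖ := by
  have h1 := hf'.hasFDerivAt.isLittleO.def hκ
  obtain ⟨ε, hε, h2⟩ := Metric.eventually_nhds_iff.1 h1
  refine ⟨ε, hε, fun h hh => ?_⟩
  have h3 := @h2 (z₀ + h) (by simpa using hh)
  simpa [hf0] using h3

/-- Second-order Taylor expansion at a critical point. -/
lemma exists_abs_taylor_two_le (hf : ∀ᶠ z in 𝓝 z₀, DifferentiableAt ℝ f z)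
    (hf' : DifferentiableAt ℝ (fderiv ℝ f) z₀) (hf0 : fderiv ℝ f z₀ = 0) {κ : ℝ} (hκ : 0 < κ) :
    ∃ ε > 0, ∀ h : E, ‖h‖ < ε →
      |f (z₀ + h) - f z₀ - fderiv ℝ (fderiv ℝ f) z₀ h h / 2| ≤ κ * ‖h‖ ^ 2 := by
  obtain ⟨ε₁, hε₁, h1⟩ := exists_norm_fderiv_sub_le hf' hf0 hκ
  obtain ⟨ε₂, hε₂, h2⟩ := Metric.eventually_nhds_iff.1 hf
  refine ⟨min ε₁ ε₂, lt_min hε₁ hε₂, fun h hh => ?_⟩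
  set D := fderiv ℝ (fderiv ℝ f) z₀
  have hth : ∀ t ∈ Set.Icc (0 : ℝ) 1, ‖t • h‖ ≤ ‖h‖ := fun t ht => by
    rw [norm_smul, Real.norm_of_nonneg ht.1]
    exact mul_le_of_le_one_left (norm_nonneg _) ht.2
  -- With the quadratic part subtracted, the derivative along the segment is the error in the
  -- linearization of the gradient. Differentiability of the gradient at the single point `z₀` is
  -- enough; no continuity of second derivatives is needed.
  have hd : ∀ t ∈ Set.Icc (0 : ℝ) 1, HasDerivAt (fun t : ℝ => f (z₀ + t • h) - D h h / 2 * t ^ 2)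
      (fderiv ℝ f (z₀ + t • h) h - D (t • h) h) t := by
    intro t ht
    have e1 : HasDerivAt (fun t : ℝ => z₀ + t • h) h t := by
      simpa using ((hasDerivAt_id t).smul_const h).const_add z₀
    have e2 : DifferentiableAt ℝ f (z₀ + t • h) :=
      h2 (by simpa using (hth t ht).trans_lt (hh.trans_le (min_le_right _ _)))
    have e3 := e2.hasFDerivAt.comp_hasDerivAt t e1
    have e4 := ((hasDerivAt_id t).pow 2).const_mul (D h h / 2)
    refine (e3.sub e4).congr_deriv ?_
    simp
    ring
  have key := norm_image_sub_le_of_norm_deriv_le_segment_01'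
    (f := fun t : ℝ => f (z₀ + t • h) - D h h / 2 * t ^ 2) (C := κ * ‖h‖ ^ 2)
    (fun t ht => (hd t ht).hasDerivWithinAt) (fun t ht => by
      have ht' : t ∈ Set.Icc (0 : ℝ) 1 := ⟨ht.1, ht.2.le⟩
      have e1 := h1 (t • h) ((hth t ht').trans_lt (hh.trans_le (min_le_left _ _)))
      rw [← _root_.sub_apply]
      refine (ContinuousLinearMap.le_opNorm _ _).trans ?_
      calc _ ≤ κ * ‖h‖ * ‖h‖ := by
            gcongr
            exact e1.trans (by gcongr; exact hth t ht')
        _ = _ := by ring)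
  simp only [one_smul, one_pow, mul_one, zero_smul, add_zero, ne_eq, OfNat.ofNat_ne_zero,
    not_false_eq_true, zero_pow, mul_zero, sub_zero, Real.norm_eq_abs] at key
  rwa [sub_right_comm] at key

/-- The gradient vanishes at `z₀` and grows at most linearly nearby; the mean value inequality is
applied on the smallest centred ball containing both points. -/
lemma exists_abs_sub_le_near_critical (hf : ∀ᶠ z in 𝓝 z₀, DifferentiableAt ℝ f z)
    (hf' : DifferentiableAt ℝ (fderiv ℝ f) z₀) (hf0 : fderiv ℝ f z₀ = 0) :
    ∃ C > 0, ∃ ε > 0, ∀ z w : E, ‖z - z₀‖ < ε → ‖w - z₀‖ < ε →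
      |f z - f w| ≤ C * (‖z - z₀‖ + ‖w - z₀‖) * ‖z - w‖ := by
  obtain ⟨ε₁, hε₁, h1⟩ := exists_norm_fderiv_sub_le hf' hf0 one_pos
  obtain ⟨ε₂, hε₂, h2⟩ := Metric.eventually_nhds_iff.1 hf
  set D := fderiv ℝ (fderiv ℝ f) z₀
  refine ⟨‖D‖ + 1, by positivity, min ε₁ ε₂, lt_min hε₁ hε₂, fun z w hz hw => ?_⟩
  set r := max ‖z - z₀‖ ‖w - z₀‖
  have hr : r < min ε₁ ε₂ := max_lt hz hw
  have hgrad : ∀ x ∈ Metric.closedBall z₀ r, ‖fderiv ℝ f x‖ ≤ (‖D‖ + 1) * r := by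
    intro x hx
    rw [mem_closedBall_iff_norm] at hx
    have e1 := h1 (x - z₀) (hx.trans_lt (hr.trans_le (min_le_left _ _)))
    rw [add_sub_cancel] at e1
    have e2 := D.le_opNorm (x - z₀)
    have e3 := norm_sub_norm_le (fderiv ℝ f x) (D (x - z₀))
    calc ‖fderiv ℝ f x‖ ≤ (‖D‖ + 1) * ‖x - z₀‖ := by linarith
      _ ≤ _ := by gcongr
  have key := Convex.norm_image_sub_le_of_norm_fderiv_le (s := Metric.closedBall z₀ r) (x := w)
    (y := z) (fun x hx => h2 ((Metric.mem_closedBall.1 hx).trans_lt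
      (hr.trans_le (min_le_right _ _)))) hgrad (convex_closedBall z₀ r)
    (mem_closedBall_iff_norm.2 (le_max_right _ _)) (mem_closedBall_iff_norm.2 (le_max_left _ _))
  rw [Real.norm_eq_abs] at key
  refine key.trans ?_
  gcongr
  exact max_le_add_of_nonneg (norm_nonneg _) (norm_nonneg _)

/-- Compactness of the unit sphere gives a positive minimum, and homogeneity extends it. -/
lemma exists_le_of_posDef [FiniteDimensional ℝ E] (D : E →L[ℝ] E →L[ℝ] ℝ)
    (hD : ∀ h, h ≠ 0 → 0 < D h h) : ∃ c > 0, ∀ h, c * ‖h‖ ^ 2 ≤ D h h := by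
  rcases subsingleton_or_nontrivial E with hE | hE
  · exact ⟨1, one_pos, fun h => by simp [Subsingleton.elim h 0]⟩
  have hcont : Continuous fun h : E => D h h := by fun_prop
  obtain ⟨h₀, hh₀, hmin⟩ := (isCompact_sphere (0 : E) 1).exists_isMinOn
    (NormedSpace.sphere_nonempty.2 zero_le_one) hcont.continuousOn
  rw [mem_sphere_zero_iff_norm] at hh₀
  refine ⟨D h₀ h₀, hD h₀ (by rintro rfl; simp at hh₀), fun h => ?_⟩
  rcases eq_or_ne h 0 with rfl | hne
  · simp
  have hn : 0 < ‖h‖ := norm_pos_iff.2 hne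
  have h1 : D h₀ h₀ ≤ D (‖h‖⁻¹ • h) (‖h‖⁻¹ • h) :=
    hmin (by simp [norm_smul, hn.ne'])
  simp only [map_smul, _root_.smul_apply, smul_eq_mul] at h1
  calc D h₀ h₀ * ‖h‖ ^ 2 ≤ ‖h‖⁻¹ * (‖h‖⁻¹ * D h h) * ‖h‖ ^ 2 := by gcongr
    _ = D h h := by field_simp

end Calculus

/-! ### Consequences of the assumptions -/

namespace Assumptions

variable {dz : ℕ} {Y : Type*} [MeasurableSpace Y] {M : ℝ} {ℓ : EuclideanSpace ℝ (Fin dz) → Y → ℝ}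
  {Z : Set (EuclideanSpace ℝ (Fin dz))} {Q : Measure Y} {z₀ : EuclideanSpace ℝ (Fin dz)}

lemma bound_nonneg (hA : Assumptions M ℓ Z Q z₀) : 0 ≤ M := by
  have := hA.isProbabilityMeasure
  obtain ⟨y, hy⟩ := hA.cost_bounded.exists
  exact (abs_nonneg _).trans (hy z₀ hA.mem)

lemma integrable_cost (hA : Assumptions M ℓ Z Q z₀) (hℓ : Measurable (Function.uncurry ℓ))
    {z : EuclideanSpace ℝ (Fin dz)} (hz : z ∈ Z) : Integrable (ℓ z) Q := by
  have := hA.isProbabilityMeasure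
  exact Integrable.of_bound hℓ.of_uncurry_left.aestronglyMeasurable M
    (hA.cost_bounded.mono fun y hy => hy z hz)

lemma abs_expectedCost_le (hA : Assumptions M ℓ Z Q z₀) {z : EuclideanSpace ℝ (Fin dz)}
    (hz : z ∈ Z) : |expectedCost ℓ Q z| ≤ M := by
  have := hA.isProbabilityMeasure
  have h := norm_integral_le_of_norm_le_const (μ := Q) (f := ℓ z)
    (hA.cost_bounded.mono fun y hy => hy z hz)
  simpa [expectedCost] using h

lemma abs_expectedCost_sub_le (hA : Assumptions M ℓ Z Q z₀) (hℓ : Measurable (Function.uncurry ℓ))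
    {z w : EuclideanSpace ℝ (Fin dz)} (hz : z ∈ Z) (hw : w ∈ Z) :
    |expectedCost ℓ Q z - expectedCost ℓ Q w| ≤ M * dist z w := by
  have := hA.isProbabilityMeasure
  have h := norm_integral_le_of_norm_le_const (μ := Q) (f := fun y => ℓ z y - ℓ w y)
    (hA.cost_lipschitz.mono fun y hy => hy z hz w hw)
  rw [integral_sub (hA.integrable_cost hℓ hz) (hA.integrable_cost hℓ hw)] at h
  simpa [expectedCost] using h

lemma expectedCost_le (hA : Assumptions M ℓ Z Q z₀) {z : EuclideanSpace ℝ (Fin dz)} (hz : z ∈ Z) :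
    expectedCost ℓ Q z₀ ≤ expectedCost ℓ Q z := by
  rcases eq_or_ne z z₀ with rfl | hne
  · rfl
  obtain ⟨η, hη, h⟩ := hA.wellSeparated (dist z z₀) (dist_pos.2 hne)
  linarith [h z hz le_rfl]

lemma mem_nhds (hA : Assumptions M ℓ Z Q z₀) : Z ∈ 𝓝 z₀ := hA.isOpen.mem_nhds hA.mem

lemma eventually_differentiableAt (hA : Assumptions M ℓ Z Q z₀) :
    ∀ᶠ z in 𝓝 z₀, DifferentiableAt ℝ (expectedCost ℓ Q) z :=
  Filter.mem_of_superset hA.mem_nhds fun z hz => (hA.smooth_expectedCost z hz).1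

lemma differentiableAt_fderiv (hA : Assumptions M ℓ Z Q z₀) :
    DifferentiableAt ℝ (fderiv ℝ (expectedCost ℓ Q)) z₀ := (hA.smooth_expectedCost z₀ hA.mem).2

/-- Quadratic growth of the expected cost at the optimal decision. -/
lemma exists_quadratic_growth (hA : Assumptions M ℓ Z Q z₀) :
    ∃ c > 0, ∃ ε > 0, ∀ z, ‖z - z₀‖ < ε →
      c * ‖z - z₀‖ ^ 2 ≤ expectedCost ℓ Q z - expectedCost ℓ Q z₀ := by
  obtain ⟨c, hc, h1⟩ := exists_le_of_posDef _ hA.second_order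
  obtain ⟨ε, hε, h2⟩ := exists_abs_taylor_two_le hA.eventually_differentiableAt
    hA.differentiableAt_fderiv hA.first_order (κ := c / 4) (by positivity)
  refine ⟨c / 4, by positivity, ε, hε, fun z hz => ?_⟩
  have h3 := (abs_le.1 (h2 _ hz)).1
  rw [add_sub_cancel] at h3
  linarith [h1 (z - z₀)]

/-- Near `z₀` this is the vanishing gradient; at distance at least `ε` the boundedness of the cost
suffices. -/
lemma exists_excess_le (hA : Assumptions M ℓ Z Q z₀) :
    ∃ C > 0, ∀ z ∈ Z, expectedCost ℓ Q z - expectedCost ℓ Q z₀ ≤ C * ‖z - z₀‖ ^ 2 := by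
  obtain ⟨C, hC, ε, hε, h⟩ := exists_abs_sub_le_near_critical hA.eventually_differentiableAt
    hA.differentiableAt_fderiv hA.first_order
  have hM := hA.bound_nonneg
  refine ⟨C + 2 * M / ε ^ 2, by positivity, fun z hz => ?_⟩
  rcases lt_or_ge ‖z - z₀‖ ε with hlt | hge
  · have h1 := (le_abs_self _).trans (h z z₀ hlt (by simpa using hε))
    have : 0 ≤ 2 * M / ε ^ 2 * ‖z - z₀‖ ^ 2 := by positivity
    rw [sub_self, norm_zero, add_zero] at h1
    nlinarith
  · have h1 := abs_le.1 (hA.abs_expectedCost_le hz)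
    have h2 := abs_le.1 (hA.abs_expectedCost_le hA.mem)
    have h3 : 2 * M ≤ 2 * M / ε ^ 2 * ‖z - z₀‖ ^ 2 := by
      rw [div_mul_eq_mul_div, le_div_iff₀ (by positivity)]
      gcongr
    have : 0 ≤ C * ‖z - z₀‖ ^ 2 := by positivity
    linarith [h1.2, h2.1]

lemma differentiableAt_cost (hA : Assumptions M ℓ Z Q z₀) (y : Y) :
    DifferentiableAt ℝ (fun z => ℓ z y) z₀ := (hA.smooth_cost y z₀ hA.mem).1

/-- A sequence of difference quotients gives both the measurability of the gradient in `y` and, by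
dominated convergence, the exchange of derivative and expectation. -/
lemma tendsto_slope (hA : Assumptions M ℓ Z Q z₀) (u : EuclideanSpace ℝ (Fin dz)) (y : Y) :
    Tendsto (fun n : ℕ => (n : ℝ) * (ℓ (z₀ + (n : ℝ)⁻¹ • u) y - ℓ z₀ y)) atTop
      (𝓝 (fderiv ℝ (fun z => ℓ z y) z₀ u)) :=
  ((hA.differentiableAt_cost y).hasFDerivAt.lim_real u).comp tendsto_natCast_atTop_atTop

lemma measurable_fderiv (hA : Assumptions M ℓ Z Q z₀) (hℓ : Measurable (Function.uncurry ℓ))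
    (u : EuclideanSpace ℝ (Fin dz)) : Measurable fun y => fderiv ℝ (fun z => ℓ z y) z₀ u :=
  measurable_of_tendsto_metrizable
    (fun _ => (hℓ.of_uncurry_left.sub hℓ.of_uncurry_left).const_mul _)
    (tendsto_pi_nhds.2 fun y => hA.tendsto_slope u y)

lemma ae_abs_fderiv_le (hA : Assumptions M ℓ Z Q z₀) (u : EuclideanSpace ℝ (Fin dz)) :
    ∀ᵐ y ∂Q, |fderiv ℝ (fun z => ℓ z y) z₀ u| ≤ M * ‖u‖ :=
  hA.gradient_bounded.mono fun _ hy =>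
    (ContinuousLinearMap.le_opNorm _ u).trans (mul_le_mul_of_nonneg_right (hy z₀ hA.mem) (norm_nonneg u))

lemma integrable_fderiv (hA : Assumptions M ℓ Z Q z₀) (hℓ : Measurable (Function.uncurry ℓ))
    (u : EuclideanSpace ℝ (Fin dz)) : Integrable (fun y => fderiv ℝ (fun z => ℓ z y) z₀ u) Q := by
  have := hA.isProbabilityMeasure
  exact Integrable.of_bound (hA.measurable_fderiv hℓ u).aestronglyMeasurable _
    (hA.ae_abs_fderiv_le u)

lemma eventually_add_mem (hA : Assumptions M ℓ Z Q z₀) :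
    ∀ᶠ h : EuclideanSpace ℝ (Fin dz) in 𝓝 0, z₀ + h ∈ Z := by
  have h : Tendsto (fun h : EuclideanSpace ℝ (Fin dz) => z₀ + h) (𝓝 0) (𝓝 z₀) := by
    simpa using (continuous_const_add z₀).tendsto 0
  exact h hA.mem_nhds

/-- The gradient of the cost at the optimal decision is centered. -/
lemma integral_fderiv_eq_zero (hA : Assumptions M ℓ Z Q z₀) (hℓ : Measurable (Function.uncurry ℓ))
    (u : EuclideanSpace ℝ (Fin dz)) : ∫ y, fderiv ℝ (fun z => ℓ z y) z₀ u ∂Q = 0 := by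
  have := hA.isProbabilityMeasure
  have hu : Tendsto (fun n : ℕ => (n : ℝ)⁻¹ • u) atTop (𝓝 0) := by
    simpa using (tendsto_inv_atTop_nhds_zero_nat (𝕜 := ℝ)).smul_const u
  have hmem := hu.eventually hA.eventually_add_mem
  have h1 : Tendsto (fun n : ℕ => ∫ y, (n : ℝ) * (ℓ (z₀ + (n : ℝ)⁻¹ • u) y - ℓ z₀ y) ∂Q) atTop
      (𝓝 (∫ y, fderiv ℝ (fun z => ℓ z y) z₀ u ∂Q)) := by
    refine tendsto_integral_filter_of_dominated_convergence (fun _ => M * ‖u‖)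
      (Eventually.of_forall fun n =>
        ((hℓ.of_uncurry_left.sub hℓ.of_uncurry_left).const_mul _).aestronglyMeasurable) ?_
      (integrable_const _) (ae_of_all _ fun y => hA.tendsto_slope u y)
    filter_upwards [hmem, eventually_gt_atTop 0] with n hn hn0
    filter_upwards [hA.cost_lipschitz] with y hy
    have h2 := hy _ hn _ hA.mem
    have hn' : (0 : ℝ) < n := by exact_mod_cast hn0
    rw [dist_self_add_left, norm_smul, norm_inv, Real.norm_of_nonneg hn'.le] at h2
    rw [norm_mul, Real.norm_of_nonneg hn'.le, Real.norm_eq_abs]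
    calc _ ≤ (n : ℝ) * (M * ((n : ℝ)⁻¹ * ‖u‖)) := by gcongr
      _ = _ := by field_simp
  have h2 : Tendsto (fun n : ℕ => (n : ℝ) *
      (expectedCost ℓ Q (z₀ + (n : ℝ)⁻¹ • u) - expectedCost ℓ Q z₀)) atTop (𝓝 0) := by
    have h3 := ((hA.smooth_expectedCost z₀ hA.mem).1.hasFDerivAt.lim_real u).comp
      tendsto_natCast_atTop_atTop
    rw [hA.first_order] at h3
    exact h3
  refine tendsto_nhds_unique h1 (h2.congr' ?_)
  filter_upwards [hmem] with n hn
  rw [integral_const_mul, integral_sub (hA.integrable_cost hℓ hn) (hA.integrable_cost hℓ hA.mem)]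
  rfl

/-- A direction in which the cost has a nondegenerate derivative. -/
lemma exists_integral_fderiv_sq_pos (hA : Assumptions M ℓ Z Q z₀)
    (hℓ : Measurable (Function.uncurry ℓ))
    (hnondeg : ¬ ∀ᵐ y ∂Q, fderiv ℝ (fun z => ℓ z y) z₀ = 0) :
    ∃ u, 0 < ∫ y, (fderiv ℝ (fun z => ℓ z y) z₀ u) ^ 2 ∂Q := by
  have := hA.isProbabilityMeasure
  by_contra! hcon
  refine hnondeg ?_
  have h1 : ∀ l, ∀ᵐ y ∂Q, fderiv ℝ (fun z => ℓ z y) z₀ (EuclideanSpace.basisFun _ ℝ l) = 0 := by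
    intro l
    set u := EuclideanSpace.basisFun (Fin dz) ℝ l
    have hint : Integrable (fun y => (fderiv ℝ (fun z => ℓ z y) z₀ u) ^ 2) Q :=
      Integrable.of_bound ((hA.measurable_fderiv hℓ u).pow_const 2).aestronglyMeasurable
        ((M * ‖u‖) ^ 2) ((hA.ae_abs_fderiv_le u).mono fun y hy => by
          rw [norm_pow, Real.norm_eq_abs]; gcongr)
    have h2 := (integral_eq_zero_iff_of_nonneg (fun y => sq_nonneg _) hint).1
      (le_antisymm (hcon u) (integral_nonneg fun y => sq_nonneg _))
    filter_upwards [h2] with y hy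
    simpa using hy
  filter_upwards [ae_all_iff.2 h1] with y hy
  refine ContinuousLinearMap.coe_injective
    ((EuclideanSpace.basisFun (Fin dz) ℝ).toBasis.ext fun l => ?_)
  simpa using hy l

/-- Differentiability of the cost in mean square at the optimal decision. -/
lemma exists_integral_sq_remainder_le (hA : Assumptions M ℓ Z Q z₀)
    (hℓ : Measurable (Function.uncurry ℓ)) {κ : ℝ} (hκ : 0 < κ) :
    ∃ ε > 0, ∀ h : EuclideanSpace ℝ (Fin dz), ‖h‖ < ε →
      ∫ y, (ℓ (z₀ + h) y - ℓ z₀ y - fderiv ℝ (fun z => ℓ z y) z₀ h) ^ 2 ∂Q ≤ κ * ‖h‖ ^ 2 := by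
  have := hA.isProbabilityMeasure
  have hM := hA.bound_nonneg
  have h1 : Tendsto (fun h : EuclideanSpace ℝ (Fin dz) => ∫ y,
      ((ℓ (z₀ + h) y - ℓ z₀ y - fderiv ℝ (fun z => ℓ z y) z₀ h) / ‖h‖) ^ 2 ∂Q) (𝓝 0)
      (𝓝 (∫ _, 0 ∂Q)) := by
    -- The Lipschitz and gradient bounds each contribute `M ‖h‖` to the remainder. At `h = 0` the
    -- quotient is `0`.
    refine tendsto_integral_filter_of_dominated_convergence (fun _ => (2 * M) ^ 2)
      (Eventually.of_forall fun h => ((((hℓ.of_uncurry_left.sub hℓ.of_uncurry_left).sub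
        (hA.measurable_fderiv hℓ h)).div_const _).pow_const 2).aestronglyMeasurable) ?_
      (integrable_const _) (ae_of_all _ fun y => ?_)
    · filter_upwards [hA.eventually_add_mem] with h hh
      filter_upwards [hA.cost_lipschitz, hA.ae_abs_fderiv_le h] with y hy1 hy2
      have h2 := hy1 _ hh _ hA.mem
      rw [dist_self_add_left] at h2
      rw [norm_pow, norm_div, norm_norm, Real.norm_eq_abs]
      refine pow_le_pow_left₀ (by positivity) (div_le_of_le_mul₀ (norm_nonneg _) (by positivity) ?_) 2
      refine (abs_sub _ _).trans ?_
      linarith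
    · have h2 := (hA.differentiableAt_cost y).hasFDerivAt
      rw [hasFDerivAt_iff_isLittleO_nhds_zero] at h2
      simpa using (h2.norm_right.tendsto_div_nhds_zero).pow 2
  rw [integral_zero] at h1
  obtain ⟨ε, hε, h2⟩ := Metric.eventually_nhds_iff.1 (h1.eventually (gt_mem_nhds hκ))
  refine ⟨ε, hε, fun h hh => ?_⟩
  have h3 := @h2 h (by simpa using hh)
  simp_rw [div_pow] at h3
  rw [integral_div] at h3
  rcases eq_or_ne h 0 with rfl | hne
  · simp
  · rw [div_lt_iff₀ (by have := norm_pos_iff.2 hne; positivity)] at h3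
    exact h3.le

end Assumptions

/-! ### A retraction onto a neighbourhood -/

/-- The coordinatewise projection onto the cube of half-side `ε` around `c`. -/
def clampCube {d : ℕ} (c : EuclideanSpace ℝ (Fin d)) (ε : ℝ) (z : EuclideanSpace ℝ (Fin d)) :
    EuclideanSpace ℝ (Fin d) :=
  WithLp.toLp 2 fun l => c l + max (-ε) (min ε (z l - c l))

lemma dist_clampCube_le {d : ℕ} (c : EuclideanSpace ℝ (Fin d)) (ε : ℝ)
    (z w : EuclideanSpace ℝ (Fin d)) : dist (clampCube c ε z) (clampCube c ε w) ≤ dist z w := by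
  rw [EuclideanSpace.dist_eq, EuclideanSpace.dist_eq]
  gcongr with l
  simp only [clampCube, dist_add_left, Real.dist_eq]
  refine (abs_max_sub_max_le_max _ _ _ _).trans ?_
  rw [sub_self, abs_zero, max_eq_right (abs_nonneg _)]
  refine (abs_min_sub_min_le_max _ _ _ _).trans ?_
  rw [sub_self, abs_zero, max_eq_right (abs_nonneg _), sub_sub_sub_cancel_right]

lemma clampCube_eq_self {d : ℕ} {c : EuclideanSpace ℝ (Fin d)} {ε : ℝ}
    {z : EuclideanSpace ℝ (Fin d)} (hz : ‖z - c‖ ≤ ε) : clampCube c ε z = z := by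
  ext l
  have h := abs_le.1 ((PiLp.norm_apply_le (z - c) l).trans hz)
  simp only [PiLp.sub_apply] at h
  simp only [clampCube]
  rw [min_eq_right h.2, max_eq_right h.1, add_sub_cancel]

lemma norm_clampCube_sub_le {d : ℕ} (c : EuclideanSpace ℝ (Fin d)) {ε : ℝ} (hε : 0 ≤ ε)
    (z : EuclideanSpace ℝ (Fin d)) : ‖clampCube c ε z - c‖ ≤ d * ε := by
  rw [EuclideanSpace.norm_eq]
  refine Real.sqrt_le_iff.2 ⟨by positivity, ?_⟩
  calc _ ≤ ∑ _l : Fin d, ε ^ 2 := by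
        gcongr with l
        simp only [clampCube, PiLp.sub_apply, add_sub_cancel_left, Real.norm_eq_abs]
        exact abs_le.2 ⟨le_max_left _ _, max_le (by linarith) (min_le_left _ _)⟩
    _ = d * ε ^ 2 := by simp
    _ ≤ (d * ε) ^ 2 := by
      rw [mul_pow]
      gcongr
      exact_mod_cast Nat.le_self_pow two_ne_zero d

/-- A `1`-Lipschitz map into a neighbourhood of `c` that is the identity near `c`. -/
lemma exists_retraction {d : ℕ} {c : EuclideanSpace ℝ (Fin d)}
    {U : Set (EuclideanSpace ℝ (Fin d))} (hU : U ∈ 𝓝 c) :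
    ∃ r : EuclideanSpace ℝ (Fin d) → EuclideanSpace ℝ (Fin d), (∀ z w, dist (r z) (r w) ≤ dist z w)
      ∧ (∀ z, r z ∈ U) ∧ ∃ ε > 0, ∀ z, ‖z - c‖ ≤ ε → r z = z := by
  obtain ⟨δ, hδ, hsub⟩ := Metric.mem_nhds_iff.1 hU
  have hε : 0 < δ / (d + 1) := by positivity
  refine ⟨clampCube c (δ / (d + 1)), dist_clampCube_le c _, fun z => hsub ?_, _, hε,
    fun z hz => clampCube_eq_self hz⟩
  rw [mem_ball_iff_norm]
  refine (norm_clampCube_sub_le c hε.le z).trans_lt ?_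
  rw [mul_div_assoc', div_lt_iff₀ (by positivity)]
  nlinarith

/-! ### The empirical process of one sample -/

/-- The total cost of a decision over the outcomes with index in `S`. -/
def totalCost {dz n : ℕ} {Y : Type*} (ℓ : EuclideanSpace ℝ (Fin dz) → Y → ℝ) (S : Finset (Fin n))
    (ω : Fin n → Y) (z : EuclideanSpace ℝ (Fin dz)) : ℝ :=
  ∑ i ∈ S, ℓ z (ω i)

/-- The deviation of the total cost from its expectation. -/
def deviation {dz n : ℕ} {Y : Type*} [MeasurableSpace Y] (ℓ : EuclideanSpace ℝ (Fin dz) → Y → ℝ)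
    (Q : Measure Y) (S : Finset (Fin n)) (ω : Fin n → Y) (z : EuclideanSpace ℝ (Fin dz)) : ℝ :=
  ∑ i ∈ S, (ℓ z (ω i) - expectedCost ℓ Q z)

lemma totalCost_eq {dz n : ℕ} {Y : Type*} [MeasurableSpace Y]
    (ℓ : EuclideanSpace ℝ (Fin dz) → Y → ℝ) (Q : Measure Y) (S : Finset (Fin n)) (ω : Fin n → Y)
    (z : EuclideanSpace ℝ (Fin dz)) :
    totalCost ℓ S ω z = deviation ℓ Q S ω z + S.card * expectedCost ℓ Q z := by
  simp [totalCost, deviation, Finset.sum_sub_distrib]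

namespace Assumptions

variable {dz : ℕ} {Y : Type*} [MeasurableSpace Y] {M : ℝ} {ℓ : EuclideanSpace ℝ (Fin dz) → Y → ℝ}
  {Z : Set (EuclideanSpace ℝ (Fin dz))} {Q : Measure Y} {z₀ : EuclideanSpace ℝ (Fin dz)}

lemma _root_.KNNBias.measurable_deviation (hℓ : Measurable (Function.uncurry ℓ)) {n : ℕ}
    (S : Finset (Fin n)) (z : EuclideanSpace ℝ (Fin dz)) :
    Measurable fun ω => deviation ℓ Q S ω z :=
  Finset.measurable_sum _ fun i _ =>
    (hℓ.of_uncurry_left.comp (measurable_pi_apply i)).sub measurable_const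

lemma integral_cost_sub_expectedCost (hA : Assumptions M ℓ Z Q z₀)
    (hℓ : Measurable (Function.uncurry ℓ)) {z : EuclideanSpace ℝ (Fin dz)} (hz : z ∈ Z) :
    ∫ y, (ℓ z y - expectedCost ℓ Q z) ∂Q = 0 := by
  have := hA.isProbabilityMeasure
  rw [integral_sub (hA.integrable_cost hℓ hz) (integrable_const _)]
  simp [expectedCost]

lemma ae_abs_deviation_sub_le (hA : Assumptions M ℓ Z Q z₀) (hℓ : Measurable (Function.uncurry ℓ))
    {n : ℕ} (S : Finset (Fin n)) : ∀ᵐ ω ∂(Measure.pi fun _ : Fin n => Q), ∀ z ∈ Z, ∀ w ∈ Z,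
      |deviation ℓ Q S ω z - deviation ℓ Q S ω w| ≤ S.card * (2 * M * dist z w) := by
  have := hA.isProbabilityMeasure
  filter_upwards [ae_pi_of_ae (ι := Fin n) hA.cost_lipschitz] with ω hω z hz w hw
  rw [deviation, deviation, ← Finset.sum_sub_distrib]
  refine (Finset.abs_sum_le_sum_abs _ _).trans ?_
  rw [← nsmul_eq_mul]
  refine Finset.sum_le_card_nsmul _ _ _ fun i _ => ?_
  rw [sub_sub_sub_comm]
  refine (abs_sub _ _).trans ?_
  linarith [hω i z hz w hw, hA.abs_expectedCost_sub_le hℓ hz hw]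

lemma ae_abs_totalCost_sub_le (hA : Assumptions M ℓ Z Q z₀) {n : ℕ} (S : Finset (Fin n)) :
    ∀ᵐ ω ∂(Measure.pi fun _ : Fin n => Q), ∀ z ∈ Z, ∀ w ∈ Z,
      |totalCost ℓ S ω z - totalCost ℓ S ω w| ≤ 2 * M * S.card := by
  have := hA.isProbabilityMeasure
  filter_upwards [ae_pi_of_ae (ι := Fin n) hA.cost_bounded] with ω hω z hz w hw
  rw [totalCost, totalCost, ← Finset.sum_sub_distrib]
  refine (Finset.abs_sum_le_sum_abs _ _).trans ?_
  rw [mul_comm, ← nsmul_eq_mul]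
  refine Finset.sum_le_card_nsmul _ _ _ fun i _ => ?_
  refine (abs_sub _ _).trans ?_
  linarith [hω i z hz, hω i w hw]

lemma lintegral_abs_deviation_sub_pow_le (hA : Assumptions M ℓ Z Q z₀)
    (hℓ : Measurable (Function.uncurry ℓ)) {n : ℕ} (S : Finset (Fin n)) (p : ℕ)
    {z w : EuclideanSpace ℝ (Fin dz)} (hz : z ∈ Z) (hw : w ∈ Z) :
    ∫⁻ ω, ENNReal.ofReal (|deviation ℓ Q S ω z - deviation ℓ Q S ω w| ^ p)
      ∂(Measure.pi fun _ : Fin n => Q)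
      ≤ ENNReal.ofReal (4 * p.factorial * (√S.card * (2 * M * dist z w)) ^ p) := by
  have := hA.isProbabilityMeasure
  have hM := hA.bound_nonneg
  set ξ : Y → ℝ := fun y => (ℓ z y - expectedCost ℓ Q z) - (ℓ w y - expectedCost ℓ Q w)
  have hξ : Measurable ξ :=
    (hℓ.of_uncurry_left.sub_const _).sub (hℓ.of_uncurry_left.sub_const _)
  have i1 := hA.integrable_cost hℓ hz
  have i2 := hA.integrable_cost hℓ hw
  have h0 : ∫ y, ξ y ∂Q = 0 := by
    have h := integral_sub (i1.sub (integrable_const (expectedCost ℓ Q z)))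
      (i2.sub (integrable_const (expectedCost ℓ Q w)))
    simp only [Pi.sub_apply, hA.integral_cost_sub_expectedCost hℓ hz,
      hA.integral_cost_sub_expectedCost hℓ hw, sub_zero] at h
    exact h
  have hB : ∀ᵐ y ∂Q, |ξ y| ≤ 2 * M * dist z w := by
    filter_upwards [hA.cost_lipschitz] with y hy
    simp only [ξ]
    rw [sub_sub_sub_comm]
    refine (abs_sub _ _).trans ?_
    linarith [hy z hz w hw, hA.abs_expectedCost_sub_le hℓ hz hw]
  have h := lintegral_abs_sum_pow_le hξ h0 (by positivity) hB S p
  simpa only [deviation, ← Finset.sum_sub_distrib] using h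

lemma integral_abs_deviation_pow_le (hA : Assumptions M ℓ Z Q z₀)
    (hℓ : Measurable (Function.uncurry ℓ)) {n : ℕ} (S : Finset (Fin n)) (p : ℕ)
    {z : EuclideanSpace ℝ (Fin dz)} (hz : z ∈ Z) :
    Integrable (fun ω => |deviation ℓ Q S ω z| ^ p) (Measure.pi fun _ : Fin n => Q) ∧
    ∫ ω, |deviation ℓ Q S ω z| ^ p ∂(Measure.pi fun _ : Fin n => Q)
      ≤ 4 * p.factorial * (√S.card * (2 * M)) ^ p := by
  have := hA.isProbabilityMeasure
  have hM := hA.bound_nonneg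
  refine integral_abs_sum_pow_le (ξ := fun y => ℓ z y - expectedCost ℓ Q z)
    (hℓ.of_uncurry_left.sub_const _) (hA.integral_cost_sub_expectedCost hℓ hz) (by positivity) ?_
    S p
  · filter_upwards [hA.cost_bounded] with y hy
    refine (abs_sub _ _).trans ?_
    linarith [hy z hz, hA.abs_expectedCost_le hz]

/-- A local modulus of continuity of the deviations, at every scale `τ / √k`. -/
lemma exists_local_modulus (hA : Assumptions M ℓ Z Q z₀) (hℓ : Measurable (Function.uncurry ℓ)) :
    ∃ C : ℝ, ∃ ε > 0, ∀ {n : ℕ} (S : Finset (Fin n)), S.Nonempty →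
      ∀ b, ‖b - z₀‖ ≤ ε → ∀ τ > 0, ∃ A : (Fin n → Y) → ℝ, (∀ ω, 0 ≤ A ω) ∧
        Integrable (fun ω => A ω ^ 4) (Measure.pi fun _ : Fin n => Q) ∧
        ∫ ω, A ω ^ 4 ∂(Measure.pi fun _ : Fin n => Q) ≤ C ∧
        ∀ᵐ ω ∂(Measure.pi fun _ : Fin n => Q), ∀ z, ‖z - z₀‖ ≤ ε →
          (deviation ℓ Q S ω z - deviation ℓ Q S ω b) ^ 2
            ≤ τ ^ 2 * A ω * (1 + √S.card * ‖z - b‖ / τ) ^ 3 := by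
  have := hA.isProbabilityMeasure
  have hM := hA.bound_nonneg
  -- Chaining needs a process on the whole space, but costs are controlled on `Z` only. Composition
  -- with a `1`-Lipschitz map into `Z` extends the process without worsening its increments, and
  -- changes nothing near `z₀`.
  obtain ⟨r, hr, hrZ, ε, hε, hrε⟩ := exists_retraction hA.mem_nhds
  set q := dz + 4
  have hq : (2 : ℝ) ^ dz * (2 / 3) ^ (2 * q) < 1 := by
    have e1 : (2 : ℝ) ^ dz * (2 / 3) ^ (2 * q) = (8 / 9) ^ dz * (4 / 9) ^ 4 := by
      rw [pow_mul, pow_add, ← mul_assoc, ← mul_pow]; norm_num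
    rw [e1]
    exact mul_lt_one_of_nonneg_of_lt_one_right (pow_le_one₀ (by norm_num) (by norm_num))
      (by norm_num) (by norm_num)
  obtain ⟨C, hC⟩ := exists_modulus dz q (by omega) hq
    (c := 4 * (2 * q).factorial * (2 * M) ^ (2 * q)) (by positivity)
  refine ⟨C, ε, hε, fun {n} S hS b hb τ hτ => ?_⟩
  set s := √(S.card : ℝ)
  have hs : 0 < s := Real.sqrt_pos.2 (by exact_mod_cast hS.card_pos)
  set ζ : EuclideanSpace ℝ (Fin dz) → EuclideanSpace ℝ (Fin dz) := fun x => r (b + (τ / s) • x)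
  have hζ : ∀ x y, dist (ζ x) (ζ y) ≤ τ / s * ‖x - y‖ := fun x y => by
    refine (hr _ _).trans ?_
    rw [dist_add_left, dist_eq_norm, ← smul_sub, norm_smul, Real.norm_of_nonneg (by positivity)]
  -- Moments of increments are of order `√k` times the distance; with space rescaled by `τ / √k` and
  -- values by `τ`, both factors cancel. The moment constant is thus free of `k`, `b` and `τ`.
  obtain ⟨A, -, hA0, hAi, hAC, hAE⟩ := hC (Measure.pi fun _ : Fin n => Q)
    (fun x ω => (deviation ℓ Q S ω (ζ x) - deviation ℓ Q S ω (ζ 0)) / τ)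
    (fun x => ((measurable_deviation hℓ S _).sub (measurable_deviation hℓ S _)).div_const _)
    (fun x y => by
      have h1 := hA.lintegral_abs_deviation_sub_pow_le hℓ S (2 * q) (hrZ (b + (τ / s) • x))
        (hrZ (b + (τ / s) • y))
      have h2 : ∀ ω, ENNReal.ofReal (|(deviation ℓ Q S ω (ζ x) - deviation ℓ Q S ω (ζ 0)) / τ -
          (deviation ℓ Q S ω (ζ y) - deviation ℓ Q S ω (ζ 0)) / τ| ^ (2 * q)) =
          ENNReal.ofReal ((τ ^ (2 * q))⁻¹) * ENNReal.ofReal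
            (|deviation ℓ Q S ω (ζ x) - deviation ℓ Q S ω (ζ y)| ^ (2 * q)) := by
        intro ω
        rw [← ENNReal.ofReal_mul (by positivity), ← sub_div, sub_sub_sub_cancel_right, abs_div,
          abs_of_pos hτ, div_pow, div_eq_inv_mul]
      simp_rw [h2]
      rw [lintegral_const_mul' _ _ ENNReal.ofReal_ne_top]
      refine (mul_le_mul_right h1 _).trans ?_
      rw [← ENNReal.ofReal_mul (by positivity)]
      refine ENNReal.ofReal_le_ofReal ?_
      calc (τ ^ (2 * q))⁻¹ * (4 * (2 * q).factorial * (s * (2 * M * dist (ζ x) (ζ y))) ^ (2 * q))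
          ≤ (τ ^ (2 * q))⁻¹ * (4 * (2 * q).factorial *
            (s * (2 * M * (τ / s * ‖x - y‖))) ^ (2 * q)) := by gcongr; exact hζ x y
        _ = _ := by
          rw [show s * (2 * M * (τ / s * ‖x - y‖)) = τ * (2 * M) * ‖x - y‖ by field_simp,
            mul_pow, mul_pow]
          field_simp)
    (by
      filter_upwards [hA.ae_abs_deviation_sub_le hℓ S] with ω hω
      refine ⟨?_, by simp⟩
      have h1 : LipschitzWith (Real.toNNReal (S.card * (2 * M * (τ / s))))
          fun x => deviation ℓ Q S ω (ζ x) := by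
        refine LipschitzWith.of_dist_le_mul fun x y => ?_
        rw [Real.dist_eq, Real.coe_toNNReal _ (by positivity)]
        refine (hω _ (hrZ _) _ (hrZ _)).trans ?_
        calc _ ≤ S.card * (2 * M * (τ / s * ‖x - y‖)) := by gcongr; exact hζ x y
          _ = _ := by rw [dist_eq_norm]; ring
      exact (h1.continuous.sub continuous_const).div_const _)
  refine ⟨A, hA0, hAi, hAC, ?_⟩
  filter_upwards [hAE] with ω hω z hz
  have h1 := hω ((s / τ) • (z - b))
  have e1 : ζ ((s / τ) • (z - b)) = z := by
    simp only [ζ, smul_smul]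
    rw [div_mul_div_cancel₀ hs.ne', div_self hτ.ne', one_smul, add_sub_cancel, hrε z hz]
  have e2 : ζ 0 = b := by simp only [ζ, smul_zero, add_zero, hrε b hb]
  rw [e1, e2, div_pow, div_le_iff₀ (by positivity), norm_smul,
    Real.norm_of_nonneg (by positivity), div_mul_eq_mul_div] at h1
  linarith

/-- With high probability the total cost has a minimizer, and every decision that is no worse
than `z₀` is close to `z₀`. -/
lemma exists_good_event (hA : Assumptions M ℓ Z Q z₀) (hℓ : Measurable (Function.uncurry ℓ))
    {ε : ℝ} (hε : 0 < ε) :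
    ∃ C ≥ 0, ∀ {n : ℕ} (S : Finset (Fin n)), S.Nonempty → ∃ G : Set (Fin n → Y),
      MeasurableSet G ∧
      (Measure.pi fun _ : Fin n => Q).real Gᶜ ≤ C / (S.card : ℝ) ^ 4 ∧
      ∀ᵐ ω ∂(Measure.pi fun _ : Fin n => Q), ω ∈ G →
        (∃ z ∈ Z, IsMinOn (totalCost ℓ S ω) Z z) ∧
        ∀ z ∈ Z, totalCost ℓ S ω z ≤ totalCost ℓ S ω z₀ → ‖z - z₀‖ < ε := by
  have := hA.isProbabilityMeasure
  have hM := hA.bound_nonneg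
  obtain ⟨ε', hε', hball⟩ := Metric.nhds_basis_closedBall.mem_iff.1 hA.mem_nhds
  set δ := min ε ε'
  have hδ : 0 < δ := lt_min hε hε'
  have hballδ : Metric.closedBall z₀ δ ⊆ Z :=
    (Metric.closedBall_subset_closedBall (min_le_right _ _)).trans hball
  obtain ⟨η, hη, hsep⟩ := hA.wellSeparated δ hδ
  -- With this mesh, moving to the nearest net point changes the deviation by at most `k η / 16`.
  -- Together with `k η / 8` on the net, deviations stay below `3 k η / 16` on `Z`; two of them
  -- cannot offset the gap `k η` of a far decision.
  have hρ : 0 < η / (32 * (M + 1)) := by positivity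
  obtain ⟨t, htZ, htfin, hcov⟩ := Metric.finite_approx_of_totallyBounded
    (hA.isBounded.isCompact_closure.totallyBounded.subset subset_closure) _ hρ
  set T := htfin.toFinset
  have hTZ : ∀ w ∈ T, w ∈ Z := fun w hw => htZ (htfin.mem_toFinset.1 hw)
  obtain ⟨F, hF⟩ : ∃ F : ℝ, F = Nat.factorial 8 := ⟨_, rfl⟩
  have hF0 : 0 ≤ F := hF ▸ Nat.cast_nonneg _
  set K : ℝ := 4 * F * (2 * M) ^ 8 / (η / 8) ^ 8
  refine ⟨T.card * K, by positivity, fun {n} S hS => ?_⟩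
  set k : ℝ := (S.card : ℝ) with hkdef
  have hk : 0 < k := by simpa [hkdef] using hS.card_pos
  refine ⟨⋂ w ∈ T, {ω | |deviation ℓ Q S ω w| < k * (η / 8)},
    Finset.measurableSet_biInter _ fun w _ =>
      measurableSet_lt (measurable_deviation hℓ S w).abs measurable_const, ?_, ?_⟩
  -- The eighth moment is `O(k ^ 4)`, so Markov's inequality at a level of order `k` yields `k ^
  -- (-4)`. This decay absorbs the factors up to `k ^ 2` that the crude bounds bring on the
  -- complement.
  · have hbad : ∀ w ∈ T, (Measure.pi fun _ : Fin n => Q).real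
        {ω | |deviation ℓ Q S ω w| < k * (η / 8)}ᶜ ≤ K / k ^ 4 := by
      intro w hw
      obtain ⟨i1, h1⟩ := hA.integral_abs_deviation_pow_le hℓ S 8 (hTZ w hw)
      rw [← hF] at h1
      have h2 := mul_meas_ge_le_integral_of_nonneg (ae_of_all _ fun ω => by positivity) i1
        ((k * (η / 8)) ^ 8)
      have h3 : {ω | |deviation ℓ Q S ω w| < k * (η / 8)}ᶜ
          = {ω | (k * (η / 8)) ^ 8 ≤ |deviation ℓ Q S ω w| ^ 8} := by
        ext ω
        simp only [Set.mem_compl_iff, Set.mem_ofPred_eq, not_lt]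
        exact (pow_le_pow_iff_left₀ (by positivity) (abs_nonneg _) (by norm_num)).symm
      rw [h3]
      have h4 : (√k * (2 * M)) ^ 8 = k ^ 4 * (2 * M) ^ 8 := by
        rw [mul_pow, show (8 : ℕ) = 2 * 4 by norm_num, pow_mul √k, Real.sq_sqrt hk.le]
      rw [h4] at h1
      rw [le_div_iff₀ (by positivity)]
      have h5 := h2.trans h1
      rw [mul_comm, ← le_div_iff₀ (by positivity)] at h5
      calc _ ≤ _ := mul_le_mul_of_nonneg_right h5 (by positivity)
        _ = K := by simp only [K]; field_simp
    rw [Set.compl_iInter₂]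
    refine (measureReal_biUnion_finset_le _ _).trans ((Finset.sum_le_sum hbad).trans ?_)
    rw [Finset.sum_const, nsmul_eq_mul, mul_div_assoc]
  · filter_upwards [hA.ae_abs_deviation_sub_le hℓ S,
      ae_pi_of_ae (ι := Fin n) hA.cost_lipschitz] with ω hω hlip hG
    have hdev : ∀ z ∈ Z, |deviation ℓ Q S ω z| ≤ k * (η * (3 / 16)) := by
      intro z hz
      obtain ⟨w, hw, hzw⟩ := Set.mem_iUnion₂.1 (hcov hz)
      have h1 := hω z hz w (htZ hw)
      have h2 : |deviation ℓ Q S ω w| < k * (η / 8) :=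
        Set.mem_iInter₂.1 hG w (htfin.mem_toFinset.2 hw)
      have h3 : 2 * M * dist z w ≤ η / 16 := by
        have h4 := (Metric.mem_ball.1 hzw).le
        rw [le_div_iff₀ (by positivity)] at h4
        nlinarith [dist_nonneg (x := z) (y := w)]
      have h5 : k * (2 * M * dist z w) ≤ k * (η / 16) := by gcongr
      have h6 := abs_sub_abs_le_abs_sub (deviation ℓ Q S ω z) (deviation ℓ Q S ω w)
      linarith
    have hfar : ∀ z ∈ Z, totalCost ℓ S ω z ≤ totalCost ℓ S ω z₀ → ‖z - z₀‖ < δ := by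
      intro z hz hle
      by_contra! hcon
      rw [← dist_eq_norm] at hcon
      have h1 := hsep z hz hcon
      rw [totalCost_eq ℓ Q, totalCost_eq ℓ Q] at hle
      have h2 := abs_le.1 (hdev z hz)
      have h3 := abs_le.1 (hdev z₀ hA.mem)
      have h4 : k * (expectedCost ℓ Q z₀ + η) ≤ k * expectedCost ℓ Q z := by gcongr
      have h5 : 0 < k * η := by positivity
      change deviation ℓ Q S ω z + k * _ ≤ _ + k * _ at hle
      nlinarith
    refine ⟨?_, fun z hz hle => (hfar z hz hle).trans_le (min_le_left _ _)⟩
    -- `Z` is open, so existence of a minimizer is not automatic: one is found on a compact ball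
    -- inside `Z`, outside of which every decision is worse than `z₀`.
    have hcont : ContinuousOn (totalCost ℓ S ω) (Metric.closedBall z₀ δ) := by
      refine continuousOn_finsetSum _ fun i _ => ?_
      have h1 : LipschitzOnWith M.toNNReal (fun z => ℓ z (ω i)) (Metric.closedBall z₀ δ) :=
        LipschitzOnWith.of_dist_le_mul fun z hz w hw => by
          rw [Real.dist_eq, Real.coe_toNNReal _ hM]
          exact hlip i z (hballδ hz) w (hballδ hw)
      exact h1.continuousOn
    obtain ⟨z₁, hz₁, hmin⟩ := (isCompact_closedBall z₀ δ).exists_isMinOn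
      (Metric.nonempty_closedBall.2 hδ.le) hcont
    refine ⟨z₁, hballδ hz₁, fun z hz => ?_⟩
    have h0 : totalCost ℓ S ω z₁ ≤ totalCost ℓ S ω z₀ := hmin (Metric.mem_closedBall_self hδ.le)
    rcases le_or_gt (totalCost ℓ S ω z) (totalCost ℓ S ω z₀) with hle | hgt
    · exact hmin (mem_closedBall_iff_norm.2 (hfar z hz hle).le)
    · exact h0.trans hgt.le

end Assumptions

/-! ### A decision that improves on a fixed one -/

/-- Integration of `2 B |W| ≤ W ^ 2 + B ^ 2`, using the variance of an independent sum. -/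
lemma integral_abs_sum_le {Y : Type*} [MeasurableSpace Y] {Q : Measure Y} [IsProbabilityMeasure Q]
    {ξ : Y → ℝ} (hξ : MemLp ξ 2 Q) (hξ0 : ∫ y, ξ y ∂Q = 0) {n : ℕ} (S : Finset (Fin n)) {B : ℝ}
    (hB : 0 < B) (h : S.card * ∫ y, ξ y ^ 2 ∂Q ≤ B ^ 2) :
    ∫ ω, |∑ i ∈ S, ξ (ω i)| ∂(Measure.pi fun _ : Fin n => Q) ≤ B := by
  have hL : MemLp (fun ω : Fin n → Y => ∑ i ∈ S, ξ (ω i)) 2 (Measure.pi fun _ : Fin n => Q) :=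
    memLp_finsetSum _ fun i _ =>
      hξ.comp_measurePreserving (measurePreserving_eval (fun _ : Fin n => Q) i)
  have i1 := hL.integrable_sq
  have i2 : Integrable (fun ω : Fin n → Y => |∑ i ∈ S, ξ (ω i)|) (Measure.pi fun _ => Q) :=
    (hL.integrable (by norm_num)).abs
  have hle := integral_mono (i2.const_mul (2 * B)) (i1.add (integrable_const (B ^ 2)))
    (fun ω => by
      simp only [Pi.add_apply]
      nlinarith [sq_nonneg (|∑ i ∈ S, ξ (ω i)| - B), sq_abs (∑ i ∈ S, ξ (ω i))])
  simp only [Pi.add_apply] at hle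
  rw [integral_const_mul, integral_add i1 (integrable_const _), integral_sq_sum_eq hξ hξ0] at hle
  simp only [integral_const, probReal_univ, one_smul] at hle
  nlinarith

lemma sum_sub_sub_sub_const {ι : Type*} (S : Finset ι) (f g h : ι → ℝ) (a : ℝ) :
    ∑ i ∈ S, (f i - g i - h i - a) = ∑ i ∈ S, f i - ∑ i ∈ S, g i - ∑ i ∈ S, h i - S.card * a := by
  simp [Finset.sum_sub_distrib]

/-- For centred `w`, Jensen gives `|a| ≤ E |w - a|`, so removing the shift costs at most a factor
`2`. -/
lemma le_integral_abs_sub {Ω : Type*} [MeasurableSpace Ω] {P : Measure Ω} [IsProbabilityMeasure P]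
    {w : Ω → ℝ} (hw : Integrable w P) (hw0 : ∫ ω, w ω ∂P = 0) (a : ℝ) :
    (∫ ω, |w ω| ∂P) / 2 ≤ ∫ ω, |w ω - a| ∂P := by
  have i1 : Integrable (fun ω => w ω - a) P := hw.sub (integrable_const a)
  have h1 : |a| ≤ ∫ ω, |w ω - a| ∂P := by
    have h := abs_integral_le_integral_abs (f := fun ω => w ω - a) (μ := P)
    rw [integral_sub hw (integrable_const a), hw0] at h
    simpa using h
  have h2 : ∫ ω, |w ω| ∂P ≤ ∫ ω, (|w ω - a| + |a|) ∂P :=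
    integral_mono hw.abs (i1.abs.add (integrable_const _)) fun ω => by
      have := abs_add_le (w ω - a) a
      rwa [sub_add_cancel] at this
  rw [integral_add i1.abs (integrable_const _)] at h2
  simp only [integral_const, probReal_univ, one_smul] at h2
  linarith

namespace Assumptions

variable {dz : ℕ} {Y : Type*} [MeasurableSpace Y] {M : ℝ} {ℓ : EuclideanSpace ℝ (Fin dz) → Y → ℝ}
  {Z : Set (EuclideanSpace ℝ (Fin dz))} {Q : Measure Y} {z₀ : EuclideanSpace ℝ (Fin dz)}

lemma memLp_cost (hA : Assumptions M ℓ Z Q z₀) (hℓ : Measurable (Function.uncurry ℓ))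
    {z : EuclideanSpace ℝ (Fin dz)} (hz : z ∈ Z) : MemLp (ℓ z) 2 Q := by
  have := hA.isProbabilityMeasure
  exact MemLp.of_bound hℓ.of_uncurry_left.aestronglyMeasurable M
    (hA.cost_bounded.mono fun y hy => hy z hz)

lemma memLp_fderiv (hA : Assumptions M ℓ Z Q z₀) (hℓ : Measurable (Function.uncurry ℓ))
    (u : EuclideanSpace ℝ (Fin dz)) : MemLp (fun y => fderiv ℝ (fun z => ℓ z y) z₀ u) 2 Q := by
  have := hA.isProbabilityMeasure
  exact MemLp.of_bound (hA.measurable_fderiv hℓ u).aestronglyMeasurable _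
    (hA.ae_abs_fderiv_le u)

/-- The centered error of the linearization of the cost between two decisions near `z₀` is small
in mean square. -/
lemma integral_sq_linearization_le (hA : Assumptions M ℓ Z Q z₀)
    (hℓ : Measurable (Function.uncurry ℓ)) {x h : EuclideanSpace ℝ (Fin dz)} (hx : z₀ + x ∈ Z)
    (hxh : z₀ + (x + h) ∈ Z) {B : ℝ}
    (h1 : ∫ y, (ℓ (z₀ + x) y - ℓ z₀ y - fderiv ℝ (fun z => ℓ z y) z₀ x) ^ 2 ∂Q ≤ B)
    (h2 : ∫ y, (ℓ (z₀ + (x + h)) y - ℓ z₀ y - fderiv ℝ (fun z => ℓ z y) z₀ (x + h)) ^ 2 ∂Q ≤ B) :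
    let ξ : Y → ℝ := fun y => ℓ (z₀ + (x + h)) y - ℓ (z₀ + x) y - fderiv ℝ (fun z => ℓ z y) z₀ h
      - (expectedCost ℓ Q (z₀ + (x + h)) - expectedCost ℓ Q (z₀ + x))
    MemLp ξ 2 Q ∧ ∫ y, ξ y ∂Q = 0 ∧ ∫ y, ξ y ^ 2 ∂Q ≤ 4 * B := by
  have := hA.isProbabilityMeasure
  intro ξ
  set f : Y → ℝ := fun y =>
    ℓ (z₀ + (x + h)) y - ℓ (z₀ + x) y - fderiv ℝ (fun z => ℓ z y) z₀ h with hf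
  set a := expectedCost ℓ Q (z₀ + (x + h)) - expectedCost ℓ Q (z₀ + x)
  have hfL : MemLp f 2 Q :=
    ((hA.memLp_cost hℓ hxh).sub (hA.memLp_cost hℓ hx)).sub (hA.memLp_fderiv hℓ h)
  have hfi : Integrable f Q := hfL.integrable (by norm_num)
  have hξL : MemLp ξ 2 Q := hfL.sub (memLp_const a)
  have hfa : ∫ y, f y ∂Q = a := by
    have e1 := integral_sub ((hA.integrable_cost hℓ hxh).sub (hA.integrable_cost hℓ hx))
      (hA.integrable_fderiv hℓ h)
    have e2 := integral_sub (hA.integrable_cost hℓ hxh) (hA.integrable_cost hℓ hx)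
    simp only [Pi.sub_apply] at e1 e2
    rw [hA.integral_fderiv_eq_zero hℓ, sub_zero, e2] at e1
    exact e1
  have hξ0 : ∫ y, ξ y ∂Q = 0 := by
    have e := integral_sub hfi (integrable_const a)
    rw [hfa] at e
    simpa using e
  refine ⟨hξL, hξ0, ?_⟩
  -- Centring lowers the second moment: the gradient has mean zero, so `a` is the mean of `f`. What
  -- remains is a difference of two remainders at `z₀`.
  have e1 : ∫ y, ξ y ^ 2 ∂Q ≤ ∫ y, f y ^ 2 ∂Q := by
    have e2 : ∀ y, f y ^ 2 = ξ y ^ 2 + (2 * a * ξ y + a ^ 2) := fun y => by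
      simp only [ξ, hf]; ring
    have i1 := hξL.integrable_sq
    have i2 : Integrable ξ Q := hξL.integrable (by norm_num)
    have i3 : Integrable (fun y => 2 * a * ξ y + a ^ 2) Q :=
      (i2.const_mul _).add (integrable_const _)
    simp_rw [e2]
    rw [integral_add i1 i3, integral_add (i2.const_mul _) (integrable_const _), integral_const_mul, hξ0]
    simp [sq_nonneg]
  refine e1.trans ?_
  set R₁ : Y → ℝ := fun y => ℓ (z₀ + x) y - ℓ z₀ y - fderiv ℝ (fun z => ℓ z y) z₀ x
  set R₂ : Y → ℝ := fun y =>
    ℓ (z₀ + (x + h)) y - ℓ z₀ y - fderiv ℝ (fun z => ℓ z y) z₀ (x + h)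
  have hR₁ : MemLp R₁ 2 Q :=
    ((hA.memLp_cost hℓ hx).sub (hA.memLp_cost hℓ hA.mem)).sub (hA.memLp_fderiv hℓ x)
  have hR₂ : MemLp R₂ 2 Q :=
    ((hA.memLp_cost hℓ hxh).sub (hA.memLp_cost hℓ hA.mem)).sub (hA.memLp_fderiv hℓ (x + h))
  have e2 : ∫ y, f y ^ 2 ∂Q ≤ ∫ y, (2 * R₁ y ^ 2 + 2 * R₂ y ^ 2) ∂Q :=
    integral_mono hfL.integrable_sq
      ((hR₁.integrable_sq.const_mul 2).add (hR₂.integrable_sq.const_mul 2)) fun y => by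
        have e3 : f y = R₂ y - R₁ y := by simp only [hf, R₁, R₂, map_add]; ring
        simp only [e3]
        nlinarith [sq_nonneg (R₁ y + R₂ y)]
  rw [integral_add (hR₁.integrable_sq.const_mul 2) (hR₂.integrable_sq.const_mul 2),
    integral_const_mul, integral_const_mul] at e2
  linarith

lemma integrable_totalCost (hA : Assumptions M ℓ Z Q z₀) (hℓ : Measurable (Function.uncurry ℓ))
    {n : ℕ} (S : Finset (Fin n)) {z : EuclideanSpace ℝ (Fin dz)} (hz : z ∈ Z) :
    Integrable (fun ω => totalCost ℓ S ω z) (Measure.pi fun _ : Fin n => Q) := by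
  have := hA.isProbabilityMeasure
  exact integrable_finsetSum _ fun i _ => integrable_comp_eval_pi (hA.integrable_cost hℓ hz) i

set_option maxHeartbeats 1000000 in
/-- Near `z₀`, at the scale `1 / √k`, the better of two opposite shifts of a decision `b` improves
the total cost of `b` by a constant in expectation. -/
theorem exists_improvement (hA : Assumptions M ℓ Z Q z₀) (hℓ : Measurable (Function.uncurry ℓ))
    (hnondeg : ¬ ∀ᵐ y ∂Q, fderiv ℝ (fun z => ℓ z y) z₀ = 0) {K : ℝ} (hK : 0 ≤ K) :
    ∃ c > 0, ∃ k₀ : ℕ, ∀ {n : ℕ} (S : Finset (Fin n)), k₀ ≤ S.card → ∀ b,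
      √S.card * ‖b - z₀‖ ≤ K → b ∈ Z ∧ ∃ b₁ ∈ Z, ∃ b₂ ∈ Z,
        c ≤ ∫ ω, max (totalCost ℓ S ω b - totalCost ℓ S ω b₁)
          (totalCost ℓ S ω b - totalCost ℓ S ω b₂) ∂(Measure.pi fun _ : Fin n => Q) := by
  have := hA.isProbabilityMeasure
  obtain ⟨u, hu⟩ := hA.exists_integral_fderiv_sq_pos hℓ hnondeg
  obtain ⟨c₁, hc₁, hW⟩ := exists_le_integral_abs_sum (hA.measurable_fderiv hℓ u)
    (hA.integral_fderiv_eq_zero hℓ u) (mul_nonneg hA.bound_nonneg (norm_nonneg u))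
    (hA.ae_abs_fderiv_le u) hu
  have hu0 : 0 < ‖u‖ := by
    rw [norm_pos_iff]
    rintro rfl
    simp at hu
  set D := fderiv ℝ (fderiv ℝ (expectedCost ℓ Q)) z₀
  set H := D u u
  -- The gain is linear in `t` and the curvature loss quadratic; this `t` keeps `t ^ 2 H` below half
  -- of `t c₁`.
  set t := c₁ / (2 * (|H| + 1))
  have ht : 0 < t := by positivity
  have htH : t * H ≤ c₁ / 2 := by
    have h1 : t * (|H| + 1) = c₁ / 2 := by simp only [t]; field_simp
    nlinarith [le_abs_self H]
  set L := K + t * ‖u‖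
  have hL : 0 < L := by positivity
  -- The tolerance for Taylor and linearization errors on the ball of radius `L / √k`, which
  -- contains `b` and both shifts. The errors cost `2 s L ^ 2 + 4 s L ≤ t c₁ / 8`, out of `t c₁ / 2`
  -- from the gradient minus `t c₁ / 4` from curvature.
  set s := min 1 (t * c₁ / (8 * (2 * L ^ 2 + 4 * L)))
  have hs : 0 < s := lt_min one_pos (by positivity)
  have hs1 : s ≤ 1 := min_le_left _ _
  have hsL : s * (2 * L ^ 2 + 4 * L) ≤ t * c₁ / 8 := by
    have h1 : s ≤ t * c₁ / (8 * (2 * L ^ 2 + 4 * L)) := min_le_right _ _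
    rw [le_div_iff₀ (by positivity)] at h1
    linarith
  obtain ⟨ε₁, hε₁, hT⟩ := exists_abs_taylor_two_le hA.eventually_differentiableAt
    hA.differentiableAt_fderiv hA.first_order (κ := s ^ 2) (by positivity)
  obtain ⟨ε₂, hε₂, hR⟩ := hA.exists_integral_sq_remainder_le hℓ (κ := s ^ 2) (by positivity)
  obtain ⟨ε₃, hε₃, hZ⟩ := Metric.eventually_nhds_iff.1 hA.eventually_add_mem
  set ε := min ε₁ (min ε₂ ε₃)
  have hε : 0 < ε := lt_min hε₁ (lt_min hε₂ hε₃)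
  refine ⟨t * c₁ / 8, by positivity, ⌈(L / ε) ^ 2⌉₊ + 1, fun {n} S hS b hb => ?_⟩
  set k : ℝ := (S.card : ℝ) with hkdef
  have hk : (L / ε) ^ 2 < k := by
    have h1 := Nat.le_ceil ((L / ε) ^ 2)
    have h2 : ((⌈(L / ε) ^ 2⌉₊ + 1 : ℕ) : ℝ) ≤ k := by rw [hkdef]; exact_mod_cast hS
    push_cast at h2
    linarith
  have hk0 : 0 < k := (sq_nonneg _).trans_lt hk
  have hsk : 0 < √k := Real.sqrt_pos.2 hk0
  have hsk2 : √k ^ 2 = k := Real.sq_sqrt hk0.le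
  have hLk : L / √k < ε := by
    rw [div_lt_iff₀ hsk, mul_comm, ← div_lt_iff₀ hε]
    exact (Real.lt_sqrt (by positivity)).2 hk
  set x := b - z₀
  have hbx : z₀ + x = b := add_sub_cancel _ _
  set h := (t / √k) • u with hh
  have hxn : ‖x‖ ≤ K / √k := by rw [le_div_iff₀ hsk]; linarith
  have hhn : ‖h‖ = t * ‖u‖ / √k := by
    rw [hh, norm_smul, Real.norm_of_nonneg (by positivity)]; ring
  have hsum : K / √k + t * ‖u‖ / √k = L / √k := (add_div _ _ _).symm
  have hn0 : ‖x‖ ≤ L / √k := hxn.trans (by rw [← hsum]; linarith [norm_nonneg h])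
  have hnp : ‖x + h‖ ≤ L / √k := (norm_add_le _ _).trans (by rw [hhn, ← hsum]; linarith)
  have hnm : ‖x + -h‖ ≤ L / √k :=
    (norm_add_le _ _).trans (by rw [norm_neg, hhn, ← hsum]; linarith)
  have hmem : ∀ x', ‖x'‖ ≤ L / √k → z₀ + x' ∈ Z := fun x' hx' =>
    @hZ x' (by
      rw [dist_zero_right]
      exact (hx'.trans_lt hLk).trans_le ((min_le_right _ _).trans (min_le_right _ _)))
  have hT' : ∀ x', ‖x'‖ ≤ L / √k → |expectedCost ℓ Q (z₀ + x') - expectedCost ℓ Q z₀ -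
      D x' x' / 2| ≤ s ^ 2 * L ^ 2 / k := fun x' hx' => by
    refine (hT x' ((hx'.trans_lt hLk).trans_le (min_le_left _ _))).trans ?_
    calc s ^ 2 * ‖x'‖ ^ 2 ≤ s ^ 2 * (L / √k) ^ 2 := by gcongr
      _ = _ := by rw [div_pow, hsk2]; ring
  have hR' : ∀ x', ‖x'‖ ≤ L / √k → ∫ y, (ℓ (z₀ + x') y - ℓ z₀ y -
      fderiv ℝ (fun z => ℓ z y) z₀ x') ^ 2 ∂Q ≤ s ^ 2 * L ^ 2 / k := fun x' hx' => by
    refine (hR x' ((hx'.trans_lt hLk).trans_le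
      ((min_le_right _ _).trans (min_le_left _ _)))).trans ?_
    calc s ^ 2 * ‖x'‖ ^ 2 ≤ s ^ 2 * (L / √k) ^ 2 := by gcongr
      _ = _ := by rw [div_pow, hsk2]; ring
  have hp := hmem _ hnp
  have hm := hmem _ hnm
  have hb0 := hmem _ hn0
  refine ⟨hbx ▸ hb0, _, hp, _, hm, ?_⟩
  obtain ⟨lp, zp, sp⟩ := hA.integral_sq_linearization_le hℓ hb0 hp (hR' _ hn0) (hR' _ hnp)
  obtain ⟨lm, zm, sm⟩ := hA.integral_sq_linearization_le hℓ hb0 hm (hR' _ hn0) (hR' _ hnm)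
  set ξp : Y → ℝ := fun y => ℓ (z₀ + (x + h)) y - ℓ (z₀ + x) y - fderiv ℝ (fun z => ℓ z y) z₀ h
      - (expectedCost ℓ Q (z₀ + (x + h)) - expectedCost ℓ Q (z₀ + x)) with hξp
  set ξm : Y → ℝ := fun y => ℓ (z₀ + (x + -h)) y - ℓ (z₀ + x) y
      - fderiv ℝ (fun z => ℓ z y) z₀ (-h)
      - (expectedCost ℓ Q (z₀ + (x + -h)) - expectedCost ℓ Q (z₀ + x)) with hξm
  set ap := k * (expectedCost ℓ Q (z₀ + (x + h)) - expectedCost ℓ Q (z₀ + x))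
  set am := k * (expectedCost ℓ Q (z₀ + (x + -h)) - expectedCost ℓ Q (z₀ + x))
  have ha : ap + am ≤ t ^ 2 * H + 4 * (s ^ 2 * L ^ 2) := by
    have h1 := abs_le.1 (hT' _ hn0)
    have h2 := abs_le.1 (hT' _ hnp)
    have h3 := abs_le.1 (hT' _ hnm)
    have h4 : D h h = t ^ 2 * H / k := by
      simp only [hh, map_smul, _root_.smul_apply, smul_eq_mul, H]
      rw [show t / √k * (t / √k * D u u) = t ^ 2 * D u u / √k ^ 2 by ring, hsk2]
    -- In opposite shifts the cross terms in `x` and `h` cancel, so the position of `b` relative to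
    -- `z₀` does not enter the main terms.
    have h5 : D (x + h) (x + h) + D (x + -h) (x + -h) - 2 * D x x = 2 * (t ^ 2 * H / k) := by
      rw [← h4]
      simp only [map_add, map_neg, _root_.add_apply, _root_.neg_apply]
      ring
    have h6 : ap + am = k * (expectedCost ℓ Q (z₀ + (x + h)) + expectedCost ℓ Q (z₀ + (x + -h))
        - 2 * expectedCost ℓ Q (z₀ + x)) := by simp only [ap, am]; ring
    rw [h6]
    calc _ ≤ k * (t ^ 2 * H / k + 4 * (s ^ 2 * L ^ 2 / k)) := by
          gcongr
          linarith [h1.1, h2.2, h3.2]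
      _ = _ := by field_simp
  set w : (Fin n → Y) → ℝ := fun ω => ∑ i ∈ S, fderiv ℝ (fun z => ℓ z (ω i)) z₀ h with hw
  set ep : (Fin n → Y) → ℝ := fun ω => ∑ i ∈ S, ξp (ω i) with hep
  set em : (Fin n → Y) → ℝ := fun ω => ∑ i ∈ S, ξm (ω i) with hem
  set P := Measure.pi fun _ : Fin n => Q
  have iw : Integrable w P := integrable_finsetSum _ fun i _ =>
    integrable_comp_eval_pi (hA.integrable_fderiv hℓ h) i
  have iep : Integrable ep P := integrable_finsetSum _ fun i _ =>
    integrable_comp_eval_pi (lp.integrable (by norm_num)) i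
  have iem : Integrable em P := integrable_finsetSum _ fun i _ =>
    integrable_comp_eval_pi (lm.integrable (by norm_num)) i
  have hw0 : ∫ ω, w ω ∂P = 0 := by
    rw [hw, integral_finsetSum _ fun i _ => integrable_comp_eval_pi (hA.integrable_fderiv hℓ h) i]
    refine Finset.sum_eq_zero fun i _ => ?_
    rw [integral_comp_eval_pi (f := fun y => fderiv ℝ (fun z => ℓ z y) z₀ h)
      (hA.measurable_fderiv hℓ h).aestronglyMeasurable, hA.integral_fderiv_eq_zero hℓ]
  have hwabs : t * c₁ ≤ ∫ ω, |w ω| ∂P := by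
    have h1 : ∀ ω, |w ω| = t / √k * |∑ i ∈ S, fderiv ℝ (fun z => ℓ z (ω i)) z₀ u| := fun ω => by
      simp only [hw, hh, map_smul, smul_eq_mul]
      rw [← Finset.mul_sum, abs_mul, abs_of_pos (by positivity : 0 < t / √k)]
    simp_rw [h1]
    rw [integral_const_mul]
    calc t * c₁ = t / √k * (c₁ * √k) := by field_simp
      _ ≤ _ := by gcongr; exact hW S
  have hBsq : k * (4 * (s ^ 2 * L ^ 2 / k)) = (2 * (s * L)) ^ 2 := by field_simp; ring
  have hepabs : ∫ ω, |ep ω| ∂P ≤ 2 * (s * L) :=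
    integral_abs_sum_le lp zp S (by positivity) ((by gcongr : _ ≤ k * _).trans hBsq.le)
  have hemabs : ∫ ω, |em ω| ∂P ≤ 2 * (s * L) :=
    integral_abs_sum_le lm zm S (by positivity) ((by gcongr : _ ≤ k * _).trans hBsq.le)
  have hFp : ∀ ω, totalCost ℓ S ω b - totalCost ℓ S ω (z₀ + (x + h)) = -ap - w ω - ep ω := by
    intro ω
    have e : ep ω = totalCost ℓ S ω (z₀ + (x + h)) - totalCost ℓ S ω (z₀ + x) - w ω - ap :=
      sum_sub_sub_sub_const S _ _ _ _
    rw [e, hbx]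
    ring
  have hFm : ∀ ω, totalCost ℓ S ω b - totalCost ℓ S ω (z₀ + (x + -h)) = -am + w ω - em ω := by
    intro ω
    have e : em ω = totalCost ℓ S ω (z₀ + (x + -h)) - totalCost ℓ S ω (z₀ + x)
        - ∑ i ∈ S, fderiv ℝ (fun z => ℓ z (ω i)) z₀ (-h) - am :=
      sum_sub_sub_sub_const S _ _ _ _
    have e' : ∑ i ∈ S, fderiv ℝ (fun z => ℓ z (ω i)) z₀ (-h) = -w ω := by
      rw [hw, ← Finset.sum_neg_distrib]
      exact Finset.sum_congr rfl fun i _ => map_neg _ _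
    rw [e, e', hbx]
    ring
  -- Up to the errors, this is the maximum of two numbers written as their mean plus half their
  -- distance.
  have hpt : ∀ ω, |w ω - (am - ap) / 2| - (ap + am) / 2 - |ep ω| - |em ω| ≤
      max (totalCost ℓ S ω b - totalCost ℓ S ω (z₀ + (x + h)))
        (totalCost ℓ S ω b - totalCost ℓ S ω (z₀ + (x + -h))) := by
    intro ω
    rw [hFp, hFm, le_max_iff]
    rcases abs_cases (w ω - (am - ap) / 2) with h1 | h1
    · right; linarith [le_abs_self (em ω), abs_nonneg (ep ω)]
    · left; linarith [le_abs_self (ep ω), abs_nonneg (em ω)]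
  have iF := fun {z} (hz : z ∈ Z) => hA.integrable_totalCost hℓ S hz
  have hbZ : b ∈ Z := hbx ▸ hb0
  have i0 : Integrable (fun ω => |w ω - (am - ap) / 2|) P := (iw.sub (integrable_const _)).abs
  have hfin := integral_mono (((i0.sub (integrable_const ((ap + am) / 2))).sub iep.abs).sub iem.abs)
    (((iF hbZ).sub (iF hp)).sup ((iF hbZ).sub (iF hm))) hpt
  refine le_trans ?_ hfin
  have e1 := integral_sub ((i0.sub (integrable_const ((ap + am) / 2))).sub iep.abs) iem.abs
  have e2 := integral_sub (i0.sub (integrable_const ((ap + am) / 2))) iep.abs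
  have e3 := integral_sub i0 (integrable_const (μ := P) ((ap + am) / 2))
  simp only [Pi.sub_apply] at e1 e2 e3 ⊢
  rw [e1, e2, e3, integral_const, probReal_univ, one_smul]
  have h1 := le_integral_abs_sub iw hw0 ((am - ap) / 2)
  have h2 : t ^ 2 * H ≤ t * (c₁ / 2) := by nlinarith
  have h3 : s ^ 2 * L ^ 2 ≤ s * L ^ 2 := by
    gcongr
    nlinarith
  nlinarith

end Assumptions

/-! ### Rates for minimizers of the total cost -/

/-- `zhat` picks a minimizer over `Z` of the total cost over the outcomes with index in `S`,
whenever there is one. -/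
structure IsEmpiricalMinimizer {dz n : ℕ} {Y : Type*} [MeasurableSpace Y]
    (ℓ : EuclideanSpace ℝ (Fin dz) → Y → ℝ) (Z : Set (EuclideanSpace ℝ (Fin dz)))
    (S : Finset (Fin n)) (zhat : (Fin n → Y) → EuclideanSpace ℝ (Fin dz)) : Prop where
  measurable : Measurable zhat
  mem : ∀ ω, zhat ω ∈ Z
  isMinOn : ∀ ω, (∃ z ∈ Z, IsMinOn (totalCost ℓ S ω) Z z) →
    IsMinOn (totalCost ℓ S ω) Z (zhat ω)

/-- Quadratic growth against a modulus of exponent `3 / 2`: for `ρ ≥ 1`, `c ^ 2 ρ ^ 4 ≤ 8 A ρ ^ 3`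
bounds `ρ` by a multiple of `A`. The fourth moment of `A` then controls both `ρ ^ 4` and `|X|`. -/
lemma quartic_bounds {A ρ X c : ℝ} (hA : 0 ≤ A) (hρ : 0 ≤ ρ) (hc : 0 < c) (h1 : c * ρ ^ 2 ≤ |X|)
    (h2 : X ^ 2 ≤ A * (1 + ρ) ^ 3) :
    ρ ^ 4 ≤ 1 + (8 / c ^ 2) ^ 4 * A ^ 4 ∧
      |X| ≤ 17 + (1 + 8 * (8 / c ^ 2) ^ 4) * A ^ 4 := by
  have h3 : ρ ^ 4 ≤ 1 + (8 / c ^ 2) ^ 4 * A ^ 4 := by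
    rcases le_total ρ 1 with h | h
    · have : ρ ^ 4 ≤ 1 := pow_le_one₀ hρ h
      have : 0 ≤ (8 / c ^ 2) ^ 4 * A ^ 4 := by positivity
      linarith
    · have e1 : (c * ρ ^ 2) ^ 2 ≤ A * (1 + ρ) ^ 3 := by
        refine le_trans ?_ h2
        rw [← sq_abs X]
        gcongr
      have e2 : A * (1 + ρ) ^ 3 ≤ A * (2 * ρ) ^ 3 := by gcongr; linarith
      have e3 : ρ ^ 3 * (c ^ 2 * ρ) ≤ ρ ^ 3 * (8 * A) := by nlinarith
      have e4 := le_of_mul_le_mul_left e3 (by positivity)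
      have e5 : ρ ≤ 8 / c ^ 2 * A := by
        rw [div_mul_eq_mul_div, le_div_iff₀ (by positivity)]; linarith
      have e6 : ρ ^ 4 ≤ (8 / c ^ 2 * A) ^ 4 := by gcongr
      rw [mul_pow] at e6
      linarith
  refine ⟨h3, ?_⟩
  have h4 : |X| ≤ 1 + X ^ 2 := by
    rw [← sq_abs]; nlinarith [sq_nonneg (|X| - 1)]
  have h5 : A * (1 + ρ) ^ 3 ≤ A ^ 4 + (1 + ρ) ^ 4 := by
    rcases le_total A (1 + ρ) with h | h
    · have : A * (1 + ρ) ^ 3 ≤ (1 + ρ) * (1 + ρ) ^ 3 := by gcongr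
      have : 0 ≤ A ^ 4 := by positivity
      linarith [show (1 + ρ) * (1 + ρ) ^ 3 = (1 + ρ) ^ 4 by ring]
    · have : A * (1 + ρ) ^ 3 ≤ A * A ^ 3 := by gcongr
      have : 0 ≤ (1 + ρ) ^ 4 := by positivity
      linarith [show A * A ^ 3 = A ^ 4 by ring]
  have h6 : (1 + ρ) ^ 4 ≤ 8 * (1 + ρ ^ 4) := by
    have e1 : (1 + ρ) ^ 2 ≤ 2 * (1 + ρ ^ 2) := by nlinarith [sq_nonneg (1 - ρ)]
    calc (1 + ρ) ^ 4 = ((1 + ρ) ^ 2) ^ 2 := by ring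
      _ ≤ (2 * (1 + ρ ^ 2)) ^ 2 := by gcongr
      _ ≤ _ := by nlinarith [sq_nonneg (1 - ρ ^ 2)]
  linarith

namespace Assumptions

variable {dz : ℕ} {Y : Type*} [MeasurableSpace Y] {M : ℝ} {ℓ : EuclideanSpace ℝ (Fin dz) → Y → ℝ}
  {Z : Set (EuclideanSpace ℝ (Fin dz))} {Q : Measure Y} {z₀ : EuclideanSpace ℝ (Fin dz)}

lemma exists_norm_sub_le (hA : Assumptions M ℓ Z Q z₀) : ∃ D ≥ 0, ∀ z ∈ Z, ‖z - z₀‖ ≤ D := by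
  obtain ⟨D, hD⟩ := hA.isBounded.subset_closedBall z₀
  exact ⟨D, by simpa using hD hA.mem, fun z hz => mem_closedBall_iff_norm.1 (hD hz)⟩

lemma measurable_expectedCost (hA : Assumptions M ℓ Z Q z₀)
    (hℓ : Measurable (Function.uncurry ℓ)) : Measurable (expectedCost ℓ Q) := by
  have := hA.isProbabilityMeasure
  exact (hℓ.stronglyMeasurable.integral_prod_right).measurable

lemma _root_.KNNBias.IsEmpiricalMinimizer.measurable_totalCost {n : ℕ} {S : Finset (Fin n)}
    {zhat : (Fin n → Y) → EuclideanSpace ℝ (Fin dz)} (hz : IsEmpiricalMinimizer ℓ Z S zhat)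
    (hℓ : Measurable (Function.uncurry ℓ)) : Measurable fun ω => totalCost ℓ S ω (zhat ω) :=
  Finset.measurable_sum _ fun i _ => hℓ.comp (hz.measurable.prodMk (measurable_pi_apply i))

/-- Localization of the minimizers of the total cost at the rate `1 / √k`. -/
lemma exists_localization (hA : Assumptions M ℓ Z Q z₀) (hℓ : Measurable (Function.uncurry ℓ)) :
    ∃ C > 0, ∀ {n : ℕ} (S : Finset (Fin n)), S.Nonempty → ∀ zhat, IsEmpiricalMinimizer ℓ Z S zhat →
      ∃ B : (Fin n → Y) → ℝ, Integrable B (Measure.pi fun _ : Fin n => Q) ∧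
        ∫ ω, B ω ∂(Measure.pi fun _ : Fin n => Q) ≤ C ∧
        ∀ᵐ ω ∂(Measure.pi fun _ : Fin n => Q), (√S.card * ‖zhat ω - z₀‖) ^ 4 ≤ B ω ∧
          |deviation ℓ Q S ω (zhat ω) - deviation ℓ Q S ω z₀| ≤ B ω := by
  have := hA.isProbabilityMeasure
  have hM := hA.bound_nonneg
  obtain ⟨c, hc, ε₁, hε₁, hgrow⟩ := hA.exists_quadratic_growth
  obtain ⟨C₁, ε₂, hε₂, hmod⟩ := hA.exists_local_modulus hℓ
  obtain ⟨C₂, hC₂, hgood⟩ := hA.exists_good_event hℓ (lt_min hε₁ hε₂)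
  obtain ⟨D, hD0, hD⟩ := hA.exists_norm_sub_le
  set a := 1 + 8 * (8 / c ^ 2) ^ 4
  have ha : 0 < a := by positivity
  refine ⟨17 + a * |C₁| + (D ^ 4 + 2 * M * D) * C₂, by positivity, fun {n} S hS zhat hz => ?_⟩
  set P := Measure.pi fun _ : Fin n => Q
  obtain ⟨A, hA0, hAi, hAC, hAE⟩ := hmod S hS z₀ (by simpa using hε₂.le) 1 one_pos
  obtain ⟨G, hGm, hGP, hGE⟩ := hgood S hS
  set k : ℝ := (S.card : ℝ) with hkdef
  have hk1 : 1 ≤ k := by rw [hkdef]; exact_mod_cast hS.card_pos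
  have hk0 : 0 < k := by linarith
  have hsk2 : √k ^ 2 = k := Real.sq_sqrt hk0.le
  -- A deterministic bound off the good event: `(√k D) ^ 4 = k ^ 2 D ^ 4` for the distance and `2 M
  -- D k` for the deviation. A probability `O(k⁻⁴)` makes its contribution bounded.
  set b := k ^ 2 * (D ^ 4 + 2 * M * D)
  have hb : 0 ≤ b := by positivity
  have i1 : Integrable (fun ω => 17 + a * A ω ^ 4) P := (integrable_const _).add (hAi.const_mul a)
  have i2 : Integrable (Gᶜ.indicator fun _ => b) P := (integrable_const b).indicator hGm.compl
  refine ⟨fun ω => 17 + a * A ω ^ 4 + Gᶜ.indicator (fun _ => b) ω, i1.add i2, ?_, ?_⟩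
  · rw [integral_add i1 i2, integral_add (integrable_const _) (hAi.const_mul a),
      integral_const_mul, integral_indicator_const _ hGm.compl, integral_const, probReal_univ,
      one_smul, smul_eq_mul]
    have h1 : P.real Gᶜ * b ≤ (D ^ 4 + 2 * M * D) * C₂ := by
      calc P.real Gᶜ * b ≤ C₂ / k ^ 4 * b := by gcongr
        _ = (D ^ 4 + 2 * M * D) * C₂ / k ^ 2 := by simp only [b]; field_simp
        _ ≤ _ := div_le_self (by positivity) (one_le_pow₀ hk1)
    have h2 : a * ∫ ω, A ω ^ 4 ∂P ≤ a * |C₁| := by gcongr; exact hAC.trans (le_abs_self _)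
    linarith
  · filter_upwards [hAE, hGE, hA.ae_abs_deviation_sub_le hℓ S] with ω h1 h2 h3
    have hAω : 0 ≤ a * A ω ^ 4 := by have := hA0 ω; positivity
    by_cases hω : ω ∈ G
    · rw [Set.indicator_of_notMem (by simpa using hω), add_zero]
      obtain ⟨h4, h5⟩ := h2 hω
      have hle : totalCost ℓ S ω (zhat ω) ≤ totalCost ℓ S ω z₀ := hz.isMinOn ω h4 hA.mem
      have hnear := h5 _ (hz.mem ω) hle
      have h6 := hgrow _ (hnear.trans_le (min_le_left _ _))
      have h7 := h1 _ (hnear.le.trans (min_le_right _ _))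
      rw [one_pow, one_mul, div_one] at h7
      -- The basic inequality: since the decision has no larger total cost than `z₀`, its excess
      -- expected cost is paid for by the deviation.
      have h8 : c * (√k * ‖zhat ω - z₀‖) ^ 2
          ≤ |deviation ℓ Q S ω (zhat ω) - deviation ℓ Q S ω z₀| := by
        rw [totalCost_eq ℓ Q, totalCost_eq ℓ Q] at hle
        rw [mul_pow, hsk2]
        have h9 : k * (c * ‖zhat ω - z₀‖ ^ 2)
          ≤ k * (expectedCost ℓ Q (zhat ω) - expectedCost ℓ Q z₀) := by gcongr
        have := neg_le_abs (deviation ℓ Q S ω (zhat ω) - deviation ℓ Q S ω z₀)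
        linarith
      obtain ⟨e1, e2⟩ := quartic_bounds (hA0 ω) (by positivity) hc h8 h7
      refine ⟨e1.trans ?_, e2⟩
      have : 0 ≤ (8 / c ^ 2) ^ 4 * A ω ^ 4 := by have := hA0 ω; positivity
      simp only [a]
      nlinarith [pow_nonneg (hA0 ω) 4]
    · rw [Set.indicator_of_mem (by simpa using hω)]
      have hk2 : k ≤ k ^ 2 := by nlinarith
      have hDz := hD _ (hz.mem ω)
      have hMD : 0 ≤ 2 * M * D := by positivity
      have hD4 : 0 ≤ D ^ 4 := by positivity
      constructor
      · have e1 : (√k * ‖zhat ω - z₀‖) ^ 4 ≤ k ^ 2 * D ^ 4 := by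
          rw [mul_pow, show √k ^ 4 = (√k ^ 2) ^ 2 by ring, hsk2]
          gcongr
        have e2 : 0 ≤ k ^ 2 * (2 * M * D) := by positivity
        simp only [b]
        linarith
      · have e1 := h3 _ (hz.mem ω) _ hA.mem
        rw [dist_eq_norm] at e1
        have e2 : k * (2 * M * ‖zhat ω - z₀‖) ≤ k ^ 2 * (2 * M * D) := by gcongr
        have e3 : 0 ≤ k ^ 2 * D ^ 4 := by positivity
        simp only [b]
        linarith

section Bounds

variable {n : ℕ} {S : Finset (Fin n)} {zhat : (Fin n → Y) → EuclideanSpace ℝ (Fin dz)}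

lemma integrable_norm_sub_pow (hA : Assumptions M ℓ Z Q z₀) (hz : IsEmpiricalMinimizer ℓ Z S zhat)
    (b : EuclideanSpace ℝ (Fin dz)) (p : ℕ) :
    Integrable (fun ω => ‖zhat ω - b‖ ^ p) (Measure.pi fun _ : Fin n => Q) := by
  have := hA.isProbabilityMeasure
  obtain ⟨D, -, hD⟩ := hA.exists_norm_sub_le
  refine Integrable.of_bound ((hz.measurable.sub_const b).norm.pow_const p).aestronglyMeasurable
    ((D + ‖z₀ - b‖) ^ p) (ae_of_all _ fun ω => ?_)
  rw [norm_pow, norm_norm]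
  gcongr
  have h := norm_add_le (zhat ω - z₀) (z₀ - b)
  rw [sub_add_sub_cancel] at h
  linarith [hD _ (hz.mem ω)]

lemma integrable_norm_sub (hA : Assumptions M ℓ Z Q z₀) (hz : IsEmpiricalMinimizer ℓ Z S zhat)
    (b : EuclideanSpace ℝ (Fin dz)) :
    Integrable (fun ω => ‖zhat ω - b‖) (Measure.pi fun _ : Fin n => Q) := by
  simpa using hA.integrable_norm_sub_pow hz b 1

lemma integrable_expectedCost_comp (hA : Assumptions M ℓ Z Q z₀)
    (hℓ : Measurable (Function.uncurry ℓ)) (hz : IsEmpiricalMinimizer ℓ Z S zhat) :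
    Integrable (fun ω => expectedCost ℓ Q (zhat ω)) (Measure.pi fun _ : Fin n => Q) := by
  have := hA.isProbabilityMeasure
  exact Integrable.of_bound
    ((hA.measurable_expectedCost hℓ).comp hz.measurable).aestronglyMeasurable M
    (ae_of_all _ fun ω => hA.abs_expectedCost_le (hz.mem ω))

lemma integrable_totalCost_comp (hA : Assumptions M ℓ Z Q z₀)
    (hℓ : Measurable (Function.uncurry ℓ)) (hz : IsEmpiricalMinimizer ℓ Z S zhat) :
    Integrable (fun ω => totalCost ℓ S ω (zhat ω)) (Measure.pi fun _ : Fin n => Q) := by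
  have := hA.isProbabilityMeasure
  refine Integrable.of_bound (hz.measurable_totalCost hℓ).aestronglyMeasurable (S.card * M) ?_
  filter_upwards [ae_pi_of_ae (ι := Fin n) hA.cost_bounded] with ω hω
  rw [Real.norm_eq_abs, totalCost]
  refine (Finset.abs_sum_le_sum_abs _ _).trans ?_
  rw [← nsmul_eq_mul]
  exact Finset.sum_le_card_nsmul _ _ _ fun i _ => hω i _ (hz.mem ω)

lemma integral_totalCost (hA : Assumptions M ℓ Z Q z₀) (hℓ : Measurable (Function.uncurry ℓ))
    {z : EuclideanSpace ℝ (Fin dz)} (hz : z ∈ Z) :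
    ∫ ω, totalCost ℓ S ω z ∂(Measure.pi fun _ : Fin n => Q) = S.card * expectedCost ℓ Q z := by
  have := hA.isProbabilityMeasure
  simp only [totalCost]
  rw [integral_finsetSum _ fun i _ => integrable_comp_eval_pi (hA.integrable_cost hℓ hz) i,
    Finset.sum_congr rfl fun i _ => integral_comp_eval_pi (hA.integrable_cost hℓ hz).1 i]
  simp [expectedCost]

end Bounds

/-- Upper bounds on the error, the excess cost and the optimism of minimizers of the total cost. -/
theorem exists_upper_bounds (hA : Assumptions M ℓ Z Q z₀) (hℓ : Measurable (Function.uncurry ℓ)) :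
    ∃ C > 0, ∀ {n : ℕ} (S : Finset (Fin n)), S.Nonempty → ∀ zhat, IsEmpiricalMinimizer ℓ Z S zhat →
      ∫ ω, (√S.card * ‖zhat ω - z₀‖) ^ 4 ∂(Measure.pi fun _ : Fin n => Q) ≤ C ∧
      ∫ ω, √S.card * ‖zhat ω - z₀‖ ∂(Measure.pi fun _ : Fin n => Q) ≤ C ∧
      ∫ ω, S.card * (expectedCost ℓ Q (zhat ω) - expectedCost ℓ Q z₀)
        ∂(Measure.pi fun _ : Fin n => Q) ≤ C ∧
      -C ≤ ∫ ω, totalCost ℓ S ω (zhat ω) ∂(Measure.pi fun _ : Fin n => Q)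
        - S.card * expectedCost ℓ Q z₀ := by
  have := hA.isProbabilityMeasure
  obtain ⟨C, hC, hloc⟩ := hA.exists_localization hℓ
  obtain ⟨C', hC', hex⟩ := hA.exists_excess_le
  refine ⟨1 + C + C' * (1 + C), by positivity, fun {n} S hS zhat hz => ?_⟩
  set P := Measure.pi fun _ : Fin n => Q
  obtain ⟨B, iB, hBC, hB⟩ := hloc S hS zhat hz
  have hCC : 0 ≤ C' * (1 + C) := by positivity
  have hsk2 : √(S.card : ℝ) ^ 2 = S.card := Real.sq_sqrt (Nat.cast_nonneg _)
  have i1 := hA.integrable_norm_sub hz z₀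
  have i4 : Integrable (fun ω => (√S.card * ‖zhat ω - z₀‖) ^ 4) P := by
    simp_rw [mul_pow]
    exact (hA.integrable_norm_sub_pow hz z₀ 4).const_mul _
  have iv := hA.integrable_expectedCost_comp hℓ hz
  have i1B : Integrable (fun ω => 1 + B ω) P := (integrable_const _).add iB
  have hI1B : ∫ ω, (1 + B ω) ∂P ≤ 1 + C := by
    rw [integral_add (integrable_const _) iB]
    simpa using hBC
  refine ⟨?_, ?_, ?_, ?_⟩
  · refine (integral_mono_ae i4 iB (hB.mono fun ω h => h.1)).trans ?_
    linarith
  · refine (integral_mono_ae (i1.const_mul _) i1B (hB.mono fun ω h => ?_)).trans ?_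
    · have h1 := h.1
      set ρ := √S.card * ‖zhat ω - z₀‖
      change ρ ≤ 1 + B ω
      nlinarith [sq_nonneg (ρ ^ 2 - 1), sq_nonneg (ρ - 1)]
    · linarith
  · refine (integral_mono_ae ((iv.sub (integrable_const _)).const_mul _) (i1B.const_mul C')
      (hB.mono fun ω h => ?_)).trans ?_
    · have h1 := h.1
      have h2 := hex _ (hz.mem ω)
      have h3 : (S.card : ℝ) * (expectedCost ℓ Q (zhat ω) - expectedCost ℓ Q z₀)
          ≤ C' * (√S.card * ‖zhat ω - z₀‖) ^ 2 := by
        rw [mul_pow, hsk2]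
        calc _ ≤ (S.card : ℝ) * (C' * ‖zhat ω - z₀‖ ^ 2) := by gcongr
          _ = _ := by ring
      refine h3.trans ?_
      set ρ := √S.card * ‖zhat ω - z₀‖
      change _ ≤ C' * (1 + B ω)
      gcongr
      nlinarith [sq_nonneg (ρ ^ 2 - 1)]
    · rw [integral_const_mul]
      have : C' * ∫ ω, (1 + B ω) ∂P ≤ C' * (1 + C) := by gcongr
      linarith
  · rw [← hA.integral_totalCost hℓ hA.mem (S := S),
      ← integral_sub (hA.integrable_totalCost_comp hℓ hz) (hA.integrable_totalCost hℓ S hA.mem)]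
    have h := integral_mono_ae iB.neg ((hA.integrable_totalCost_comp hℓ hz).sub
      (hA.integrable_totalCost hℓ S hA.mem)) (hB.mono fun ω h => by
        have h1 := (abs_le.1 h.2).1
        have h2 : 0 ≤ (S.card : ℝ) * (expectedCost ℓ Q (zhat ω) - expectedCost ℓ Q z₀) :=
          mul_nonneg (Nat.cast_nonneg _) (sub_nonneg.2 (hA.expectedCost_le (hz.mem ω)))
        simp only [Pi.neg_apply, Pi.sub_apply, totalCost_eq ℓ Q]
        linarith)
    simp only [Pi.neg_apply, Pi.sub_apply, integral_neg] at h
    linarith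

end Assumptions

/-! ### Lower bounds on the optimism and the spread. -/

lemma sq_le_quartic_add {θ ρ : ℝ} (hθ : 0 < θ) (hθ1 : θ ≤ 1) (hρ : 0 ≤ ρ) :
    ρ ^ 2 ≤ θ * ρ ^ 4 + 1 / θ * ρ := by
  rcases le_total (θ * ρ) 1 with h | h
  · have h1 : ρ ^ 2 ≤ 1 / θ * ρ := by
      rw [div_mul_eq_mul_div, le_div_iff₀ hθ]
      nlinarith
    have : 0 ≤ θ * ρ ^ 4 := by positivity
    linarith
  · have h2 : 1 ≤ θ * ρ ^ 2 := by
      have : 1 ≤ ρ := by nlinarith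
      nlinarith
    have h1 : ρ ^ 2 * 1 ≤ ρ ^ 2 * (θ * ρ ^ 2) := by gcongr
    have : 0 ≤ 1 / θ * ρ := by positivity
    nlinarith

/-- The modulus at the fine scale `θ / √k` splits the increment into a small multiple of quantities
with bounded mean and a possibly large multiple of the distance `ρ`. If the increment has mean
bounded below, so has `ρ`. For `ρ ≥ θ` the split is the arithmetic-geometric inequality. -/
lemma abs_le_of_fine_modulus {A ρ X θ : ℝ} (hA : 0 ≤ A) (hρ : 0 ≤ ρ) (hθ : 0 < θ)
    (h : X ^ 2 ≤ θ ^ 2 * A * (1 + ρ / θ) ^ 3) :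
    |X| ≤ θ * (4 + 2 * A ^ 4 + ρ ^ 4) + 2 / θ ^ 2 * ρ := by
  have hA1 : A ≤ 1 + A ^ 4 := by nlinarith [sq_nonneg (A ^ 2 - 1), sq_nonneg (A - 1)]
  have hA2 : A ^ 2 ≤ 1 + A ^ 4 := by nlinarith [sq_nonneg (A ^ 2 - 1)]
  rcases le_total ρ θ with hle | hle
  · have h1 : ρ / θ ≤ 1 := (div_le_one hθ).2 hle
    have h2 : X ^ 2 ≤ θ ^ 2 * A * 2 ^ 3 := by
      refine h.trans ?_
      gcongr
      linarith
    have h3 : |X| ≤ θ * (2 + A) := by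
      refine abs_le_of_sq_le_sq ?_ (by positivity)
      nlinarith [mul_nonneg (sq_nonneg θ) (sq_nonneg (A - 2))]
    have h4 : θ * (2 + A) ≤ θ * (4 + 2 * A ^ 4 + ρ ^ 4) := by
      refine mul_le_mul_of_nonneg_left ?_ hθ.le
      have : 0 ≤ ρ ^ 4 := by positivity
      have : 0 ≤ A ^ 4 := by positivity
      linarith
    have : 0 ≤ 2 / θ ^ 2 * ρ := by positivity
    linarith
  · have h1 : 1 ≤ ρ / θ := (one_le_div hθ).2 hle
    have h2 : X ^ 2 ≤ θ ^ 2 * A * (2 * (ρ / θ)) ^ 3 := by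
      refine h.trans ?_
      gcongr
      linarith
    have h3 : |X| ≤ θ * (A * ρ ^ 2) + 2 / θ ^ 2 * ρ := by
      refine abs_le_of_sq_le_sq ?_ (by positivity)
      have e1 : θ ^ 2 * A * (2 * (ρ / θ)) ^ 3 = 4 * (θ * (A * ρ ^ 2)) * (2 / θ ^ 2 * ρ) := by
        field_simp; ring
      rw [e1] at h2
      nlinarith [sq_nonneg (θ * (A * ρ ^ 2) - 2 / θ ^ 2 * ρ)]
    have h4 : A * ρ ^ 2 ≤ 4 + 2 * A ^ 4 + ρ ^ 4 := by
      nlinarith [sq_nonneg (A - ρ ^ 2), pow_nonneg hρ 4, pow_nonneg hA 4]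
    have h5 : θ * (A * ρ ^ 2) ≤ θ * (4 + 2 * A ^ 4 + ρ ^ 4) := by gcongr
    linarith

lemma improvement_le {A ρ X θ K Cv d : ℝ} (hρ : 0 ≤ ρ) (hθ : 0 < θ) (hθ1 : θ ≤ 1) (hCv : 0 ≤ Cv)
    (hX : |X| ≤ θ * (4 + 2 * A ^ 4 + ρ ^ 4) + 2 / θ ^ 2 * ρ)
    (hd : |d| ≤ Cv * ((2 * K + ρ) * ρ)) :
    d - X ≤ θ * (4 + 2 * A ^ 4 + (1 + Cv) * ρ ^ 4) + (2 / θ ^ 2 + Cv * (2 * K + 1 / θ)) * ρ := by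
  have h1 : Cv * ((2 * K + ρ) * ρ) ≤ Cv * (θ * ρ ^ 4 + (2 * K + 1 / θ) * ρ) := by
    gcongr
    linarith [sq_le_quartic_add hθ hθ1 hρ]
  linarith [le_abs_self d, neg_le_abs X]

namespace Assumptions

variable {dz : ℕ} {Y : Type*} [MeasurableSpace Y] {M : ℝ} {ℓ : EuclideanSpace ℝ (Fin dz) → Y → ℝ}
  {Z : Set (EuclideanSpace ℝ (Fin dz))} {Q : Measure Y} {z₀ : EuclideanSpace ℝ (Fin dz)}

/-- Minimizers of the total cost improve on every fixed decision at distance `O(1 / √k)` of `z₀`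
by a constant in expectation. -/
theorem exists_le_integral_totalCost_sub (hA : Assumptions M ℓ Z Q z₀)
    (hℓ : Measurable (Function.uncurry ℓ))
    (hnondeg : ¬ ∀ᵐ y ∂Q, fderiv ℝ (fun z => ℓ z y) z₀ = 0) {K : ℝ} (hK : 0 ≤ K) :
    ∃ c > 0, ∃ k₀ : ℕ, ∀ {n : ℕ} (S : Finset (Fin n)), S.Nonempty → k₀ ≤ S.card → ∀ zhat,
      IsEmpiricalMinimizer ℓ Z S zhat → ∀ b, √S.card * ‖b - z₀‖ ≤ K → b ∈ Z ∧
        c ≤ ∫ ω, (totalCost ℓ S ω b - totalCost ℓ S ω (zhat ω))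
          ∂(Measure.pi fun _ : Fin n => Q) := by
  have := hA.isProbabilityMeasure
  have hM := hA.bound_nonneg
  obtain ⟨c, hc, k₀, himp⟩ := hA.exists_improvement hℓ hnondeg hK
  obtain ⟨C, hC, hgood⟩ := hA.exists_good_event hℓ one_pos
  refine ⟨c / 2, by positivity, max k₀ ⌈8 * M * C / c⌉₊, fun {n} S hS hk zhat hz b hb => ?_⟩
  obtain ⟨hbZ, b₁, hb₁, b₂, hb₂, hX⟩ := himp S ((le_max_left _ _).trans hk) b hb
  refine ⟨hbZ, ?_⟩
  obtain ⟨G, hGm, hGP, hGE⟩ := hgood S hS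
  set P := Measure.pi fun _ : Fin n => Q
  have iF := fun {z} (hz : z ∈ Z) => hA.integrable_totalCost hℓ S hz
  have iX := ((iF hbZ).sub (iF hb₁)).sup ((iF hbZ).sub (iF hb₂))
  set k : ℝ := (S.card : ℝ) with hkdef
  have hk1 : 1 ≤ k := by rw [hkdef]; exact_mod_cast hS.card_pos
  have hkc : 8 * M * C / c ≤ k :=
    (Nat.le_ceil _).trans (by rw [hkdef]; exact_mod_cast (le_max_right _ _).trans hk)
  -- Off the good event there may be no minimizer; the decision may lose `2 M k` to `b` while a
  -- shift gains `2 M k`.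
  have i2 : Integrable (Gᶜ.indicator fun _ => 4 * M * k) P :=
    (integrable_const _).indicator hGm.compl
  have hle := integral_mono_ae (iX.sub i2) ((iF hbZ).sub (hA.integrable_totalCost_comp hℓ hz)) (by
    filter_upwards [hGE, hA.ae_abs_totalCost_sub_le S] with ω h1 h2
    simp only [Pi.sub_apply, Pi.sup_apply]
    by_cases hω : ω ∈ G
    · rw [Set.indicator_of_notMem (by simpa using hω), sub_zero]
      have hmin := hz.isMinOn ω (h1 hω).1
      have e1 : totalCost ℓ S ω (zhat ω) ≤ totalCost ℓ S ω b₁ := hmin hb₁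
      have e2 : totalCost ℓ S ω (zhat ω) ≤ totalCost ℓ S ω b₂ := hmin hb₂
      exact sup_le (by linarith) (by linarith)
    · rw [Set.indicator_of_mem (by simpa using hω)]
      have e1 := (abs_le.1 (h2 b hbZ b₁ hb₁)).2
      have e2 := (abs_le.1 (h2 b hbZ b₂ hb₂)).2
      have e3 := (abs_le.1 (h2 b hbZ _ (hz.mem ω))).1
      rw [sub_le_iff_le_add]
      exact sup_le (by linarith) (by linarith))
  have e1 := integral_sub iX i2
  simp only [Pi.sub_apply, Pi.sup_apply] at e1 hle
  rw [e1, integral_indicator_const _ hGm.compl, smul_eq_mul] at hle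
  have hbad : P.real Gᶜ * (4 * M * k) ≤ c / 2 := by
    calc P.real Gᶜ * (4 * M * k) ≤ C / k ^ 4 * (4 * M * k) := by gcongr
      _ = 4 * M * C / k ^ 3 := by field_simp
      _ ≤ 4 * M * C / k := by
        gcongr
        exact le_self_pow₀ hk1 (by norm_num)
      _ ≤ c / 2 := by
        rw [div_le_iff₀ hc] at hkc
        rw [div_le_iff₀ (by linarith)]
        linarith
  have hX' : c ≤ ∫ ω, (totalCost ℓ S ω b - totalCost ℓ S ω b₁) ⊔
      (totalCost ℓ S ω b - totalCost ℓ S ω b₂) ∂P := hX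
  linarith

set_option maxHeartbeats 1000000 in
/-- Minimizers of the total cost have a spread of order at least `1 / √k`. -/
theorem exists_le_integral_norm_sub (hA : Assumptions M ℓ Z Q z₀)
    (hℓ : Measurable (Function.uncurry ℓ))
    (hnondeg : ¬ ∀ᵐ y ∂Q, fderiv ℝ (fun z => ℓ z y) z₀ = 0) :
    ∃ c > 0, ∃ k₀ : ℕ, ∀ {n : ℕ} (S : Finset (Fin n)), S.Nonempty → k₀ ≤ S.card → ∀ zhat,
      IsEmpiricalMinimizer ℓ Z S zhat → ∀ b,
        c ≤ ∫ ω, √S.card * ‖zhat ω - b‖ ∂(Measure.pi fun _ : Fin n => Q) := by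
  have := hA.isProbabilityMeasure
  have hM := hA.bound_nonneg
  obtain ⟨C₁, hC₁, hup⟩ := hA.exists_upper_bounds hℓ
  set K := C₁ + 1
  have hK : 0 < K := by positivity
  obtain ⟨c, hc, k₁, hdec⟩ := hA.exists_le_integral_totalCost_sub hℓ hnondeg hK.le
  obtain ⟨C₂, ε₂, hε₂, hmod⟩ := hA.exists_local_modulus hℓ
  obtain ⟨Cv, hCv, ε₃, hε₃, hlip⟩ := exists_abs_sub_le_near_critical hA.eventually_differentiableAt
    hA.differentiableAt_fderiv hA.first_order
  set ε := min ε₂ ε₃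
  have hε : 0 < ε := lt_min hε₂ hε₃
  obtain ⟨C₃, hC₃, hgood⟩ := hA.exists_good_event hℓ hε
  -- Bounds the mean of the bracket multiplied by `θ` in `improvement_le`. With `θ U ≤ c / 4` and at
  -- most `c / 4` from the bad event, half of the gain `c` must come from the term linear in the
  -- distance, whose coefficient is `Cθ`.
  set U := 4 + 2 * |C₂| + (1 + Cv) * (8 * (C₁ + K ^ 4))
  have hU : 0 < U := by positivity
  set θ := min 1 (c / (4 * U))
  have hθ : 0 < θ := lt_min one_pos (by positivity)
  have hθ1 : θ ≤ 1 := min_le_left _ _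
  have hθU : θ * U ≤ c / 4 := by
    have h1 : θ ≤ c / (4 * U) := min_le_right _ _
    rw [le_div_iff₀ (by positivity)] at h1
    linarith
  set Cθ := 2 / θ ^ 2 + Cv * (2 * K + 1 / θ)
  have hCθ : 0 < Cθ := by positivity
  refine ⟨min 1 (c / (2 * Cθ)), lt_min one_pos (by positivity),
    max k₁ (max (⌈(K / ε) ^ 2⌉₊ + 1) ⌈8 * M * C₃ / c⌉₊), fun {n} S hS hk zhat hz b => ?_⟩
  obtain ⟨h4, h1, -, -⟩ := hup S hS zhat hz
  set P := Measure.pi fun _ : Fin n => Q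
  set k : ℝ := (S.card : ℝ) with hkdef
  have hk1 : 1 ≤ k := by rw [hkdef]; exact_mod_cast hS.card_pos
  have hk0 : 0 < k := by linarith
  have hsk : 0 < √k := Real.sqrt_pos.2 hk0
  have hsk2 : √k ^ 2 = k := Real.sq_sqrt hk0.le
  have ib := hA.integrable_norm_sub hz b
  have i0 := hA.integrable_norm_sub hz z₀
  -- A point `b` farther than `(C₁ + 1) / √k` from `z₀` is on average at least `1 / √k` away from a
  -- decision whose mean distance to `z₀` is at most `C₁ / √k`. Only nearby points need the gain.
  rcases lt_or_ge K (√k * ‖b - z₀‖) with hfar | hnear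
  · refine (min_le_left _ _).trans ?_
    have h := integral_mono (μ := P) (integrable_const (√k * ‖b - z₀‖))
      ((ib.const_mul √k).add (i0.const_mul √k)) (fun ω => by
        simp only [Pi.add_apply]
        rw [← mul_add]
        gcongr
        rw [norm_sub_rev (zhat ω) b]
        simpa using norm_add_le (b - zhat ω) (zhat ω - z₀))
    simp only [Pi.add_apply] at h
    rw [integral_add (ib.const_mul √k) (i0.const_mul √k), integral_const, probReal_univ,
      one_smul] at h
    linarith
  · refine (min_le_right _ _).trans ?_
    have hkε : (K / ε) ^ 2 < k := by
      have e1 := Nat.le_ceil ((K / ε) ^ 2)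
      have e2 : ((⌈(K / ε) ^ 2⌉₊ + 1 : ℕ) : ℝ) ≤ k := by
        rw [hkdef]; exact_mod_cast (le_max_left _ _).trans ((le_max_right _ _).trans hk)
      push_cast at e2
      linarith
    have hkc : 8 * M * C₃ / c ≤ k := (Nat.le_ceil _).trans (by
      rw [hkdef]; exact_mod_cast (le_max_right _ _).trans ((le_max_right _ _).trans hk))
    have hbε : ‖b - z₀‖ < ε := by
      have e1 : K / ε < √k := (Real.lt_sqrt (by positivity)).2 hkε
      rw [div_lt_iff₀ hε] at e1
      exact lt_of_mul_lt_mul_left (hnear.trans_lt e1) hsk.le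
    obtain ⟨hbZ, hcle⟩ := hdec S hS ((le_max_left _ _).trans hk) zhat hz b hnear
    obtain ⟨A, hA0, hAi, hAC, hAE⟩ := hmod S hS b (hbε.le.trans (min_le_left _ _)) θ hθ
    obtain ⟨G, hGm, hGP, hGE⟩ := hgood S hS
    have i2 : Integrable (Gᶜ.indicator fun _ => 2 * M * k) P :=
      (integrable_const _).indicator hGm.compl
    have ib4 : Integrable (fun ω => (√k * ‖zhat ω - b‖) ^ 4) P := by
      simp_rw [mul_pow]
      exact (hA.integrable_norm_sub_pow hz b 4).const_mul _
    have i04 : Integrable (fun ω => (√k * ‖zhat ω - z₀‖) ^ 4) P := by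
      simp_rw [mul_pow]
      exact (hA.integrable_norm_sub_pow hz z₀ 4).const_mul _
    have hE4 : ∫ ω, (√k * ‖zhat ω - b‖) ^ 4 ∂P ≤ 8 * (C₁ + K ^ 4) := by
      have h := integral_mono (μ := P) ib4 ((i04.add (integrable_const (K ^ 4))).const_mul 8)
        (fun ω => by
          simp only [Pi.add_apply]
          have e1 : √k * ‖zhat ω - b‖ ≤ √k * ‖zhat ω - z₀‖ + K := by
            have e2 := norm_sub_le (zhat ω - z₀) (b - z₀)
            rw [sub_sub_sub_cancel_right] at e2
            nlinarith
          set ρ := √k * ‖zhat ω - z₀‖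
          calc _ ≤ (ρ + K) ^ 4 := by gcongr
            _ = ((ρ + K) ^ 2) ^ 2 := by ring
            _ ≤ (2 * (ρ ^ 2 + K ^ 2)) ^ 2 := by gcongr; nlinarith [sq_nonneg (ρ - K)]
            _ ≤ 8 * (ρ ^ 4 + K ^ 4) := by nlinarith [sq_nonneg (ρ ^ 2 - K ^ 2)])
      simp only [Pi.add_apply] at h
      rw [integral_const_mul, integral_add i04 (integrable_const _), integral_const,
        probReal_univ, one_smul] at h
      linarith
    have j1 : Integrable (fun ω => 4 + 2 * A ω ^ 4) P :=
      (integrable_const _).add (hAi.const_mul 2)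
    have j2 : Integrable (fun ω => θ * (4 + 2 * A ω ^ 4 + (1 + Cv) * (√k * ‖zhat ω - b‖) ^ 4)) P :=
      (j1.add (ib4.const_mul _)).const_mul _
    have j3 : Integrable (fun ω => Cθ * (√k * ‖zhat ω - b‖)) P := (ib.const_mul _).const_mul _
    have hle := integral_mono_ae ((hA.integrable_totalCost hℓ S hbZ).sub
      (hA.integrable_totalCost_comp hℓ hz)) ((j2.add j3).add i2) (by
      filter_upwards [hGE, hAE, hA.ae_abs_totalCost_sub_le S] with ω e1 e2 e3
      simp only [Pi.sub_apply, Pi.add_apply]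
      set ρ := √k * ‖zhat ω - b‖ with hρdef
      have hρ : 0 ≤ ρ := by positivity
      have hAω := hA0 ω
      have hpos : 0 ≤ θ * (4 + 2 * A ω ^ 4 + (1 + Cv) * ρ ^ 4) + Cθ * ρ := by positivity
      by_cases hω : ω ∈ G
      · rw [Set.indicator_of_notMem (by simpa using hω), add_zero]
        obtain ⟨e4, e5⟩ := e1 hω
        have hzε := e5 _ (hz.mem ω) (hz.isMinOn ω e4 hA.mem)
        have e6 := abs_le_of_fine_modulus hAω hρ hθ
          (e2 _ (hzε.le.trans (min_le_left _ _)))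
        have e7 := hlip b (zhat ω) (hbε.trans_le (min_le_right _ _))
          (hzε.trans_le (min_le_right _ _))
        have e8 : √k * ‖zhat ω - z₀‖ ≤ ρ + K := by
          have := norm_add_le (zhat ω - b) (b - z₀)
          rw [sub_add_sub_cancel] at this
          nlinarith
        have e9 : k * |expectedCost ℓ Q b - expectedCost ℓ Q (zhat ω)| ≤
            Cv * ((2 * K + ρ) * ρ) := by
          calc _ ≤ k * (Cv * (‖b - z₀‖ + ‖zhat ω - z₀‖) * ‖b - zhat ω‖) := by gcongr
            _ = Cv * ((√k * ‖b - z₀‖ + √k * ‖zhat ω - z₀‖) * ρ) := by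
              rw [hρdef, norm_sub_rev b (zhat ω)]
              linear_combination
                (-(Cv * (‖b - z₀‖ + ‖zhat ω - z₀‖) * ‖zhat ω - b‖)) * hsk2
            _ ≤ _ := mul_le_mul_of_nonneg_left
              (mul_le_mul_of_nonneg_right (by linarith) hρ) hCv.le
        have e10 := improvement_le hρ hθ hθ1 hCv.le e6
          (d := k * (expectedCost ℓ Q b - expectedCost ℓ Q (zhat ω)))
          (by rwa [abs_mul, abs_of_pos hk0])
        rw [totalCost_eq ℓ Q, totalCost_eq ℓ Q]
        refine le_trans (le_of_eq ?_) e10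
        ring
      · rw [Set.indicator_of_mem (by simpa using hω)]
        have := (abs_le.1 (e3 b hbZ _ (hz.mem ω))).2
        linarith)
    have q1 := integral_add (j2.add j3) i2
    have q2 := integral_add j2 j3
    have q3 := integral_add j1 (ib4.const_mul (1 + Cv))
    have q4 := integral_add (integrable_const (μ := P) (4 : ℝ)) (hAi.const_mul 2)
    simp only [Pi.sub_apply, Pi.add_apply] at hle q1 q2 q3 q4
    rw [q1, q2, integral_const_mul θ, q3, q4, integral_const_mul, integral_const_mul,
      integral_const_mul Cθ, integral_indicator_const _ hGm.compl, integral_const, probReal_univ,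
      one_smul, smul_eq_mul] at hle
    have hbad : P.real Gᶜ * (2 * M * k) ≤ c / 4 := by
      calc P.real Gᶜ * (2 * M * k) ≤ C₃ / k ^ 4 * (2 * M * k) := by gcongr
        _ = 2 * M * C₃ / k ^ 3 := by field_simp
        _ ≤ 2 * M * C₃ / k := by
          gcongr
          exact le_self_pow₀ hk1 (by norm_num)
        _ ≤ c / 4 := by
          rw [div_le_iff₀ hc] at hkc
          rw [div_le_iff₀ hk0]
          linarith
    have hmain : θ * (4 + 2 * ∫ ω, A ω ^ 4 ∂P + (1 + Cv) * ∫ ω, (√k * ‖zhat ω - b‖) ^ 4 ∂P)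
        ≤ c / 4 := by
      refine le_trans ?_ hθU
      simp only [U]
      gcongr
      exact hAC.trans (le_abs_self _)
    rw [div_le_iff₀ (by positivity)]
    linarith

end Assumptions

/-! ### Distance ties -/

section Ties

variable {dx n : ℕ}

/-- Fubini in the single coordinate `i`: a tie confines that covariate to a sphere determined by the
others. -/
lemma pi_null_of_update_null {E : Type*} [MeasurableSpace E] {μ : Measure E}
    [IsProbabilityMeasure μ] {N : Set (Fin n → E)} (hN : MeasurableSet N) (i : Fin n)
    (h : ∀ X, μ {t | Function.update X i t ∈ N} = 0) : Measure.pi (fun _ => μ) N = 0 := by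
  classical
  rw [← lintegral_indicator_one hN]
  have h1 := lmarginal_erase' (μ := fun _ : Fin n => μ) (N.indicator 1 : (Fin n → E) → ℝ≥0∞)
    (measurable_one.indicator hN) (Finset.mem_univ i)
  have h2 : (fun X => ∫⁻ t, (N.indicator 1 : (Fin n → E) → ℝ≥0∞) (Function.update X i t) ∂μ)
      = fun _ => 0 := by
    funext X
    have h3 : (fun t => (N.indicator 1 : (Fin n → E) → ℝ≥0∞) (Function.update X i t))
        = {t | Function.update X i t ∈ N}.indicator 1 := by
      funext t
      simp [Set.indicator_apply]
    rw [h3]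
    exact (lintegral_indicator_one (measurable_update X hN)).trans (h X)
  rw [h2, lmarginal_univ] at h1
  by_cases hne : Nonempty (Fin n → E)
  · obtain ⟨X⟩ := hne
    have := congrFun h1 X
    rw [this]
    simp [lmarginal]
  · rw [not_nonempty_iff] at hne
    rw [lintegral_of_isEmpty]

variable {μ : Measure (EuclideanSpace ℝ (Fin dx))} [IsProbabilityMeasure μ]

lemma ae_forall_dist_ne (hμ : ∀ x r, μ (Metric.sphere x r) = 0)
    (x : EuclideanSpace ℝ (Fin dx)) :
    ∀ᵐ X ∂(Measure.pi fun _ : Fin n => μ), ∀ i j, i ≠ j → dist (X i) x ≠ dist (X j) x := by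
  refine ae_all_iff.2 fun i => ae_all_iff.2 fun j => ?_
  by_cases hij : i = j
  · exact ae_of_all _ fun X h => absurd hij h
  have hN : MeasurableSet {X : Fin n → EuclideanSpace ℝ (Fin dx) | dist (X i) x = dist (X j) x} :=
    measurableSet_eq_fun ((measurable_pi_apply i).dist measurable_const)
      ((measurable_pi_apply j).dist measurable_const)
  have h := pi_null_of_update_null (μ := μ) hN i fun X => by
    refine le_antisymm ((measure_mono ?_).trans (hμ x (dist (X j) x)).le) bot_le
    intro t ht
    have ht' : dist (Function.update X i t i) x = dist (Function.update X i t j) x := ht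
    rwa [Function.update_self, Function.update_of_ne (Ne.symm hij)] at ht'
  filter_upwards [measure_eq_zero_iff_ae_notMem.1 h] with X hX _ using hX

lemma ae_forall_dist_data_ne (hμ : ∀ x r, μ (Metric.sphere x r) = 0) :
    ∀ᵐ X ∂(Measure.pi fun _ : Fin n => μ), ∀ l i j, i ≠ j →
      dist (X i) (X l) ≠ dist (X j) (X l) := by
  have key : ∀ l i j : Fin n, i ≠ j → i ≠ l →
      ∀ᵐ X ∂(Measure.pi fun _ : Fin n => μ), dist (X i) (X l) ≠ dist (X j) (X l) := by
    intro l i j hij hil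
    have hN : MeasurableSet {X : Fin n → EuclideanSpace ℝ (Fin dx) |
        dist (X i) (X l) = dist (X j) (X l)} :=
      measurableSet_eq_fun ((measurable_pi_apply i).dist (measurable_pi_apply l))
        ((measurable_pi_apply j).dist (measurable_pi_apply l))
    have h := pi_null_of_update_null (μ := μ) hN i fun X => by
      refine le_antisymm ((measure_mono ?_).trans (hμ (X l) (dist (X j) (X l))).le) bot_le
      intro t ht
      have ht' : dist (Function.update X i t i) (Function.update X i t l)
          = dist (Function.update X i t j) (Function.update X i t l) := ht
      rwa [Function.update_self, Function.update_of_ne (Ne.symm hij),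
        Function.update_of_ne (Ne.symm hil)] at ht'
    exact measure_eq_zero_iff_ae_notMem.1 h
  refine ae_all_iff.2 fun l => ae_all_iff.2 fun i => ae_all_iff.2 fun j => ?_
  by_cases hij : i = j
  · exact ae_of_all _ fun X h => absurd hij h
  by_cases hil : i = l
  -- The moved covariate must not be the centre of the sphere, so the other one is moved instead.
  · filter_upwards [key l j i (Ne.symm hij) (fun h => hij (hil.trans h.symm))] with X hX _
    exact hX.symm
  · filter_upwards [key l i j hij hil] with X hX _ using hX

lemma IsNearestNeighborSet.eq_of_dist_ne {k : ℕ} {X : Fin n → EuclideanSpace ℝ (Fin dx)}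
    {x : EuclideanSpace ℝ (Fin dx)} (hne : ∀ i j, i ≠ j → dist (X i) x ≠ dist (X j) x)
    {S T : Finset (Fin n)} (hS : IsNearestNeighborSet k X x S) (hT : IsNearestNeighborSet k X x T) :
    S = T := by
  classical
  refine Finset.eq_of_subset_of_card_le ?_ (hT.1.trans hS.1.symm).le
  by_contra hsub
  obtain ⟨i, hiS, hiT⟩ := Finset.not_subset.1 hsub
  have hsub' : ¬ T ⊆ S := fun h =>
    hiT ((Finset.eq_of_subset_of_card_le h (hS.1.trans hT.1.symm).le) ▸ hiS)
  obtain ⟨j, hjT, hjS⟩ := Finset.not_subset.1 hsub'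
  exact hne i j (fun h => hiT (h ▸ hjT)) (le_antisymm (hS.2 i hiS j hjS) (hT.2 j hjT i hiT))

lemma IsNearestNeighborSet.self_mem {k : ℕ} (hk : 0 < k) {X : Fin n → EuclideanSpace ℝ (Fin dx)}
    {l : Fin n} (hne : ∀ i j, i ≠ j → dist (X i) (X l) ≠ dist (X j) (X l))
    {S : Finset (Fin n)} (hS : IsNearestNeighborSet k X (X l) S) : l ∈ S := by
  by_contra hl
  obtain ⟨i, hi⟩ := Finset.card_pos.1 (hS.1 ▸ hk)
  have h := hS.2 i hi l hl
  rw [dist_self] at h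
  refine hne i l (fun h => hl (h ▸ hi)) ?_
  rw [dist_self]
  exact le_antisymm h dist_nonneg

end Ties

/-! ### Conditioning on the covariates -/

section Conditioning

variable {dx n : ℕ} {Y : Type*} [MeasurableSpace Y]
  {μ : Measure (EuclideanSpace ℝ (Fin dx))} [IsProbabilityMeasure μ] {Q : Measure Y}
  [IsProbabilityMeasure Q]

lemma measurePreserving_pairing (μ : Measure (EuclideanSpace ℝ (Fin dx))) [IsProbabilityMeasure μ]
    (Q : Measure Y) [IsProbabilityMeasure Q] (n : ℕ) :
    MeasurePreserving (MeasurableEquiv.arrowProdEquivProdArrow (EuclideanSpace ℝ (Fin dx)) Y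
      (Fin n)).symm ((Measure.pi fun _ : Fin n => μ).prod (Measure.pi fun _ : Fin n => Q))
      (datasetLaw (μ.prod Q) n) :=
  MeasurePreserving.symm _
    (measurePreserving_arrowProdEquivProdArrow _ _ _ (fun _ => μ) (fun _ => Q))

/-- Under a product law covariates and outcomes are independent samples, so conditioning on the
covariates is Fubini's theorem and leaves the outcomes i.i.d. from `Q`. -/
lemma integral_dataset_eq {g : (Fin n → EuclideanSpace ℝ (Fin dx) × Y) → ℝ}
    (hg : Integrable g (datasetLaw (μ.prod Q) n)) :
    Integrable (fun X => ∫ ω, g (fun i => (X i, ω i)) ∂(Measure.pi fun _ : Fin n => Q))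
      (Measure.pi fun _ : Fin n => μ) ∧
    ∫ D, g D ∂(datasetLaw (μ.prod Q) n) = ∫ X, ∫ ω, g (fun i => (X i, ω i))
      ∂(Measure.pi fun _ : Fin n => Q) ∂(Measure.pi fun _ : Fin n => μ) := by
  have hmp := measurePreserving_pairing μ Q n
  have hi := hmp.integrable_comp_of_integrable hg
  exact ⟨hi.integral_prod_left, (hmp.integral_comp' g).symm.trans (integral_prod _ hi)⟩

lemma le_integral_dataset {g : (Fin n → EuclideanSpace ℝ (Fin dx) × Y) → ℝ}
    (hg : Integrable g (datasetLaw (μ.prod Q) n)) {a : ℝ}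
    (h : ∀ᵐ X ∂(Measure.pi fun _ : Fin n => μ),
      a ≤ ∫ ω, g (fun i => (X i, ω i)) ∂(Measure.pi fun _ : Fin n => Q)) :
    a ≤ ∫ D, g D ∂(datasetLaw (μ.prod Q) n) := by
  obtain ⟨h1, h2⟩ := integral_dataset_eq hg
  have h3 := integral_mono_ae (integrable_const a) h1 h
  rw [h2]
  simpa using h3

lemma integral_dataset_le {g : (Fin n → EuclideanSpace ℝ (Fin dx) × Y) → ℝ}
    (hg : Integrable g (datasetLaw (μ.prod Q) n)) {a : ℝ}
    (h : ∀ᵐ X ∂(Measure.pi fun _ : Fin n => μ),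
      ∫ ω, g (fun i => (X i, ω i)) ∂(Measure.pi fun _ : Fin n => Q) ≤ a) :
    ∫ D, g D ∂(datasetLaw (μ.prod Q) n) ≤ a := by
  obtain ⟨h1, h2⟩ := integral_dataset_eq hg
  have h3 := integral_mono_ae h1 (integrable_const a) h
  rw [h2]
  simpa using h3

end Conditioning

/-! ### The decisions of a kNN learner given the covariates -/

section Learner

variable {dx dz n k : ℕ} {Y : Type*} [MeasurableSpace Y] {ℓ : EuclideanSpace ℝ (Fin dz) → Y → ℝ}
  {Z : Set (EuclideanSpace ℝ (Fin dz))}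
  {zhat : (Fin n → EuclideanSpace ℝ (Fin dx) × Y) → EuclideanSpace ℝ (Fin dx) →
    EuclideanSpace ℝ (Fin dz)}

lemma IsKNNLearner.mem (h : IsKNNLearner ℓ Z n k zhat)
    (D : Fin n → EuclideanSpace ℝ (Fin dx) × Y) (x : EuclideanSpace ℝ (Fin dx)) :
    zhat D x ∈ Z := by
  obtain ⟨-, argmin, harg, h⟩ := h
  obtain ⟨S, -, hS⟩ := h D x
  rw [hS]
  exact (harg _).1

/-- Without distance ties, the decision at `x` given the covariates is the minimizer of the total
cost over a fixed set of neighbours, and depends on the total cost only. -/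
lemma IsKNNLearner.exists_neighbors (h : IsKNNLearner ℓ Z n k zhat)
    {X : Fin n → EuclideanSpace ℝ (Fin dx)} {x : EuclideanSpace ℝ (Fin dx)}
    (hne : ∀ i j, i ≠ j → dist (X i) x ≠ dist (X j) x) (hY : Nonempty Y) :
    ∃ S, IsNearestNeighborSet k X x S ∧
      IsEmpiricalMinimizer ℓ Z S (fun ω => zhat (fun i => (X i, ω i)) x) ∧
      ∀ ω ω' : Fin n → Y, totalCost ℓ S ω = totalCost ℓ S ω' →
        zhat (fun i => (X i, ω i)) x = zhat (fun i => (X i, ω' i)) x := by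
  obtain ⟨hm, argmin, harg, h⟩ := h
  obtain ⟨y⟩ := hY
  -- Without ties the neighbours are determined by the covariates, so outcomes chosen arbitrarily
  -- already reveal the set used for all outcomes.
  obtain ⟨S, hS, -⟩ := h (fun i => (X i, y)) x
  have hz : ∀ ω : Fin n → Y, zhat (fun i => (X i, ω i)) x = argmin (totalCost ℓ S ω) := by
    intro ω
    obtain ⟨T, hT, hzT⟩ := h (fun i => (X i, ω i)) x
    rw [IsNearestNeighborSet.eq_of_dist_ne hne hS hT]
    exact hzT
  refine ⟨S, hS, ⟨?_, fun ω => ?_, fun ω hex => ?_⟩, fun ω ω' hω => ?_⟩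
  · have h1 : Measurable fun ω : Fin n → Y => ((fun i => (X i, ω i)), x) :=
      (measurable_pi_lambda _ fun i => measurable_const.prodMk (measurable_pi_apply i)).prodMk
        measurable_const
    exact hm.comp h1
  · rw [hz]; exact (harg _).1
  · rw [hz]; exact (harg _).2 hex
  · rw [hz, hz, hω]

end Learner

/-- The costs of a symmetric decision at the outcomes of the sample have the same expectation. -/
lemma integral_cost_eq_of_symmetric {dz n : ℕ} {Y : Type*} [MeasurableSpace Y]
    {ℓ : EuclideanSpace ℝ (Fin dz) → Y → ℝ} {Q : Measure Y} [IsProbabilityMeasure Q]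
    {S : Finset (Fin n)} {z : (Fin n → Y) → EuclideanSpace ℝ (Fin dz)}
    (hz : ∀ ω ω' : Fin n → Y, totalCost ℓ S ω = totalCost ℓ S ω' → z ω = z ω') {i j : Fin n}
    (hi : i ∈ S) (hj : j ∈ S) :
    ∫ ω, ℓ (z ω) (ω i) ∂(Measure.pi fun _ : Fin n => Q)
      = ∫ ω, ℓ (z ω) (ω j) ∂(Measure.pi fun _ : Fin n => Q) := by
  -- Exchanging two outcomes in `S` preserves their joint law and the objective, hence the decision.
  have hmp := measurePreserving_piCongrLeft (α := fun _ : Fin n => Y) (fun _ => Q) (Equiv.swap i j)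
  rw [← hmp.integral_comp' fun ω => ℓ (z ω) (ω i)]
  refine integral_congr_ae (ae_of_all _ fun ω => ?_)
  set ω' := MeasurableEquiv.piCongrLeft (fun _ : Fin n => Y) (Equiv.swap i j) ω
  have hω' : ∀ l, ω' l = ω (Equiv.swap i j l) := fun l => by
    have h := Equiv.piCongrLeft_apply_apply (fun _ : Fin n => Y) (Equiv.swap i j) ω
      (Equiv.swap i j l)
    rw [Equiv.swap_apply_self] at h
    exact h
  have hcost : totalCost ℓ S ω' = totalCost ℓ S ω := by
    funext w
    refine Finset.sum_equiv (Equiv.swap i j) (fun l => ?_) fun l _ => by rw [hω']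
    rcases eq_or_ne l i with rfl | hli
    · simp [hi, hj]
    · rcases eq_or_ne l j with rfl | hlj
      · simp [hi, hj]
      · rw [Equiv.swap_apply_of_ne_of_ne hli hlj]
  change ℓ (z ω') (ω' i) = ℓ (z ω) (ω j)
  rw [hz ω' ω hcost, hω', Equiv.swap_apply_left]

/-! ### Bias and variability of kNN learners -/

namespace Assumptions

variable {dx dz : ℕ} {Y : Type*} [MeasurableSpace Y] {M : ℝ} {ℓ : EuclideanSpace ℝ (Fin dz) → Y → ℝ}
  {Z : Set (EuclideanSpace ℝ (Fin dz))} {Q : Measure Y} {z₀ : EuclideanSpace ℝ (Fin dz)}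
  {μ : Measure (EuclideanSpace ℝ (Fin dx))} {n k : ℕ}
  {zhat : (Fin n → EuclideanSpace ℝ (Fin dx) × Y) → EuclideanSpace ℝ (Fin dx) →
    EuclideanSpace ℝ (Fin dz)}

instance isProbabilityMeasure_datasetLaw {P : Measure (EuclideanSpace ℝ (Fin dx) × Y)}
    [IsProbabilityMeasure P] : IsProbabilityMeasure (datasetLaw P n) := by
  unfold datasetLaw; infer_instance

lemma integrable_cost_at (hA : Assumptions M ℓ Z Q z₀) (hℓ : Measurable (Function.uncurry ℓ))
    [IsProbabilityMeasure μ] (h : IsKNNLearner ℓ Z n k zhat) (i : Fin n) :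
    Integrable (fun D => ℓ (zhat D (D i).1) (D i).2) (datasetLaw (μ.prod Q) n) := by
  have := hA.isProbabilityMeasure
  have hi : Measurable fun D : Fin n → EuclideanSpace ℝ (Fin dx) × Y => D i := measurable_pi_apply i
  have h1 : ∀ᵐ p ∂(μ.prod Q), ∀ z ∈ Z, |ℓ z p.2| ≤ M :=
    Measure.quasiMeasurePreserving_snd.ae hA.cost_bounded
  have h2 : ∀ᵐ D ∂(datasetLaw (μ.prod Q) n), ∀ i, ∀ z ∈ Z, |ℓ z (D i).2| ≤ M :=
    ae_pi_of_ae (ι := Fin n) h1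
  exact Integrable.of_bound (hℓ.comp ((h.1.comp (measurable_id.prodMk hi.fst)).prodMk
    hi.snd)).aestronglyMeasurable M (h2.mono fun D hD => hD i _ (h.mem D _))

lemma integrable_plugInCost (hA : Assumptions M ℓ Z Q z₀) (hℓ : Measurable (Function.uncurry ℓ))
    [IsProbabilityMeasure μ] (h : IsKNNLearner ℓ Z n k zhat) :
    Integrable (fun D => plugInCost ℓ D (zhat D)) (datasetLaw (μ.prod Q) n) :=
  (integrable_finsetSum _ fun i _ => hA.integrable_cost_at hℓ h i).div_const _

lemma trueCost_eq (hA : Assumptions M ℓ Z Q z₀) (hℓ : Measurable (Function.uncurry ℓ))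
    [IsProbabilityMeasure μ] (h : IsKNNLearner ℓ Z n k zhat)
    (D : Fin n → EuclideanSpace ℝ (Fin dx) × Y) :
    trueCost ℓ (μ.prod Q) (zhat D) = ∫ x, expectedCost ℓ Q (zhat D x) ∂μ := by
  have := hA.isProbabilityMeasure
  have h1 : ∀ᵐ p ∂(μ.prod Q), ∀ z ∈ Z, |ℓ z p.2| ≤ M :=
    Measure.quasiMeasurePreserving_snd.ae hA.cost_bounded
  refine integral_prod _ (Integrable.of_bound (hℓ.comp ((h.1.comp (measurable_const.prodMk
    measurable_fst)).prodMk measurable_snd)).aestronglyMeasurable M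
    (h1.mono fun p hp => hp _ (h.mem D _)))

lemma measurable_expectedCost_uncurry (hA : Assumptions M ℓ Z Q z₀)
    (hℓ : Measurable (Function.uncurry ℓ)) (h : IsKNNLearner ℓ Z n k zhat) :
    Measurable fun p : (Fin n → EuclideanSpace ℝ (Fin dx) × Y) × EuclideanSpace ℝ (Fin dx) =>
      expectedCost ℓ Q (zhat p.1 p.2) :=
  (hA.measurable_expectedCost hℓ).comp h.1

lemma integrable_trueCost (hA : Assumptions M ℓ Z Q z₀) (hℓ : Measurable (Function.uncurry ℓ))
    [IsProbabilityMeasure μ] (h : IsKNNLearner ℓ Z n k zhat) :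
    Integrable (fun D => trueCost ℓ (μ.prod Q) (zhat D)) (datasetLaw (μ.prod Q) n) := by
  have := hA.isProbabilityMeasure
  simp_rw [hA.trueCost_eq hℓ h]
  refine Integrable.of_bound (hA.measurable_expectedCost_uncurry hℓ
    h).stronglyMeasurable.integral_prod_right'.aestronglyMeasurable M (ae_of_all _ fun D => ?_)
  have h1 := norm_integral_le_of_norm_le_const (μ := μ) (f := fun x => expectedCost ℓ Q (zhat D x))
    (ae_of_all _ fun x => hA.abs_expectedCost_le (h.mem D x))
  simpa using h1

lemma measurable_decision (h : IsKNNLearner ℓ Z n k zhat) (x : EuclideanSpace ℝ (Fin dx)) :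
    Measurable fun D => zhat D x := h.1.comp (measurable_id.prodMk measurable_const)

lemma integrable_decision (hA : Assumptions M ℓ Z Q z₀) [IsProbabilityMeasure μ]
    (h : IsKNNLearner ℓ Z n k zhat) (x : EuclideanSpace ℝ (Fin dx)) :
    Integrable (fun D => zhat D x) (datasetLaw (μ.prod Q) n) := by
  have := hA.isProbabilityMeasure
  obtain ⟨C, hC⟩ := hA.isBounded.exists_norm_le
  exact Integrable.of_bound (measurable_decision h x).aestronglyMeasurable C
    (ae_of_all _ fun D => hC _ (h.mem D x))

/-- By exchangeability each neighbour carries an equal share of the expected minimal total cost.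
This turns optimism of the minimum into bias at a data point. -/
lemma integral_cost_at_mul (hA : Assumptions M ℓ Z Q z₀) (hℓ : Measurable (Function.uncurry ℓ))
    {S : Finset (Fin n)} {z : (Fin n → Y) → EuclideanSpace ℝ (Fin dz)}
    (hz : IsEmpiricalMinimizer ℓ Z S z)
    (hsym : ∀ ω ω' : Fin n → Y, totalCost ℓ S ω = totalCost ℓ S ω' → z ω = z ω') {i : Fin n}
    (hi : i ∈ S) :
    S.card * ∫ ω, ℓ (z ω) (ω i) ∂(Measure.pi fun _ : Fin n => Q)
      = ∫ ω, totalCost ℓ S ω (z ω) ∂(Measure.pi fun _ : Fin n => Q) := by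
  have := hA.isProbabilityMeasure
  simp only [totalCost]
  rw [integral_finsetSum, Finset.sum_congr rfl fun j hj =>
    integral_cost_eq_of_symmetric hsym hj hi]
  · simp
  · intro j _
    exact Integrable.of_bound (hℓ.comp (hz.measurable.prodMk
      (measurable_pi_apply j))).aestronglyMeasurable M
      ((ae_pi_of_ae (ι := Fin n) hA.cost_bounded).mono fun ω hω => hω j _ (hz.mem ω))

/-- Variability and bias of a kNN learner whose outcomes do not depend on the covariates. -/
theorem exists_learner_bounds (hA : Assumptions M ℓ Z Q z₀) (hℓ : Measurable (Function.uncurry ℓ))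
    (hnondeg : ¬ ∀ᵐ y ∂Q, fderiv ℝ (fun z => ℓ z y) z₀ = 0) (dx : ℕ) :
    ∃ c > 0, ∃ C > 0, ∃ k₀ : ℕ, ∀ (μ : Measure (EuclideanSpace ℝ (Fin dx)))
      [IsProbabilityMeasure μ], (∀ x r, μ (Metric.sphere x r) = 0) →
      ∀ (n k : ℕ) zhat, 0 < n → 0 < k → k₀ ≤ k → IsKNNLearner ℓ Z n k zhat →
      (∀ x, c / √k ≤ variability (μ.prod Q) n zhat x ∧
        variability (μ.prod Q) n zhat x ≤ C / √k) ∧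
      plugInBias ℓ (μ.prod Q) n zhat ≤ -(c / k) ∧ -(C / k) ≤ plugInBias ℓ (μ.prod Q) n zhat := by
  have := hA.isProbabilityMeasure
  obtain ⟨C, hC, hup⟩ := hA.exists_upper_bounds hℓ
  -- The bias compares with `z₀` itself, so `K = 0` is enough.
  obtain ⟨c₁, hc₁, k₁, hdec⟩ := hA.exists_le_integral_totalCost_sub hℓ hnondeg le_rfl
  obtain ⟨c₂, hc₂, k₂, hspr⟩ := hA.exists_le_integral_norm_sub hℓ hnondeg
  -- `c₁` serves the bias and `c₂` the variability. The factor `2` comes from replacing `z₀` by the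
  -- mean decision in one case, and from adding the in-sample and out-of-sample errors in the other.
  refine ⟨min c₁ c₂, lt_min hc₁ hc₂, 2 * C, by positivity, max k₁ k₂,
    fun μ _ hμ n k zhat hn hk0 hk h => ?_⟩
  obtain ⟨y₀, -⟩ := hA.cost_bounded.exists
  have hkR : (0 : ℝ) < k := by exact_mod_cast hk0
  have hsk : 0 < √(k : ℝ) := Real.sqrt_pos.2 hkR
  have hSne : ∀ {X : Fin n → EuclideanSpace ℝ (Fin dx)} {x S}, IsNearestNeighborSet k X x S →
      S.Nonempty := fun hS => Finset.card_pos.1 (hS.1 ▸ hk0)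
  constructor
  · intro x
    have hD := hA.integrable_decision (μ := μ) h x
    have hnorm : ∀ b, Integrable (fun D => ‖zhat D x - b‖) (datasetLaw (μ.prod Q) n) :=
      fun b => (hD.sub (integrable_const b)).norm
    constructor
    · refine le_integral_dataset (hnorm _) ?_
      filter_upwards [ae_forall_dist_ne hμ x] with X hX
      obtain ⟨S, hS, hz, -⟩ := h.exists_neighbors hX ⟨y₀⟩
      have h1 := hspr S (hSne hS) (hS.1 ▸ (le_max_right _ _).trans hk) _ hz
        (∫ D', zhat D' x ∂(datasetLaw (μ.prod Q) n))
      rw [integral_const_mul, hS.1] at h1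
      rw [div_le_iff₀ hsk, mul_comm]
      exact (min_le_right _ _).trans h1
    · have h1 : ∫ D, ‖zhat D x - z₀‖ ∂(datasetLaw (μ.prod Q) n) ≤ C / √k := by
        refine integral_dataset_le (hnorm _) ?_
        filter_upwards [ae_forall_dist_ne hμ x] with X hX
        obtain ⟨S, hS, hz, -⟩ := h.exists_neighbors hX ⟨y₀⟩
        have h1 := (hup S (hSne hS) _ hz).2.1
        rw [integral_const_mul, hS.1] at h1
        rw [le_div_iff₀ hsk, mul_comm]
        exact h1
      set b := ∫ D', zhat D' x ∂(datasetLaw (μ.prod Q) n)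
      have h2 : ‖z₀ - b‖ ≤ ∫ D, ‖zhat D x - z₀‖ ∂(datasetLaw (μ.prod Q) n) := by
        have h3 := norm_integral_le_integral_norm (μ := datasetLaw (μ.prod Q) n)
          (fun D => zhat D x - z₀)
        rw [integral_sub hD (integrable_const _), integral_const, probReal_univ, one_smul] at h3
        rwa [norm_sub_rev]
      have h3 := integral_mono (hnorm b) ((hnorm z₀).add (integrable_const ‖z₀ - b‖)) fun D => by
        simpa using norm_add_le (zhat D x - z₀) (z₀ - b)
      simp only [Pi.add_apply] at h3
      rw [integral_add (hnorm z₀) (integrable_const _), integral_const, probReal_univ,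
        one_smul] at h3
      calc variability (μ.prod Q) n zhat x ≤ C / √k + C / √k := by
            unfold variability; linarith
        _ = 2 * C / √k := by ring
  · have hbias : plugInBias ℓ (μ.prod Q) n zhat = ∫ D, plugInCost ℓ D (zhat D)
        ∂(datasetLaw (μ.prod Q) n) - ∫ D, trueCost ℓ (μ.prod Q) (zhat D)
        ∂(datasetLaw (μ.prod Q) n) :=
      integral_sub (hA.integrable_plugInCost hℓ h) (hA.integrable_trueCost hℓ h)
    have hplug : ∀ i : Fin n, expectedCost ℓ Q z₀ - C / k ≤
        ∫ D, ℓ (zhat D (D i).1) (D i).2 ∂(datasetLaw (μ.prod Q) n) ∧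
        ∫ D, ℓ (zhat D (D i).1) (D i).2 ∂(datasetLaw (μ.prod Q) n)
          ≤ expectedCost ℓ Q z₀ - c₁ / k := by
      intro i
      have key : ∀ᵐ X ∂(Measure.pi fun _ : Fin n => μ), expectedCost ℓ Q z₀ - C / k ≤
          ∫ ω, ℓ (zhat (fun j => (X j, ω j)) (X i)) (ω i) ∂(Measure.pi fun _ : Fin n => Q) ∧
          ∫ ω, ℓ (zhat (fun j => (X j, ω j)) (X i)) (ω i) ∂(Measure.pi fun _ : Fin n => Q)
            ≤ expectedCost ℓ Q z₀ - c₁ / k := by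
        filter_upwards [ae_forall_dist_data_ne hμ] with X hX
        obtain ⟨S, hS, hz, hsym⟩ := h.exists_neighbors (hX i) ⟨y₀⟩
        have hi := hS.self_mem hk0 (hX i)
        have h1 := hA.integral_cost_at_mul hℓ hz hsym hi
        have h2 := (hup S (hSne hS) _ hz).2.2.2
        have h3 := (hdec S (hSne hS) (hS.1 ▸ (le_max_left _ _).trans hk) _ hz z₀
          (by simp)).2
        rw [integral_sub (hA.integrable_totalCost hℓ S hA.mem)
          (hA.integrable_totalCost_comp hℓ hz), hA.integral_totalCost hℓ hA.mem] at h3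
        rw [← h1] at h2 h3
        rw [hS.1] at h2 h3
        have e1 : (k : ℝ) * (C / k) = C := mul_div_cancel₀ C hkR.ne'
        have e2 : (k : ℝ) * (c₁ / k) = c₁ := mul_div_cancel₀ c₁ hkR.ne'
        constructor
        · refine le_of_mul_le_mul_left ?_ hkR
          rw [mul_sub, e1]
          linarith
        · refine le_of_mul_le_mul_left ?_ hkR
          rw [mul_sub, e2]
          linarith
      exact ⟨le_integral_dataset (hA.integrable_cost_at hℓ h i) (key.mono fun X hX => hX.1),
        integral_dataset_le (hA.integrable_cost_at hℓ h i) (key.mono fun X hX => hX.2)⟩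
    have hnR : (0 : ℝ) < n := by exact_mod_cast hn
    have hplugeq : ∫ D, plugInCost ℓ D (zhat D) ∂(datasetLaw (μ.prod Q) n)
        = (∑ i, ∫ D, ℓ (zhat D (D i).1) (D i).2 ∂(datasetLaw (μ.prod Q) n)) / n := by
      simp only [plugInCost]
      rw [integral_div, integral_finsetSum _ fun i _ => hA.integrable_cost_at hℓ h i]
    have hp1 : expectedCost ℓ Q z₀ - C / k
        ≤ ∫ D, plugInCost ℓ D (zhat D) ∂(datasetLaw (μ.prod Q) n) := by
      rw [hplugeq, le_div_iff₀ hnR]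
      have h1 := Finset.card_nsmul_le_sum Finset.univ _ _ fun i _ => (hplug i).1
      rw [Finset.card_univ, Fintype.card_fin, nsmul_eq_mul] at h1
      linarith
    have hp2 : ∫ D, plugInCost ℓ D (zhat D) ∂(datasetLaw (μ.prod Q) n)
        ≤ expectedCost ℓ Q z₀ - c₁ / k := by
      rw [hplugeq, div_le_iff₀ hnR]
      have h1 := Finset.sum_le_card_nsmul Finset.univ _ _ fun i _ => (hplug i).2
      rw [Finset.card_univ, Fintype.card_fin, nsmul_eq_mul] at h1
      linarith
    have hx : ∀ x, expectedCost ℓ Q z₀ ≤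
        ∫ D, expectedCost ℓ Q (zhat D x) ∂(datasetLaw (μ.prod Q) n) ∧
        ∫ D, expectedCost ℓ Q (zhat D x) ∂(datasetLaw (μ.prod Q) n)
          ≤ expectedCost ℓ Q z₀ + C / k := by
      intro x
      have hi : Integrable (fun D => expectedCost ℓ Q (zhat D x)) (datasetLaw (μ.prod Q) n) :=
        Integrable.of_bound ((hA.measurable_expectedCost hℓ).comp
          (measurable_decision h x)).aestronglyMeasurable M
          (ae_of_all _ fun D => hA.abs_expectedCost_le (h.mem D x))
      constructor
      · have h1 := integral_mono (integrable_const (expectedCost ℓ Q z₀)) hi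
          fun D => hA.expectedCost_le (h.mem D x)
        simpa using h1
      · refine integral_dataset_le hi ?_
        filter_upwards [ae_forall_dist_ne hμ x] with X hX
        obtain ⟨S, hS, hz, -⟩ := h.exists_neighbors hX ⟨y₀⟩
        have h1 := (hup S (hSne hS) _ hz).2.2.1
        rw [integral_const_mul, integral_sub (hA.integrable_expectedCost_comp hℓ hz)
          (integrable_const _), integral_const, probReal_univ, one_smul, hS.1] at h1
        rw [← sub_le_iff_le_add', le_div_iff₀ hkR, mul_comm]
        exact h1
    have hswap : ∫ D, trueCost ℓ (μ.prod Q) (zhat D) ∂(datasetLaw (μ.prod Q) n)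
        = ∫ x, ∫ D, expectedCost ℓ Q (zhat D x) ∂(datasetLaw (μ.prod Q) n) ∂μ := by
      simp_rw [hA.trueCost_eq hℓ h]
      exact integral_integral_swap (Integrable.of_bound
        (hA.measurable_expectedCost_uncurry hℓ h).aestronglyMeasurable M
        (ae_of_all _ fun p => hA.abs_expectedCost_le (h.mem p.1 p.2)))
    have hxi : Integrable (fun x => ∫ D, expectedCost ℓ Q (zhat D x)
        ∂(datasetLaw (μ.prod Q) n)) μ :=
      (Integrable.of_bound (hA.measurable_expectedCost_uncurry hℓ h).aestronglyMeasurable M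
        (ae_of_all _ fun p => hA.abs_expectedCost_le (h.mem p.1 p.2))).integral_prod_right
    have ht1 := integral_mono (integrable_const _) hxi fun x => (hx x).1
    have ht2 := integral_mono hxi (integrable_const _) fun x => (hx x).2
    simp only [integral_const, probReal_univ, one_smul] at ht1 ht2
    rw [hbias, hswap]
    have hcc : min c₁ c₂ / k ≤ c₁ / k := by gcongr; exact min_le_left _ _
    have e3 : 2 * C / k = C / k + C / k := by ring
    constructor <;> linarith

end Assumptions

/-! ### The covariates -/

/-- Unit balls with centers at distance at least `5` of each other. -/
def ballRegion {dx : ℕ} (hdx : 0 < dx) (m : ℕ) (j : Fin m) : Set (EuclideanSpace ℝ (Fin dx)) :=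
  Metric.ball (EuclideanSpace.single ⟨0, hdx⟩ (5 * (j : ℝ))) 1

lemma separatedRegions_ballRegion {dx : ℕ} (hdx : 0 < dx) (m : ℕ) :
    SeparatedRegions (ballRegion hdx m) where
  measurableSet _ := Metric.isOpen_ball.measurableSet
  isBounded _ := Metric.isBounded_ball
  volume_pos _ := Metric.measure_ball_pos _ _ one_pos
  volume_eq i j := by
    rw [ballRegion, ballRegion, Measure.addHaar_ball_center, ← Measure.addHaar_ball_center]
  separated i j hij := by
    -- Centres at distance `5` and radii `1` leave a gap of `5 - 1 - 1 = 3`, above the diameter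
    -- bound `2`.
    refine ⟨3, (Metric.diam_ball zero_le_one).trans_lt (by norm_num), fun x hx y hy => ?_⟩
    have h1 : (5 : ℝ) ≤ dist (EuclideanSpace.single (⟨0, hdx⟩ : Fin dx) (5 * (i : ℝ)))
        (EuclideanSpace.single ⟨0, hdx⟩ (5 * (j : ℝ))) := by
      rw [PiLp.dist_single_same 2 (fun _ => ℝ), Real.dist_eq, ← mul_sub, abs_mul,
        abs_of_pos (by norm_num : (0 : ℝ) < 5)]
      have h2 : (1 : ℝ) ≤ |(i : ℝ) - j| := by
        have h3 : (1 : ℤ) ≤ |(i : ℤ) - j| := by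
          refine Int.one_le_abs (sub_ne_zero.2 fun h => hij (Fin.ext ?_))
          exact_mod_cast h
        exact_mod_cast h3
      linarith
    have h2 := Metric.mem_ball.1 hx
    have h3 := Metric.mem_ball.1 hy
    have h4 := dist_triangle4 (EuclideanSpace.single (⟨0, hdx⟩ : Fin dx) (5 * (i : ℝ))) x y
      (EuclideanSpace.single ⟨0, hdx⟩ (5 * (j : ℝ)))
    rw [dist_comm _ x] at h4
    linarith

/-- The mixture, with equal weights, of the uniform laws on the regions `R i`. -/
def covariateLaw {dx m : ℕ} (R : Fin m → Set (EuclideanSpace ℝ (Fin dx))) :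
    Measure (EuclideanSpace ℝ (Fin dx)) :=
  (m : ℝ≥0∞)⁻¹ • ∑ i, ProbabilityTheory.cond volume (R i)

lemma isProbabilityMeasure_covariateLaw {dx m : ℕ} (hm : m ≠ 0)
    {R : Fin m → Set (EuclideanSpace ℝ (Fin dx))} (hR : SeparatedRegions R) :
    IsProbabilityMeasure (covariateLaw R) := by
  have h1 : ∀ i, ProbabilityTheory.cond volume (R i) Set.univ = 1 := fun i =>
    (ProbabilityTheory.cond_isProbabilityMeasure_of_finite (hR.volume_pos i).ne'
      (hR.isBounded i).measure_lt_top.ne).measure_univ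
  refine ⟨?_⟩
  simp only [covariateLaw, Measure.smul_apply, Measure.finsetSum_apply, h1, Finset.sum_const,
    Finset.card_univ, Fintype.card_fin, nsmul_eq_mul, mul_one, smul_eq_mul]
  exact ENNReal.inv_mul_cancel (by exact_mod_cast hm) (ENNReal.natCast_ne_top m)

/-- Excludes distance ties. Positive dimension matters: spheres include single points, as radius
zero is allowed. -/
lemma covariateLaw_sphere {dx m : ℕ} (hdx : 0 < dx) (R : Fin m → Set (EuclideanSpace ℝ (Fin dx)))
    (x : EuclideanSpace ℝ (Fin dx)) (r : ℝ) : covariateLaw R (Metric.sphere x r) = 0 := by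
  have : Nonempty (Fin dx) := ⟨⟨0, hdx⟩⟩
  have h1 : ∀ i, ProbabilityTheory.cond volume (R i) (Metric.sphere x r) = 0 := fun i =>
    ProbabilityTheory.cond_absolutelyContinuous (Measure.addHaar_sphere volume x r)
  simp [covariateLaw, Measure.smul_apply, Measure.finsetSum_apply, h1]

lemma clusterMixture_const {dx m : ℕ} {Y : Type*} [MeasurableSpace Y]
    (R : Fin m → Set (EuclideanSpace ℝ (Fin dx))) (Q : Measure Y) [IsProbabilityMeasure Q] :
    clusterMixture R (fun _ => Q) = (covariateLaw R).prod Q := by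
  rw [clusterMixture, covariateLaw, Measure.prod_smul_left, ← Measure.sum_fintype,
    ← Measure.sum_fintype, Measure.prod_sum_left]

end KNNBias

end
-- Choice of the laws and conversion of the rates from `k` to `n`.
theorem mainTheorem8 {dx dz : ℕ} (hdx : 0 < dx) {Y : Type*} [MeasurableSpace Y]
    (ℓ : EuclideanSpace ℝ (Fin dz) → Y → ℝ) (hℓ : Measurable (Function.uncurry ℓ))
    (Z : Set (EuclideanSpace ℝ (Fin dz))) (M : ℝ)
    -- some law of the outcome satisfies the assumptions, and is not degenerate
    (Q₀ : Measure Y) (z₀ : EuclideanSpace ℝ (Fin dz))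
    (hQ₀ : KNNBias.Assumptions M ℓ Z Q₀ z₀)
    (hnondeg : ¬ ∀ᵐ y ∂Q₀, fderiv ℝ (fun z => ℓ z y) z₀ = 0)
    -- the number of neighbours
    (k : ℕ → ℕ) (hk_le : ∀ n, k n ≤ n) (γv : ℝ) (hγv : 0 < γv) (hγv' : γv ≤ 1 / 2)
    (hk : (fun n : ℕ => (k n : ℝ)) =Θ[atTop] fun n : ℕ => (n : ℝ) ^ (2 * γv)) :
    ∃ (Q : ℕ → Measure Y) (zo : ℕ → EuclideanSpace ℝ (Fin dz))
      (R : ∀ n, Fin (max 1 (n / (2 * k n))) → Set (EuclideanSpace ℝ (Fin dx)))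
      (P : ℕ → Measure (EuclideanSpace ℝ (Fin dx) × Y)),
      (∀ j, KNNBias.Assumptions M ℓ Z (Q j) (zo j)) ∧
      (∀ n, KNNBias.SeparatedRegions (R n)) ∧
      (∀ n, P n = KNNBias.clusterMixture (R n) fun j => Q j) ∧
      (∀ n, IsProbabilityMeasure (P n)) ∧
      ∀ zhat : ∀ n, (Fin n → EuclideanSpace ℝ (Fin dx) × Y) → EuclideanSpace ℝ (Fin dx) →
          EuclideanSpace ℝ (Fin dz),
        (∀ n, KNNBias.IsKNNLearner ℓ Z n (k n) (zhat n)) →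
        (∀ n, Integrable (fun D => KNNBias.plugInCost ℓ D (zhat n D))
            (KNNBias.datasetLaw (P n) n) ∧
          Integrable (fun D => KNNBias.trueCost ℓ (P n) (zhat n D))
            (KNNBias.datasetLaw (P n) n)) ∧
        KNNBias.HasVariabilityRate P zhat γv ∧
        (∀ᶠ n in atTop, KNNBias.plugInBias ℓ (P n) n (zhat n) < 0) ∧
        (fun n => KNNBias.plugInBias ℓ (P n) n (zhat n)) =Θ[atTop] (fun n => 1 / (k n : ℝ)) ∧
        (fun n => KNNBias.plugInBias ℓ (P n) n (zhat n)) =Θ[atTop]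
          (fun n => (n : ℝ) ^ (-(2 * γv))) := by
  have hprob := hQ₀.isProbabilityMeasure
  set R : ∀ n, Fin (max 1 (n / (2 * k n))) → Set (EuclideanSpace ℝ (Fin dx)) :=
    fun n => KNNBias.ballRegion hdx _
  have hR : ∀ n, KNNBias.SeparatedRegions (R n) :=
    fun n => KNNBias.separatedRegions_ballRegion hdx _
  have hμ : ∀ n, IsProbabilityMeasure (KNNBias.covariateLaw (R n)) := fun n =>
    KNNBias.isProbabilityMeasure_covariateLaw
      (Nat.one_le_iff_ne_zero.1 (le_max_left _ _)) (hR n)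
  -- The same outcome law on every region makes covariate and outcome independent, so neighbours
  -- from other regions do no harm.
  refine ⟨fun _ => Q₀, fun _ => z₀, R, fun n => (KNNBias.covariateLaw (R n)).prod Q₀,
    fun _ => hQ₀, hR, fun n => (KNNBias.clusterMixture_const (R n) Q₀).symm,
    fun n => inferInstance, fun zhat hz => ?_⟩
  refine ⟨fun n => ⟨hQ₀.integrable_plugInCost hℓ (hz n), hQ₀.integrable_trueCost hℓ (hz n)⟩, ?_⟩
  obtain ⟨c, hc, C, hC, k₀, hbd⟩ := hQ₀.exists_learner_bounds hℓ hnondeg dx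
  obtain ⟨b, hb, hkb⟩ := hk.1.exists_pos
  obtain ⟨a, ha, hka⟩ := hk.2.exists_pos
  have hk_top : Tendsto (fun n => (k n : ℝ)) atTop atTop := by
    have h1 : Tendsto (fun n : ℕ => a⁻¹ * (n : ℝ) ^ (2 * γv)) atTop atTop :=
      ((tendsto_rpow_atTop (by positivity)).comp tendsto_natCast_atTop_atTop).const_mul_atTop
        (inv_pos.2 ha)
    refine tendsto_atTop_mono' _ ?_ h1
    filter_upwards [hka.bound] with n hn
    rw [Real.norm_of_nonneg (by positivity), Real.norm_of_nonneg (by positivity)] at hn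
    rwa [inv_mul_le_iff₀ ha]
  have hev : ∀ᶠ n in atTop, 0 < n ∧ 0 < k n ∧ k₀ ≤ k n := by
    filter_upwards [eventually_gt_atTop 0, hk_top.eventually_ge_atTop ((k₀ : ℝ) + 1)] with n h1 h2
    have h3 : k₀ + 1 ≤ k n := by exact_mod_cast h2
    omega
  have hall : ∀ᶠ n in atTop, 0 < k n ∧ _ := hev.mono fun n hn => ⟨hn.2.1,
    hbd (KNNBias.covariateLaw (R n)) (KNNBias.covariateLaw_sphere hdx (R n)) n (k n) (zhat n)
      hn.1 hn.2.1 hn.2.2 (hz n)⟩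
  have htheta : (fun n => KNNBias.plugInBias ℓ ((KNNBias.covariateLaw (R n)).prod Q₀) n (zhat n))
      =Θ[atTop] (fun n => 1 / (k n : ℝ)) := by
    constructor
    · refine IsBigO.of_bound C ?_
      filter_upwards [hall] with n hn
      obtain ⟨h1, -, h2, h3⟩ := hn
      have h4 : (0 : ℝ) < c / k n := by positivity
      rw [Real.norm_eq_abs, Real.norm_of_nonneg (by positivity), mul_one_div, abs_le]
      have h5 : (0 : ℝ) < C / k n := by positivity
      constructor <;> linarith
    · refine IsBigO.of_bound c⁻¹ ?_
      filter_upwards [hall] with n hn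
      obtain ⟨h1, -, h2, h3⟩ := hn
      rw [Real.norm_of_nonneg (by positivity), Real.norm_eq_abs, ← div_eq_inv_mul,
        le_div_iff₀ hc, one_div_mul_eq_div]
      linarith [neg_le_abs (KNNBias.plugInBias ℓ ((KNNBias.covariateLaw (R n)).prod Q₀) n (zhat n))]
  refine ⟨?_, ?_, htheta, ?_⟩
  -- From `k n ≤ b n ^ (2 γv)` and `n ^ (2 γv) ≤ a k n`, by taking square roots in the rate `1 /
  -- √k`.
  · refine ⟨c / √b, by positivity, C * √a, by positivity, ?_⟩
    filter_upwards [hall, hka.bound, hkb.bound, eventually_gt_atTop 0] with n hn hna hnb hn0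
    refine ae_of_all _ fun x => ?_
    have hnR : (0 : ℝ) < n := by exact_mod_cast hn0
    have hkR : (0 : ℝ) < k n := by exact_mod_cast hn.1
    obtain ⟨h1, h2⟩ := hn.2.1 x
    rw [Real.norm_of_nonneg (by positivity), Real.norm_of_nonneg (by positivity)] at hna hnb
    have hpow : √((n : ℝ) ^ (2 * γv)) = (n : ℝ) ^ γv := by
      rw [mul_comm, Real.rpow_mul hnR.le, Real.rpow_two, Real.sqrt_sq (by positivity)]
    have hpos : 0 < (n : ℝ) ^ γv := by positivity
    have hsk : 0 < √(k n : ℝ) := Real.sqrt_pos.2 hkR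
    have h3 : √(k n : ℝ) ≤ √b * (n : ℝ) ^ γv := by
      rw [← hpow, ← Real.sqrt_mul hb.le]
      exact Real.sqrt_le_sqrt hnb
    have h4 : (n : ℝ) ^ γv ≤ √a * √(k n : ℝ) := by
      rw [← hpow, ← Real.sqrt_mul ha.le]
      exact Real.sqrt_le_sqrt hna
    rw [Real.rpow_neg hnR.le]
    constructor
    · refine le_trans ?_ h1
      calc c / √b * ((n : ℝ) ^ γv)⁻¹ = c / (√b * (n : ℝ) ^ γv) := by
            rw [← div_div, div_eq_mul_inv _ ((n : ℝ) ^ γv)]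
        _ ≤ c / √(k n : ℝ) := by gcongr
    · refine h2.trans ?_
      rw [← div_eq_mul_inv, div_le_div_iff₀ hsk hpos, mul_assoc]
      gcongr
  · filter_upwards [hall] with n hn
    have : (0 : ℝ) < c / k n := by have := hn.1; positivity
    linarith [hn.2.2.1]
  · refine htheta.trans ?_
    simp only [one_div]
    refine hk.inv.trans_eventuallyEq ?_
    filter_upwards with n
    rw [Real.rpow_neg (Nat.cast_nonneg n)]
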